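/- **Theorem 2.2 (Regularity).** *Setting.* Let $\Omega\subset\mathbb R^3$ be a nonempty bounded connected open set, $H:=L^2(\Omega)$ with inner product $(\cdot,\cdot)$ and norm $\|\cdot\|$, and let $A:D(A)\subset H\to H$ and $B:D(B)\subset H\to H$ be unbounded monotone selfadjoint linear operators with compact resolvents. Let $0\le\lambda_1\le\lambda_2\le\dots\to\infty$ and $0\le\lambda_1'\le\lambda_2'\le\dots\to\infty$ be their eigenvalues, with complete orthonormal systems of eigenvectors $e_j$ and $e_j'$. For $s>0$ let $V_A^s:=D(A^s)=\{v\in H:\sum_j|\lambda_j^s(v,e_j)|^2<\infty\}$ and $A^sv:=\sum_j\lambda_j^s(v,e_j)e_j$, and define $V_B^s:=D(B^s)$ and $B^s$ in the same way. Fix $r,\sigma>0$ and assume that either $\lambda_1>0$, or $0=\lambda_1<\lambda_2$, $e_1$ is constant and the constant functions belong to $V_B^\sigma$. For $s>0$, $V_B^s$ carries the norm $(\|v\|^2+\|B^sv\|^2)^{1/2}$, and $V_A^s$ the norm $\|v\|_{A,s}:=\|A^sv\|$ if $\lambda_1>0$ and $\|v\|_{A,s}:=(|(v,e_1)|^2+\|A^sv\|^2)^{1/2}$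 if $\lambda_1=0$. Let $V_A^{-r}$ be the dual of $V_A^r$, with the dual norm and the duality pairing $\langle\cdot,\cdot\rangle$; $H$ is identified with a subspace of $V_A^{-r}$ through $\langle w,v\rangle=(w,v)$ for $w\in H$, $v\in V_A^r$. Let $\tau\ge0$, $T>0$; let $\hat\beta:\mathbb R\to[0,+\infty]$ be convex and lower semicontinuous with $\hat\beta(0)=0$; let $\hat\pi\in C^1(\mathbb R)$ have a Lipschitz continuous derivative $\pi:=\hat\pi'$; and let $\liminf_{|s|\to\infty}(\hat\beta(s)+\hat\pi(s))/s^2>0$. Put $\beta:=\partial\hat\beta$ with effective domain $D(\beta)$, let $\beta^\circ(s)$ be the element of minimum modulus of $\beta(s)$ for $s\in D(\beta)$, and let $\beta_\lambda$ be the Yosida approximation of $\beta$ at level $\lambda>0$. *Data.* Let $u\in H^1(0,T;H)$ (taken as its continuous representative) and $y_0\in V_B^{2\sigma}$ with $\hat\beta(y_0)\in L^1(\Omega)$; if $\lambda_1=0$, assume that the mean value $m_0$ of $y_0$ over $\Omega$ lies in the interior of $D(\beta)$, and let $\delta_0>0$ be such that $[m_0-\delta_0,m_0+\delta_0]\subset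 D(\beta)$. Assume moreover that * if $\tau>0$, then $y_0\in D(\beta)$ a.e. in $\Omega$ and $\beta^\circ(y_0)\in H$; * if $\tau=0$, then there is a constant $M_0$ such that, for all sufficiently small $\lambda>0$ and $t>0$, the function $\mu_0^\lambda(t):=B^{2\sigma}y_0+\beta_\lambda(y_0)+\pi(y_0)-u(t)$ belongs to $V_A^r$ and $\|\mu_0^\lambda(t)\|_{A,r}\le M_0$. *Solutions.* A solution is a pair $(y,\mu)$ with $y\in H^1(0,T;V_A^{-r})\cap L^\infty(0,T;V_B^\sigma)$, $\tau\partial_ty\in L^2(0,T;H)$, $\mu\in L^2(0,T;V_A^r)$ and $\hat\beta(y)\in L^1(\Omega\times(0,T))$ such that $y(0)=y_0$ and, for a.e. $t\in(0,T)$, $$\langle\partial_ty(t),v\rangle+(A^r\mu(t),A^rv)=0\quad\text{for every }v\in V_A^r,$$ $$\tau(\partial_ty(t),y(t)-v)+(B^\sigma y(t),B^\sigma(y(t)-v))+\int_\Omega\hat\beta(y(t))+(\pi(y(t))-u(t),y(t)-v)\le(\mu(t),y(t)-v)+\int_\Omega\hat\beta(v)\quad\text{for every }v\in V_B^\sigma,$$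 where $\int_\Omega\hat\beta(v):=+\infty$ if $\hat\beta(v)\notin L^1(\Omega)$. *Conclusion.* Every solution $(y,\mu)$ satisfies $$\partial_ty\in L^\infty(0,T;V_A^{-r})\cap L^2(0,T;V_B^\sigma),\qquad\mu\in L^\infty(0,T;V_A^r),$$ and, if $\tau>0$, also $$\partial_ty\in L^\infty(0,T;H),\qquad\mu\in L^\infty(0,T;V_A^{2r}).$$ Moreover, $$\|\partial_ty\|_{L^\infty(0,T;V_A^{-r})}+\|\partial_ty\|_{L^2(0,T;V_B^\sigma)}+\|\mu\|_{L^\infty(0,T;V_A^r)}+\|\tau^{1/2}\partial_ty\|_{L^\infty(0,T;H)}+\|\tau^{1/2}\mu\|_{L^\infty(0,T;V_A^{2r})}\le K_3,$$ where the last two terms are understood to be $0$ if $\tau=0$, with a constant $K_3$ that depends only on the structure of the system ($\Omega,A,B,r,\sigma,\tau,\hat\beta,\hat\pi$), on $T$, on an upper bound for the norms of the data ($\|u\|_{L^2(0,T;H)}$, $\|\partial_tu\|_{L^2(0,T;H)}$, $\|y_0\|_{V_B^{2\sigma}}$, $\|\hat\beta(y_0)\|_{L^1(\Omega)}$ and,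 if $\tau>0$, $\|\beta^\circ(y_0)\|$), on $\delta_0$ if $\lambda_1=0$, and on $M_0$ if $\tau=0$. -/

import Mathlib

open MeasureTheory Filter Topology Set
open scoped ENNReal NNReal RealInnerProductSpace

noncomputable section

namespace FracCH

/-! ### Operators with compact resolvent, their eigensystems and their powers -/

section Abstract

variable {H : Type*} [NormedAddCommGroup H] [InnerProductSpace ℝ H] [CompleteSpace H]

/-- An unbounded monotone selfadjoint linear operator with compact resolvent. (For a monotone
selfadjoint operator the resolvents are compact as soon as `(I + A)⁻¹` is.) -/
structure IsAdmissibleOperator (A : H →ₗ.[ℝ] H) : Prop where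
  selfAdjoint : IsSelfAdjoint A
  monotone : ∀ v : A.domain, 0 ≤ ⟪A v, (v : H)⟫
  unbounded : ¬ ∃ C : ℝ, ∀ v : A.domain, ‖A v‖ ≤ C * ‖(v : H)‖
  compactResolvent : ∃ R : H →L[ℝ] H, IsCompactOperator R ∧
    ∀ v : H, ∃ h : R v ∈ A.domain, R v + A ⟨R v, h⟩ = v

/-- A complete orthonormal sequence of eigenvectors of `A`, ordered so that the eigenvalues are
nonnegative, nondecreasing and tend to infinity. The indices start from `0`, so that
`lam 0`, `lam 1` are the first two eigenvalues. -/
structure EigenSystem (A : H →ₗ.[ℝ] H) where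
  lam : ℕ → ℝ
  vec : ℕ → H
  mem_domain : ∀ j, vec j ∈ A.domain
  apply_vec : ∀ j, A ⟨vec j, mem_domain j⟩ = lam j • vec j
  orthonormal : Orthonormal ℝ vec
  nonneg : 0 ≤ lam 0
  mono : Monotone lam
  tendsto : Tendsto lam atTop atTop
  complete : (Submodule.span ℝ (range vec)).topologicalClosure = ⊤

/-- Enumeration in nondecreasing order of a family with finite sublevels. -/
theorem exists_monotone_enum {ι : Type*} [Infinite ι] (f : ι → ℝ)
    (hf : ∀ M : ℝ, {i | f i ≤ M}.Finite) :
    ∃ g : ℕ ≃ ι, Monotone (f ∘ g) ∧ Tendsto (f ∘ g) atTop atTop := by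
  classical
  have hc : Countable ι := by
    have h : (univ : Set ι) = ⋃ n : ℕ, {i | f i ≤ n} := by
      ext i
      simpa using exists_nat_ge (f i)
    exact countable_univ_iff.1 (h ▸ countable_iUnion fun n => (hf n).countable)
  obtain ⟨c, hcinj⟩ := exists_injective_nat ι
  let key : ι → ℝ ×ₗ ℕ := fun i => toLex (f i, c i)
  have hkey : Function.Injective key := fun i j h => hcinj (congrArg (fun z => (ofLex z).2) h)
  let : LinearOrder ι := LinearOrder.lift' key hkey
  have hle : ∀ i j : ι, i ≤ j → f i ≤ f j := fun i j h => by
    have h1 : key i ≤ key j := h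
    rcases Prod.Lex.le_iff.1 h1 with h2 | h2
    · exact h2.le
    · exact h2.1.le
  have hIic : ∀ j : ι, (Iic j).Finite := fun j => (hf (f j)).subset fun i hi => hle i j hi
  let : LocallyFiniteOrder ι :=
    LocallyFiniteOrder.ofFiniteIcc fun a b => (hIic b).subset fun i hi => hi.2
  have : NoMaxOrder ι := ⟨fun a => by
    obtain ⟨b, hb⟩ := (hIic a).exists_notMem
    exact ⟨b, not_le.1 hb⟩⟩
  obtain ⟨a⟩ : Nonempty ι := inferInstance
  obtain ⟨b, hb⟩ := (hIic a).exists_minimal ⟨a, le_refl a⟩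
  have hbot : ∀ i, b ≤ i := fun i => by
    by_contra h
    have h1 := (not_le.1 h)
    exact h (hb.2 (h1.le.trans hb.1) h1.le)
  let : OrderBot ι := { bot := b, bot_le := hbot }
  let := LinearLocallyFiniteOrder.succOrder ι
  let := LinearLocallyFiniteOrder.predOrder ι
  let g := (orderIsoNatOfLinearSuccPredArch (ι := ι)).symm
  have hm : Monotone (f ∘ g) := fun m n h => hle _ _ (g.monotone h)
  refine ⟨g.toEquiv, hm, tendsto_atTop_atTop_of_monotone hm fun M => ?_⟩
  obtain ⟨i, hi⟩ := (hf M).exists_notMem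
  exact ⟨g.symm i, by simpa using (not_le.1 hi).le⟩

/-- Every admissible operator has an eigensystem. -/
theorem IsAdmissibleOperator.nonempty_eigenSystem
    {A : H →ₗ.[ℝ] H} (hA : IsAdmissibleOperator A) :
    Nonempty (EigenSystem A) := by
  classical
  obtain ⟨R, hRc, hR⟩ := hA.compactResolvent
  have hAs : A.IsFormalAdjoint A := by
    have h := LinearPMap.adjoint_isFormalAdjoint hA.selfAdjoint.dense_domain
    rwa [LinearPMap.isSelfAdjoint_def.1 hA.selfAdjoint] at h
  have hRsym : (R : H →ₗ[ℝ] H).IsSymmetric := by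
    intro v w
    obtain ⟨hv, hv'⟩ := hR v
    obtain ⟨hw, hw'⟩ := hR w
    have h := hAs ⟨R v, hv⟩ ⟨R w, hw⟩
    change ⟪R v, w⟫ = ⟪v, R w⟫
    conv_lhs => rw [← hw']
    conv_rhs => rw [← hv']
    rw [inner_add_right, inner_add_left]
    congr 1
    exact h.symm
  have hRpos : ∀ v, ‖R v‖ ^ 2 ≤ ⟪R v, v⟫ := fun v => by
    obtain ⟨hv, hv'⟩ := hR v
    have h := hA.monotone ⟨R v, hv⟩
    have h2 : ⟪R v, v⟫ = ⟪R v, R v⟫ + ⟪R v, A ⟨R v, hv⟩⟫ := by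
      rw [← inner_add_right, hv']
    rw [h2, real_inner_self_eq_norm_sq, real_inner_comm]
    exact le_add_of_nonneg_right h
  have hRinj : ∀ v, R v = 0 → v = 0 := fun v h => by
    obtain ⟨hv, hv'⟩ := hR v
    have h0 : (⟨R v, hv⟩ : A.domain) = 0 := Subtype.ext h
    rw [h0, h, LinearPMap.map_zero, add_zero] at hv'
    exact hv'.symm
  have heig : ∀ (ρ : ℝ) (v : H), R v = ρ • v → v ≠ 0 → 0 < ρ ∧ ρ ≤ 1 := fun ρ v h hv => by
    have h1 := hRpos v
    have h2 : 0 < ‖v‖ ^ 2 := by positivity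
    rw [h, norm_smul, mul_pow, Real.norm_eq_abs, sq_abs, real_inner_smul_left,
      real_inner_self_eq_norm_sq] at h1
    have h3 : ρ ^ 2 ≤ ρ := le_of_mul_le_mul_right h1 h2
    have h4 : ρ ≠ 0 := fun h0 => hv (hRinj v (by rw [h, h0, zero_smul]))
    have h5 : 0 < ρ ^ 2 := by positivity
    constructor <;> nlinarith
  let E : ℝ → Submodule ℝ H := fun ρ => Module.End.eigenspace (R : Module.End ℝ H) ρ
  have hE : ∀ ρ v, v ∈ E ρ ↔ R v = ρ • v := fun ρ v => Module.End.mem_eigenspace_iff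
  have hfin : ∀ ρ, FiniteDimensional ℝ (E ρ) := fun ρ => by
    by_cases h : ρ = 0
    · have : E ρ = ⊥ := by
        rw [Submodule.eq_bot_iff]
        intro v hv
        rw [hE, h, zero_smul] at hv
        exact hRinj v hv
      rw [this]
      infer_instance
    · exact ContinuousLinearMap.finite_dimensional_eigenspace hRc ρ h
  let b : ∀ ρ, OrthonormalBasis (Fin (Module.finrank ℝ (E ρ))) ℝ (E ρ) :=
    fun ρ => stdOrthonormalBasis ℝ (E ρ)
  let ι := Σ ρ : ℝ, Fin (Module.finrank ℝ (E ρ))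
  let e : ι → H := fun a => (b a.1 a.2 : H)
  have hon : Orthonormal ℝ e :=
    (hRsym.orthogonalFamily_eigenspaces).orthonormal_sigma_orthonormal
      (v_family := fun ρ => b ρ) fun ρ => (b ρ).orthonormal
  have heR : ∀ a, R (e a) = a.1 • e a := fun a => (hE _ _).1 (b a.1 a.2).2
  have hne : ∀ a, e a ≠ 0 := fun a => hon.ne_zero a
  have hperp : (Submodule.span ℝ (range e))ᗮ = ⊥ := by
    have h := ContinuousLinearMap.orthogonalComplement_iSup_eigenspaces_eq_bot hRc hRsym
    rw [eq_bot_iff, ← h]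
    refine Submodule.orthogonal_le (iSup_le fun ρ v hv => ?_)
    have h1 := (b ρ).sum_repr ⟨v, hv⟩
    have h2 := congrArg (fun z : E ρ => (z : H)) h1
    simp only [Submodule.coe_sum, Submodule.coe_smul] at h2
    rw [← h2]
    exact Submodule.sum_mem _ fun i _ =>
      Submodule.smul_mem _ _ (Submodule.subset_span ⟨⟨ρ, i⟩, rfl⟩)
  have hdense : (Submodule.span ℝ (range e)).topologicalClosure = ⊤ :=
    Submodule.topologicalClosure_eq_top_iff.2 hperp
  have hinf : Infinite ι := by
    by_contra hι
    rw [not_infinite_iff_finite] at hι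
    have : FiniteDimensional ℝ (Submodule.span ℝ (range e)) :=
      FiniteDimensional.span_of_finite ℝ (finite_range e)
    have h1 : Submodule.span ℝ (range e) = ⊤ := by
      rw [← hdense]
      exact (Submodule.span ℝ (range e)).closed_of_finiteDimensional
        |>.submodule_topologicalClosure_eq.symm
    have : FiniteDimensional ℝ H := by
      rw [h1] at this
      exact Module.Finite.of_surjective (⊤ : Submodule ℝ H).subtype fun v => ⟨⟨v, trivial⟩, rfl⟩
    apply hA.unbounded
    exact ⟨‖LinearMap.toContinuousLinearMap A.toFun‖,
      fun v => (LinearMap.toContinuousLinearMap A.toFun).le_opNorm v⟩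
  let f : ι → ℝ := fun a => a.1⁻¹ - 1
  have hpos : ∀ a : ι, 0 < a.1 ∧ a.1 ≤ 1 := fun a => heig _ _ (heR a) (hne a)
  have hf : ∀ M : ℝ, {a | f a ≤ M}.Finite := fun M => by
    by_contra hM
    have hM : {a | f a ≤ M}.Infinite := hM
    let q := hM.natEmbedding
    obtain ⟨K, hK, hKsub⟩ := hRc.image_closedBall_subset_compact 1
    have hx : ∀ n, R (e (q n)) ∈ K := fun n =>
      hKsub ⟨e (q n), by simp [hon.1], rfl⟩
    obtain ⟨x, -, φ, hφ, hlim⟩ := hK.tendsto_subseq hx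
    have hcau := hlim.cauchySeq
    rw [Metric.cauchySeq_iff] at hcau
    have hM1 : 0 < M + 1 := by
      have h1 : f (q 0) ≤ M := (q 0).2
      have h2 := inv_pos.2 (hpos (q 0)).1
      simp only [f] at h1
      linarith
    obtain ⟨N, hN⟩ := hcau (M + 1)⁻¹ (inv_pos.2 hM1)
    have h := hN N le_rfl (N + 1) (Nat.le_succ N)
    set a := (q (φ N) : ι) with ha
    set a' := (q (φ (N + 1)) : ι) with ha'
    have hne' : a ≠ a' := fun h0 => by
      have := q.injective (Subtype.ext h0)
      exact absurd (hφ.injective this) (by simp)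
    have hρ : (M + 1)⁻¹ ≤ a.1 := by
      have h1 : f a ≤ M := (q (φ N)).2
      simp only [f] at h1
      have h2 : a.1⁻¹ ≤ M + 1 := by linarith
      exact inv_le_of_inv_le₀ (hpos a).1 h2
    have h1 : ‖R (e a) - R (e a')‖ ^ 2 = a.1 ^ 2 + a'.1 ^ 2 := by
      rw [heR, heR, norm_sub_sq_real, norm_smul, norm_smul, hon.1, hon.1, real_inner_smul_left,
        real_inner_smul_right, hon.2 hne']
      simp
    have h2 : ‖R (e a) - R (e a')‖ < (M + 1)⁻¹ := by
      simpa [dist_eq_norm] using h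
    have h3 := norm_nonneg (R (e a) - R (e a'))
    have h4 := inv_pos.2 hM1
    nlinarith [sq_nonneg a'.1]
  obtain ⟨g, hmono, htend⟩ := exists_monotone_enum f hf
  have hdom : ∀ a, ∃ h : e a ∈ A.domain, A ⟨e a, h⟩ = f a • e a := fun a => by
    obtain ⟨hv, hv'⟩ := hR (a.1⁻¹ • e a)
    have h1 : R (a.1⁻¹ • e a) = e a := by
      rw [map_smul, heR, smul_smul, inv_mul_cancel₀ (hpos a).1.ne', one_smul]
    have h2 : e a ∈ A.domain := h1 ▸ hv
    refine ⟨h2, ?_⟩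
    have h3 : (⟨R (a.1⁻¹ • e a), hv⟩ : A.domain) = ⟨e a, h2⟩ := Subtype.ext h1
    rw [h3, h1] at hv'
    rw [eq_sub_of_add_eq' hv', sub_smul, one_smul]
  exact ⟨{
    lam := f ∘ g
    vec := e ∘ g
    mem_domain := fun j => (hdom (g j)).1
    apply_vec := fun j => (hdom (g j)).2
    orthonormal := hon.comp g g.injective
    nonneg := by
      have h := one_le_inv₀ (hpos (g 0)).1 |>.2 (hpos (g 0)).2
      simp only [f, Function.comp]
      linarith
    mono := hmono
    tendsto := htend
    complete := by rw [g.surjective.range_comp]; exact hdense }⟩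

namespace EigenSystem

variable {A : H →ₗ.[ℝ] H} (S : EigenSystem A)

theorem lam_nonneg (j : ℕ) : 0 ≤ S.lam j := S.nonneg.trans (S.mono (Nat.zero_le j))

/-- The domain `D(A^s)`. -/
def domPow (s : ℝ) : Submodule ℝ H where
  carrier := {v | Summable fun j => (S.lam j ^ s * ⟪S.vec j, v⟫) ^ 2}
  zero_mem' := by simp [summable_zero]
  add_mem' := by
    intro v w hv hw
    refine Summable.of_nonneg_of_le (fun j => sq_nonneg _) (fun j => ?_)
      ((hv.mul_left 2).add (hw.mul_left 2))
    rw [inner_add_right]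
    nlinarith [sq_nonneg (S.lam j ^ s * ⟪S.vec j, v⟫ - S.lam j ^ s * ⟪S.vec j, w⟫)]
  smul_mem' := by
    intro c v hv
    refine (hv.mul_left (c ^ 2)).congr fun j => ?_
    rw [real_inner_smul_right]
    ring

theorem summable_pow {s : ℝ} {v : H} (hv : v ∈ S.domPow s) :
    Summable fun j => (S.lam j ^ s * ⟪S.vec j, v⟫) • S.vec j := by
  have h := S.orthonormal.orthogonalFamily.summable_iff_norm_sq_summable
    (fun j => S.lam j ^ s * ⟪S.vec j, v⟫)
  have h2 : Summable fun j => ‖S.lam j ^ s * ⟪S.vec j, v⟫‖ ^ 2 := by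
    have h3 : Summable fun j => (S.lam j ^ s * ⟪S.vec j, v⟫) ^ 2 := hv
    exact h3.congr fun j => by rw [Real.norm_eq_abs, sq_abs]
  simpa using h.2 h2

/-- The power `A^s` on its domain, given by the eigenvector expansion. -/
def pow (s : ℝ) : S.domPow s →ₗ[ℝ] H where
  toFun v := ∑' j, (S.lam j ^ s * ⟪S.vec j, (v : H)⟫) • S.vec j
  map_add' v w := by
    rw [← (S.summable_pow v.2).tsum_add (S.summable_pow w.2)]
    refine tsum_congr fun j => ?_
    rw [← add_smul, Submodule.coe_add, inner_add_right, mul_add]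
  map_smul' c v := by
    rw [RingHom.id_apply, ← tsum_const_smul'']
    refine tsum_congr fun j => ?_
    rw [smul_smul, Submodule.coe_smul, real_inner_smul_right]
    ring_nf

/-- The map `v ↦ (v, A^s v)` whose Euclidean norm is the graph norm. -/
def graphMap (s : ℝ) : S.domPow s →ₗ[ℝ] WithLp 2 (H × H) :=
  (WithLp.linearEquiv 2 ℝ (H × H)).symm.toLinearMap ∘ₗ
    (LinearMap.prod (S.domPow s).subtype (S.pow s))

theorem graphMap_injective (s : ℝ) : Function.Injective (S.graphMap s) := by
  intro v w h
  have h1 := congrArg (fun z => (WithLp.linearEquiv 2 ℝ (H × H) z).1) h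
  simpa [graphMap] using h1

/-- `D(A^s)` endowed with the graph norm `(‖v‖² + ‖A^s v‖²)^(1/2)`. -/
def GraphSpace (s : ℝ) : Type _ := S.domPow s

namespace GraphSpace

variable {S} {s : ℝ}

instance : NormedAddCommGroup (S.GraphSpace s) :=
  NormedAddCommGroup.induced (S.domPow s) (WithLp 2 (H × H)) (S.graphMap s)
    (S.graphMap_injective s)

instance : NormedSpace ℝ (S.GraphSpace s) :=
  NormedSpace.induced ℝ (S.domPow s) (WithLp 2 (H × H)) (S.graphMap s)

/-- The inclusion of `D(A^s)` into `H`. -/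
def toH : S.GraphSpace s →ₗ[ℝ] H := (S.domPow s).subtype

/-- `v ↦ A^s v`. -/
def op : S.GraphSpace s →ₗ[ℝ] H := S.pow s

theorem norm_sq (v : S.GraphSpace s) : ‖v‖ ^ 2 = ‖toH v‖ ^ 2 + ‖op v‖ ^ 2 := by
  have h := WithLp.prod_norm_sq_eq_of_L2 (S.graphMap s v)
  exact h

end GraphSpace

/-- The weights `λ_j^s`, replaced by `1` where `λ_j = 0`. -/
def weight (s : ℝ) (j : ℕ) : ℝ := if S.lam j = 0 then 1 else S.lam j ^ s

theorem weight_ne_zero (s : ℝ) (j : ℕ) : S.weight s j ≠ 0 := by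
  unfold weight
  split_ifs with h
  · exact one_ne_zero
  · exact (Real.rpow_pos_of_pos (lt_of_le_of_ne (S.lam_nonneg j) (Ne.symm h)) s).ne'

theorem memℓp_weight {s : ℝ} {v : H} (hv : v ∈ S.domPow s) :
    Memℓp (fun j => S.weight s j * ⟪S.vec j, v⟫) 2 := by
  refine memℓp_gen ?_
  have h1 : Summable fun j => ⟪S.vec j, v⟫ ^ 2 := by
    have := S.orthonormal.inner_products_summable v
    simpa [Real.norm_eq_abs, sq_abs] using this
  have h2 : Summable fun j => (S.lam j ^ s * ⟪S.vec j, v⟫) ^ 2 := hv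
  refine Summable.of_nonneg_of_le (fun j => by positivity) (fun j => ?_) (h1.add h2)
  simp only [ENNReal.toReal_ofNat, Real.rpow_ofNat, Real.norm_eq_abs, sq_abs]
  unfold weight
  split_ifs with h
  · rw [one_mul]
    exact le_add_of_nonneg_right (sq_nonneg _)
  · exact le_add_of_nonneg_left (sq_nonneg _)

/-- The weighted Fourier coefficients, as an element of `ℓ²`. -/
def coeffMap (s : ℝ) : S.domPow s →ₗ[ℝ] lp (fun _ : ℕ => ℝ) 2 where
  toFun v := ⟨fun j => S.weight s j * ⟪S.vec j, (v : H)⟫, S.memℓp_weight v.2⟩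
  map_add' v w := by
    ext j
    change S.weight s j * ⟪S.vec j, (v : H) + w⟫ = _ + _
    rw [inner_add_right, mul_add]
  map_smul' c v := by
    ext j
    change S.weight s j * ⟪S.vec j, c • (v : H)⟫ = c * _
    rw [real_inner_smul_right]
    ring

theorem coeffMap_injective (s : ℝ) : Function.Injective (S.coeffMap s) := by
  intro v w h
  have hj : ∀ j, ⟪S.vec j, (v : H)⟫ = ⟪S.vec j, (w : H)⟫ := fun j => by
    have h1 := congrArg (fun z : lp (fun _ : ℕ => ℝ) 2 => (z : ℕ → ℝ) j) h
    exact mul_left_cancel₀ (S.weight_ne_zero s j) h1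
  have hd : (v : H) - w ∈ (Submodule.span ℝ (range S.vec))ᗮ := by
    rw [Submodule.mem_orthogonal]
    intro z hz
    induction hz using Submodule.span_induction with
    | mem x hx =>
      obtain ⟨j, rfl⟩ := hx
      rw [inner_sub_right, hj, sub_self]
    | zero => exact inner_zero_left _
    | add x y _ _ hx hy => rw [inner_add_left, hx, hy, add_zero]
    | smul c x _ hx => rw [real_inner_smul_left, hx, mul_zero]
  rw [Submodule.topologicalClosure_eq_top_iff.1 S.complete] at hd
  exact Subtype.ext (sub_eq_zero.1 ((Submodule.mem_bot ℝ).1 hd))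

/-- `D(A^s)` endowed with the norm
`(∑_{λ_j = 0} |(v, e_j)|² + ∑_{λ_j > 0} |λ_j^s (v, e_j)|²)^(1/2)`.
If the first eigenvalue is positive, this is `‖A^s v‖`; if it is zero and simple, this is
`(|(v, e_1)|² + ‖A^s v‖²)^(1/2)` with `e_1` the first eigenvector. -/
def EnergySpace (s : ℝ) : Type _ := S.domPow s

namespace EnergySpace

variable {S} {s : ℝ}

instance : NormedAddCommGroup (S.EnergySpace s) :=
  NormedAddCommGroup.induced (S.domPow s) (lp (fun _ : ℕ => ℝ) 2) (S.coeffMap s)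
    (S.coeffMap_injective s)

instance : NormedSpace ℝ (S.EnergySpace s) :=
  NormedSpace.induced ℝ (S.domPow s) (lp (fun _ : ℕ => ℝ) 2) (S.coeffMap s)

/-- The inclusion of `D(A^s)` into `H`. -/
def toH : S.EnergySpace s →ₗ[ℝ] H := (S.domPow s).subtype

/-- `v ↦ A^s v`. -/
def op : S.EnergySpace s →ₗ[ℝ] H := S.pow s

end EnergySpace

/-- The dual of `D(A^s)` (the space with exponent `-s`), with the dual norm. -/
abbrev DualSpace (s : ℝ) : Type _ := StrongDual ℝ (S.EnergySpace s)

/-- The functional `f` on `D(A^s)` is the element `w` of `H`, under the usual identification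
`⟨w, v⟩ = (w, v)` of `H` with a subspace of the dual of `D(A^s)`. -/
def Represents {s : ℝ} (f : S.DualSpace s) (w : H) : Prop :=
  ∀ v : S.EnergySpace s, f v = ⟪w, EnergySpace.toH v⟫

end EigenSystem

end Abstract

/-! ### The nonlinearities -/

/-- The subdifferential of a convex function `ℝ → [0,+∞]`. -/
def subdiff (βh : ℝ → ℝ≥0∞) (s : ℝ) : Set ℝ :=
  {ξ | ∀ z : ℝ, (βh s : EReal) + ((ξ * (z - s) : ℝ) : EReal) ≤ (βh z : EReal)}

/-- The effective domain of the subdifferential. -/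
def subdiffDom (βh : ℝ → ℝ≥0∞) : Set ℝ := {s | (subdiff βh s).Nonempty}

/-- `ξ` is the element of minimum modulus of the subdifferential at `s`. -/
def IsMinSection (βh : ℝ → ℝ≥0∞) (s ξ : ℝ) : Prop :=
  ξ ∈ subdiff βh s ∧ ∀ η ∈ subdiff βh s, |ξ| ≤ |η|

/-- The resolvent `(I + lam β)⁻¹` of the subdifferential `β`: the point `p` with
`s ∈ p + lam β(p)`. -/
def resolvent (βh : ℝ → ℝ≥0∞) (lam s : ℝ) : ℝ :=
  Classical.epsilon fun p => (s - p) / lam ∈ subdiff βh p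

/-- The Yosida approximation of the subdifferential. -/
def yosida (βh : ℝ → ℝ≥0∞) (lam s : ℝ) : ℝ := (s - resolvent βh lam s) / lam

/-- The assumptions on the convex part `βh` and on the smooth perturbation `πh` of the
potential. -/
structure IsAdmissiblePotential (βh : ℝ → ℝ≥0∞) (πh : ℝ → ℝ) : Prop where
  convex : ConvexOn ℝ≥0 univ βh
  lsc : LowerSemicontinuous βh
  zero : βh 0 = 0
  contDiff : ContDiff ℝ 1 πh
  lipschitz : ∃ L : ℝ≥0, LipschitzWith L (deriv πh)
  coercive : 0 < liminf
    (fun s : ℝ => ((βh s : EReal) + (πh s : EReal)) / ((s ^ 2 : ℝ) : EReal))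
    (Bornology.cobounded ℝ)

/-! ### The evolution problem -/

/-- The space `L²(Ω)`, for `Ω` in `ℝ³`. -/
abbrev L2 (Ω : Set (EuclideanSpace ℝ (Fin 3))) : Type :=
  Lp ℝ 2 ((volume : Measure (EuclideanSpace ℝ (Fin 3))).restrict Ω)

/-- Lebesgue measure on `(0,T)`. -/
abbrev timeMeasure (T : ℝ) : Measure ℝ := volume.restrict (Ioo 0 T)

/-- The convex functional `v ↦ ∫_Ω βh(v)`, equal to `+∞` if `βh(v)` is not integrable. -/
def energy {Ω : Set (EuclideanSpace ℝ (Fin 3))} (βh : ℝ → ℝ≥0∞) (v : L2 Ω) : ℝ≥0∞ :=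
  ∫⁻ x in Ω, βh (v x)

/-- `u` belongs to `H¹(0,T;X)` and `du` is its derivative; `u` is the continuous
representative. -/
structure IsH1 {X : Type*} [NormedAddCommGroup X] [NormedSpace ℝ X] (T : ℝ) (u du : ℝ → X) :
    Prop where
  memLp : MemLp u 2 (timeMeasure T)
  memLp_deriv : MemLp du 2 (timeMeasure T)
  eq_integral : ∀ t ∈ Icc 0 T, u t = u 0 + ∫ s in (0 : ℝ)..t, du s

variable {Ω : Set (EuclideanSpace ℝ (Fin 3))} {A B : L2 Ω →ₗ.[ℝ] L2 Ω}

/-- `(y, μ)` is a solution of the Cauchy problem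
`⟨∂ₜy, v⟩ + (A^r μ, A^r v) = 0`,
`τ(∂ₜy, y - v) + (B^σ y, B^σ(y - v)) + ∫ βh(y) + (πh'(y) - u, y - v) ≤ (μ, y - v) + ∫ βh(v)`,
`y(0) = y0`, with the time derivative `dy = ∂ₜy`, a function with values in the dual of
`D(A^r)`. The membership of `y` in `H¹(0,T; D(A^r)*)`, with derivative `dy`, and the initial
condition are expressed through the continuous representative
`t ↦ y0 + ∫_0^t dy(s) ds` of `y`. -/
structure IsSolution (SA : EigenSystem A) (SB : EigenSystem B) (r σ τ T : ℝ)
    (βh : ℝ → ℝ≥0∞) (πh : ℝ → ℝ) (u : ℝ → L2 Ω) (y0 : L2 Ω)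
    (y : ℝ → SB.GraphSpace σ) (dy : ℝ → SA.DualSpace r) (μ : ℝ → SA.EnergySpace r) : Prop where
  y_memLp : MemLp y ∞ (timeMeasure T)
  dy_memLp : MemLp dy 2 (timeMeasure T)
  y_eq_integral : ∃ Y : ℝ → SA.DualSpace r, SA.Represents (Y 0) y0 ∧
    (∀ t ∈ Icc 0 T, Y t = Y 0 + ∫ s in (0 : ℝ)..t, dy s) ∧
    ∀ᵐ t ∂(timeMeasure T), SA.Represents (Y t) (EigenSystem.GraphSpace.toH (y t))
  mu_memLp : MemLp μ 2 (timeMeasure T)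
  energy_integrable : ∫⁻ t, energy βh (EigenSystem.GraphSpace.toH (y t)) ∂(timeMeasure T) < ∞
  first : ∀ᵐ t ∂(timeMeasure T), ∀ v : SA.EnergySpace r,
    dy t v + ⟪EigenSystem.EnergySpace.op (μ t), EigenSystem.EnergySpace.op v⟫ = 0
  /-- `tdy` is `τ ∂ₜy`, as an element of `L²(0,T;H)`. -/
  second : ∃ tdy : ℝ → L2 Ω, MemLp tdy 2 (timeMeasure T) ∧
    (∀ᵐ t ∂(timeMeasure T), SA.Represents (τ • dy t) (tdy t)) ∧
    ∀ᵐ t ∂(timeMeasure T), ∀ v : SB.GraphSpace σ,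
      ((⟪tdy t, EigenSystem.GraphSpace.toH (y t - v)⟫
        + ⟪EigenSystem.GraphSpace.op (y t), EigenSystem.GraphSpace.op (y t - v)⟫
        + ∫ x in Ω, (deriv πh (EigenSystem.GraphSpace.toH (y t) x) - u t x)
            * EigenSystem.GraphSpace.toH (y t - v) x : ℝ) : EReal)
        + (energy βh (EigenSystem.GraphSpace.toH (y t)) : EReal)
      ≤ ((⟪EigenSystem.EnergySpace.toH (μ t),
            EigenSystem.GraphSpace.toH (y t - v)⟫ : ℝ) : EReal)
        + (energy βh (EigenSystem.GraphSpace.toH v) : EReal)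

/-- The additional condition on the initial datum `y0 ∈ D(B^(2σ))` in the viscous case: the
minimal section of `β` at `y0` is in `L²(Ω)`, with norm at most `R`. -/
def ViscousData (βh : ℝ → ℝ≥0∞) (y0 : L2 Ω) (R : ℝ) : Prop :=
  ∃ b0 : L2 Ω, (∀ᵐ x ∂(volume.restrict Ω), IsMinSection βh (y0 x) (b0 x)) ∧ ‖b0‖ ≤ R

/-- The additional condition on the data in the nonviscous case: for all sufficiently small
`lam > 0` and `t > 0`, the function `B^(2σ) y0 + β_lam(y0) + πh'(y0) - u(t)` belongs to `D(A^r)`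
with norm at most `M0`. -/
def NonviscousData (SA : EigenSystem A) (SB : EigenSystem B) (r σ : ℝ)
    (βh : ℝ → ℝ≥0∞) (πh : ℝ → ℝ) (u : ℝ → L2 Ω) (y0 : SB.GraphSpace (2 * σ)) (M0 : ℝ) : Prop :=
  ∃ ε > 0, ∀ lam ∈ Ioo 0 ε, ∀ t ∈ Ioo 0 ε, ∃ m : SA.EnergySpace r,
    (∀ᵐ x ∂(volume.restrict Ω), EigenSystem.EnergySpace.toH m x =
      EigenSystem.GraphSpace.op y0 x + yosida βh lam (EigenSystem.GraphSpace.toH y0 x)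
        + deriv πh (EigenSystem.GraphSpace.toH y0 x) - u t x) ∧ ‖m‖ ≤ M0

end FracCH

end

/-!
By the Riesz theorem the dual of `D(A^r)` is `D(A^r)` itself, with `H` embedded in it through some
`i`. Eliminating `μ`, one obtains an evolution for the image of `y` under `v ↦ (i v, √τ v)`, whose
velocity is dissipative up to a perturbation: the subdifferential is monotone, and since `D(B^σ)` is
compactly embedded in `H`, an inequality of Ehrling type absorbs the Lipschitz perturbation into
`‖B^σ ·‖²` and the weak norm. Comparing the solution with its time translates by Grönwall's
inequality therefore bounds the difference quotients by those at the initial time. The latter are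
controlled by testing the inequality at `y₀`, with the subgradient `β°(y₀)` if `τ > 0`, and with
the Yosida approximations of `β(y₀)`, which are subgradients up to a small error, if `τ = 0`.
The limit of the difference quotients gives the bounds for `∂ₜy`.

The equation `A^(2r) μ = -∂ₜy` bounds `μ` up to its component along the kernel of `A`. That
component is proportional to the mean value of `μ`, and it is bounded by testing the inequality with
two constants, one on each side of `m₀`, that stay away from `m₀`. They are chosen within `δ₀` of it
among finitely many points of finite energy, so that the bound does not depend on `m₀`.
-/

noncomputable section

namespace FracCH

section Calculus

theorem absolutelyContinuousOnInterval_of_dist_le {X Y : Type*} [PseudoMetricSpace X]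
    [PseudoMetricSpace Y] {f : ℝ → X} {g : ℝ → Y} {a b C : ℝ}
    (hg : AbsolutelyContinuousOnInterval g a b)
    (h : ∀ s ∈ uIcc a b, ∀ t ∈ uIcc a b, dist (f s) (f t) ≤ C * dist (g s) (g t)) :
    AbsolutelyContinuousOnInterval f a b := by
  rw [absolutelyContinuousOnInterval_iff] at hg ⊢
  intro ε hε
  obtain ⟨δ, hδ, hsum⟩ := hg (ε / (|C| + 1)) (by positivity)
  refine ⟨δ, hδ, fun E hE hlength => ?_⟩
  calc ∑ i ∈ Finset.range E.1, dist (f (E.2 i).1) (f (E.2 i).2)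
      ≤ ∑ i ∈ Finset.range E.1, (|C| + 1) * dist (g (E.2 i).1) (g (E.2 i).2) := by
        refine Finset.sum_le_sum fun i hi => ?_
        obtain ⟨hs, ht⟩ := hE.1 i hi
        refine (h _ hs _ ht).trans ?_
        gcongr
        exact (le_abs_self C).trans (le_add_of_nonneg_right zero_le_one)
    _ = (|C| + 1) * ∑ i ∈ Finset.range E.1, dist (g (E.2 i).1) (g (E.2 i).2) :=
        (Finset.mul_sum _ _ _).symm
    _ < (|C| + 1) * (ε / (|C| + 1)) := by
        gcongr
        exact hsum E hE hlength
    _ = ε := by field_simp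

/-- `f` is an absolutely continuous primitive of the integrable function `g` on `[0,b]`. -/
structure IsPrimitive {X : Type*} [NormedAddCommGroup X] [NormedSpace ℝ X] (f g : ℝ → X)
    (b : ℝ) : Prop where
  intervalIntegrable : IntervalIntegrable g volume 0 b
  eq_integral : ∀ t ∈ Icc 0 b, f t = f 0 + ∫ s in (0 : ℝ)..t, g s

namespace IsPrimitive

section NormedSpace

variable {X : Type*} [NormedAddCommGroup X] [NormedSpace ℝ X] {f g : ℝ → X} {b : ℝ}

theorem of_integral (hg : IntervalIntegrable g volume 0 b) :
    IsPrimitive (fun t => ∫ s in (0 : ℝ)..t, g s) g b :=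
  ⟨hg, fun t _ => by rw [intervalIntegral.integral_same, zero_add]⟩

theorem mono (h : IsPrimitive f g b) {t : ℝ} (ht : t ∈ Icc 0 b) : IsPrimitive f g t where
  intervalIntegrable := h.intervalIntegrable.mono_set <| by
    rw [uIcc_of_le (ht.1.trans ht.2), uIcc_of_le ht.1]
    exact Icc_subset_Icc_right ht.2
  eq_integral s hs := h.eq_integral s ⟨hs.1, hs.2.trans ht.2⟩

theorem continuousOn (h : IsPrimitive f g b) : ContinuousOn f (Icc 0 b) := by
  rcases lt_or_ge b 0 with hb | hb
  · simp only [Icc_eq_empty hb.not_ge, continuousOn_empty]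
  have hprim := intervalIntegral.continuousOn_primitive_interval' h.intervalIntegrable left_mem_uIcc
  rw [uIcc_of_le hb] at hprim
  exact (continuousOn_const.add hprim).congr h.eq_integral

theorem intervalIntegrable_of_mem (h : IsPrimitive f g b) {s t : ℝ} (hs : s ∈ Icc 0 b)
    (ht : t ∈ Icc 0 b) : IntervalIntegrable g volume s t :=
  (h.mono hs).intervalIntegrable.symm.trans (h.mono ht).intervalIntegrable

theorem sub_eq_integral (h : IsPrimitive f g b) {s t : ℝ} (hs : s ∈ Icc 0 b)
    (ht : t ∈ Icc 0 b) : f t - f s = ∫ x in s..t, g x := by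
  rw [h.eq_integral t ht, h.eq_integral s hs, add_sub_add_left_eq_sub,
    intervalIntegral.integral_interval_sub_left (h.mono ht).intervalIntegrable
      (h.mono hs).intervalIntegrable]

theorem ae_hasDerivAt [CompleteSpace X] (h : IsPrimitive f g b) :
    ∀ᵐ t, t ∈ Ioo 0 b → HasDerivAt f (g t) t := by
  filter_upwards [h.intervalIntegrable.ae_hasDerivAt_integral] with t hderiv ht
  have hb : 0 ≤ b := (ht.1.trans ht.2).le
  rw [uIcc_of_le hb] at hderiv
  refine ((hderiv (Ioo_subset_Icc_self ht) 0 ⟨le_rfl, hb⟩).const_add (f 0)).congr_of_eventuallyEq ?_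
  filter_upwards [Ioo_mem_nhds ht.1 ht.2] with s hs
  exact h.eq_integral s (Ioo_subset_Icc_self hs)

end NormedSpace

section InnerProductSpace

variable {X : Type*} [NormedAddCommGroup X] [InnerProductSpace ℝ X] {f g : ℝ → X} {b : ℝ}

theorem intervalIntegrable_inner (hb : 0 ≤ b) (h : IsPrimitive f g b) :
    IntervalIntegrable (fun s => ⟪g s, f s⟫) volume 0 b := by
  obtain ⟨M, hM⟩ := isCompact_Icc.exists_bound_of_continuousOn h.continuousOn
  have hg := h.intervalIntegrable
  rw [intervalIntegrable_iff_integrableOn_Ioc_of_le hb] at hg ⊢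
  have hf : AEStronglyMeasurable f (volume.restrict (Ioc 0 b)) :=
    (h.continuousOn.mono Ioc_subset_Icc_self).aestronglyMeasurable measurableSet_Ioc
  refine (hg.norm.mul_const M).mono' (hg.1.inner hf) ?_
  filter_upwards [ae_restrict_mem measurableSet_Ioc] with s hs
  refine (norm_inner_le_norm _ _).trans ?_
  gcongr
  exact hM s (Ioc_subset_Icc_self hs)

theorem absolutelyContinuousOnInterval_norm_sq (hb : 0 ≤ b) (h : IsPrimitive f g b) :
    AbsolutelyContinuousOnInterval (fun t => ‖f t‖ ^ 2) 0 b := by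
  obtain ⟨M, hM⟩ := isCompact_Icc.exists_bound_of_continuousOn h.continuousOn
  refine absolutelyContinuousOnInterval_of_dist_le (C := 2 * M)
    (h.intervalIntegrable.norm.absolutelyContinuousOnInterval_intervalIntegral left_mem_uIcc) ?_
  rw [uIcc_of_le hb]
  intro s hs t ht
  have hincrement : ‖f s - f t‖ ≤ |∫ x in t..s, ‖g x‖| := by
    rw [h.sub_eq_integral ht hs]
    exact intervalIntegral.norm_integral_le_abs_integral_norm
  have hsum : ‖f s‖ + ‖f t‖ ≤ 2 * M := by linarith [hM s hs, hM t ht]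
  rw [Real.dist_eq, Real.dist_eq, intervalIntegral.integral_interval_sub_left
    (h.mono hs).intervalIntegrable.norm (h.mono ht).intervalIntegrable.norm]
  calc |‖f s‖ ^ 2 - ‖f t‖ ^ 2| = (‖f s‖ + ‖f t‖) * |‖f s‖ - ‖f t‖| := by
        rw [sq_sub_sq, abs_mul, abs_of_nonneg (by positivity)]
    _ ≤ 2 * M * |∫ x in t..s, ‖g x‖| :=
        mul_le_mul hsum ((abs_norm_sub_norm_le _ _).trans hincrement) (abs_nonneg _)
          ((by positivity : 0 ≤ ‖f s‖ + ‖f t‖).trans hsum)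

theorem norm_sq_eq_add_integral_inner [CompleteSpace X] (hb : 0 ≤ b) (h : IsPrimitive f g b) :
    ‖f b‖ ^ 2 = ‖f 0‖ ^ 2 + 2 * ∫ s in (0 : ℝ)..b, ⟪g s, f s⟫ := by
  have hderiv : ∀ᵐ t, t ∈ uIoc 0 b → deriv (fun t => ‖f t‖ ^ 2) t = 2 * ⟪g t, f t⟫ := by
    filter_upwards [h.ae_hasDerivAt, Measure.ae_ne volume b] with t ht hne htm
    rw [uIoc_of_le hb] at htm
    rw [(ht ⟨htm.1, htm.2.lt_of_ne hne⟩).norm_sq.deriv, real_inner_comm]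
  have hftc := (h.absolutelyContinuousOnInterval_norm_sq hb).integral_deriv_eq_sub
  rw [intervalIntegral.integral_congr_ae hderiv, intervalIntegral.integral_const_mul] at hftc
  linarith

theorem norm_le_of_inner_le [CompleteSpace X] {C M : ℝ} (hb : 0 ≤ b) (hC : 0 ≤ C) (hM : 0 ≤ M)
    (hCb : 4 * C * b ≤ 1) (h : IsPrimitive f g b) (hzero : f 0 = 0)
    (hinner : ∀ᵐ t, t ∈ Ioc 0 b → ⟪g t, f t⟫ ≤ C * ‖f t‖ ^ 2 + M * ‖f t‖) :
    ‖f b‖ ≤ 4 * M * b := by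
  obtain ⟨t₀, ht₀, hmax⟩ := isCompact_Icc.exists_isMaxOn ⟨0, le_rfl, hb⟩ h.continuousOn.norm
  set N := ‖f t₀‖ with hN
  have hN₀ : 0 ≤ N := norm_nonneg _
  have hprim := h.mono ht₀
  have henergy : N ^ 2 = 2 * ∫ s in (0 : ℝ)..t₀, ⟪g s, f s⟫ := by
    rw [hN, hprim.norm_sq_eq_add_integral_inner ht₀.1, hzero, norm_zero]
    ring
  have hintegral : ∫ s in (0 : ℝ)..t₀, ⟪g s, f s⟫ ≤ ∫ _ in (0 : ℝ)..t₀, (C * N ^ 2 + M * N) := by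
    refine intervalIntegral.integral_mono_ae_restrict ht₀.1
      (hprim.intervalIntegrable_inner ht₀.1) intervalIntegrable_const ?_
    rw [EventuallyLE, ae_restrict_iff' measurableSet_Icc]
    filter_upwards [hinner, Measure.ae_ne volume 0] with t ht hne htm
    have htb : t ∈ Icc 0 b := ⟨htm.1, htm.2.trans ht₀.2⟩
    have hle : ‖f t‖ ≤ N := hmax htb
    refine (ht ⟨htb.1.lt_of_ne hne.symm, htb.2⟩).trans ?_
    gcongr
  rw [intervalIntegral.integral_const, smul_eq_mul, sub_zero] at hintegral
  have hquadratic : N ^ 2 ≤ 2 * (b * (C * N ^ 2 + M * N)) := by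
    refine henergy.le.trans ?_
    exact mul_le_mul_of_nonneg_left
      (hintegral.trans (mul_le_mul_of_nonneg_right ht₀.2 (by positivity))) zero_le_two
  have habsorb : N ^ 2 ≤ 4 * M * b * N := by nlinarith [sq_nonneg N]
  have hbound : N ≤ 4 * M * b := by
    rcases hN₀.eq_or_lt with h₀ | h₀
    · rw [← h₀]
      positivity
    · nlinarith
  exact (hmax ⟨hb, le_rfl⟩).trans hbound

end InnerProductSpace

end IsPrimitive

theorem hasDerivWithinAt_integral_right {q : ℝ → ℝ} {b t : ℝ} (hq : ContinuousOn q (Icc 0 b))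
    (ht : t ∈ Ico 0 b) :
    HasDerivWithinAt (fun t => ∫ s in (0 : ℝ)..t, q s) (q t) (Ici t) t := by
  have hsub : Icc 0 t ⊆ Icc 0 b := Icc_subset_Icc_right ht.2.le
  have hint : IntervalIntegrable q volume 0 t :=
    ContinuousOn.intervalIntegrable (by rw [uIcc_of_le ht.1]; exact hq.mono hsub)
  have hright : Ioo t b ⊆ Icc 0 b := fun s hs => ⟨ht.1.trans hs.1.le, hs.2.le⟩
  refine intervalIntegral.integral_hasDerivWithinAt_right (t := Ioi t) hint ?_ ?_
  · exact ⟨Ioo t b, Ioo_mem_nhdsGT ht.2,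
      (hq.mono hright).aestronglyMeasurable measurableSet_Ioo⟩
  · exact (hq t ⟨ht.1, ht.2.le⟩).mono_of_mem_nhdsWithin
      (mem_of_superset (Ioo_mem_nhdsGT ht.2) hright)

theorem add_mul_integral_le_mul_exp {q : ℝ → ℝ} {a b C : ℝ} (hC : 0 ≤ C)
    (hq : ContinuousOn q (Icc 0 b))
    (h : ∀ t ∈ Icc 0 b, q t ≤ a + C * ∫ s in (0 : ℝ)..t, q s) {t : ℝ} (ht : t ∈ Icc 0 b) :
    a + C * ∫ s in (0 : ℝ)..t, q s ≤ a * Real.exp (C * t) := by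
  have hb : 0 ≤ b := ht.1.trans ht.2
  have hcont : ContinuousOn (fun t => a + C * ∫ s in (0 : ℝ)..t, q s) (Icc 0 b) := by
    have hint : IntervalIntegrable q volume 0 b :=
      ContinuousOn.intervalIntegrable (by rwa [uIcc_of_le hb])
    have hprim := intervalIntegral.continuousOn_primitive_interval' hint left_mem_uIcc
    rw [uIcc_of_le hb] at hprim
    exact continuousOn_const.add (continuousOn_const.mul hprim)
  have hderiv : ∀ x ∈ Ico 0 b, HasDerivWithinAt (fun t => a + C * ∫ s in (0 : ℝ)..t, q s)
      (C * q x) (Ici x) x :=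
    fun x hx => ((hasDerivWithinAt_integral_right hq hx).const_mul C).const_add a
  have hgronwall := le_gronwallBound_of_liminf_deriv_right_le (δ := a) (K := C) (ε := 0) hcont
    (fun x hx r hr => (hderiv x hx).liminf_right_slope_le hr)
    (by simp only [intervalIntegral.integral_same, mul_zero, add_zero, le_refl])
    (fun x hx => by
      rw [add_zero]
      exact mul_le_mul_of_nonneg_left (h x ⟨hx.1, hx.2.le⟩) hC) t ht
  rwa [gronwallBound_ε0, sub_zero] at hgronwall

end Calculus

section TimeMeasure

variable {T : ℝ}

theorem timeMeasure_mono {S : ℝ} (h : S ≤ T) : timeMeasure S ≤ timeMeasure T :=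
  Measure.restrict_mono (Ioo_subset_Ioo_right h) le_rfl

theorem integral_timeMeasure {Y : Type*} [NormedAddCommGroup Y] [NormedSpace ℝ Y] (hT : 0 ≤ T)
    (f : ℝ → Y) : ∫ t, f t ∂timeMeasure T = ∫ t in (0 : ℝ)..T, f t := by
  rw [intervalIntegral.integral_of_le hT, integral_Ioc_eq_integral_Ioo]

theorem integrable_timeMeasure_iff {Y : Type*} [NormedAddCommGroup Y] (hT : 0 ≤ T)
    {f : ℝ → Y} : Integrable f (timeMeasure T) ↔ IntervalIntegrable f volume 0 T :=
  (intervalIntegrable_iff_integrableOn_Ioo_of_le hT).symm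

theorem measurePreserving_add_timeMeasure (T h : ℝ) :
    MeasurePreserving (· + h) (timeMeasure (T - h)) (volume.restrict (Ioo h T)) := by
  have hpres := (measurePreserving_add_right (volume : Measure ℝ) h).restrict_preimage
    (s := Ioo h T) measurableSet_Ioo
  rwa [preimage_add_const_Ioo, sub_self] at hpres

theorem restrict_Ioo_le_timeMeasure {h : ℝ} (hh : 0 ≤ h) :
    volume.restrict (Ioo h T) ≤ timeMeasure T :=
  Measure.restrict_mono (Ioo_subset_Ioo_left hh) le_rfl

theorem ae_timeMeasure_and_add {P : ℝ → Prop} (hP : ∀ᵐ t ∂timeMeasure T, P t) {h : ℝ}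
    (hh : 0 ≤ h) : ∀ᵐ t ∂timeMeasure (T - h), P t ∧ P (t + h) :=
  Eventually.and (ae_mono (timeMeasure_mono (sub_le_self T hh)) hP) <|
    (measurePreserving_add_timeMeasure T h).quasiMeasurePreserving.ae
      (ae_mono (restrict_Ioo_le_timeMeasure hh) hP)

theorem memLp_add_sub {Y : Type*} [NormedAddCommGroup Y] {f : ℝ → Y} {p : ℝ≥0∞}
    (hf : MemLp f p (timeMeasure T)) {h : ℝ} (hh : 0 ≤ h) :
    MemLp (fun t => f (t + h) - f t) p (timeMeasure (T - h)) :=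
  ((hf.mono_measure (restrict_Ioo_le_timeMeasure hh)).comp_measurePreserving
    (measurePreserving_add_timeMeasure T h)).sub
    (hf.mono_measure (timeMeasure_mono (sub_le_self T hh)))

end TimeMeasure

section SquareIntegrals

variable {α Y : Type*} [MeasurableSpace α] [NormedAddCommGroup Y] {m : Measure α} {f : α → Y}

theorem eLpNorm_two_le_iff_lintegral {c : ℝ≥0∞} :
    eLpNorm f 2 m ≤ c ↔ ∫⁻ t, ‖f t‖ₑ ^ 2 ∂m ≤ c ^ 2 := by
  have hpow := eLpNorm_nnreal_pow_eq_lintegral (f := f) (μ := m) (p := 2) two_ne_zero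
  simp only [NNReal.coe_ofNat, ENNReal.rpow_ofNat, ENNReal.coe_ofNat] at hpow
  rw [← hpow]
  exact (ENNReal.pow_le_pow_left_iff two_ne_zero).symm

theorem eLpNorm_two_le_iff_integral (hf : MemLp f 2 m) {c : ℝ} (hc : 0 ≤ c) :
    eLpNorm f 2 m ≤ ENNReal.ofReal c ↔ ∫ t, ‖f t‖ ^ 2 ∂m ≤ c ^ 2 := by
  have hint : Integrable (fun t => ‖f t‖ ^ 2) m := hf.integrable_norm_pow two_ne_zero
  rw [eLpNorm_two_le_iff_lintegral, ← ENNReal.ofReal_pow hc,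
    ← ENNReal.ofReal_le_ofReal_iff (sq_nonneg c),
    ofReal_integral_eq_lintegral_ofReal hint (ae_of_all _ fun t => sq_nonneg _)]
  simp only [ENNReal.ofReal_pow (norm_nonneg _), ofReal_norm]

theorem sq_lintegral_le {φ : α → ℝ≥0∞} (hφ : AEMeasurable φ m) :
    (∫⁻ s, φ s ∂m) ^ 2 ≤ m univ * ∫⁻ s, φ s ^ 2 ∂m := by
  have hholder := ENNReal.lintegral_mul_le_Lp_mul_Lq m Real.HolderConjugate.two_two
    (f := fun _ => 1) (g := φ) aemeasurable_const hφ
  simp only [Pi.mul_apply, one_mul, lintegral_const, ENNReal.rpow_ofNat, one_pow] at hholder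
  calc (∫⁻ s, φ s ∂m) ^ 2 ≤ (m univ ^ (1 / 2 : ℝ) * (∫⁻ s, φ s ^ 2 ∂m) ^ (1 / 2 : ℝ)) ^ 2 := by
        gcongr
    _ = m univ * ∫⁻ s, φ s ^ 2 ∂m := by
        rw [mul_pow, ← ENNReal.rpow_natCast, ← ENNReal.rpow_natCast, ← ENNReal.rpow_mul,
          ← ENNReal.rpow_mul]
        norm_num

theorem lintegral_lintegral_Ioc_le {φ : ℝ → ℝ≥0∞} (hφ : AEMeasurable φ) (h : ℝ) :
    ∫⁻ t, ∫⁻ s in Ioc t (t + h), φ s ≤ ENNReal.ofReal h * ∫⁻ s, φ s := by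
  have htranslate (t : ℝ) :
      ∫⁻ s in Ioc t (t + h), φ s = ∫⁻ s in Ioc 0 h, hφ.mk φ (t + s) := by
    rw [lintegral_congr_ae (ae_restrict_of_ae hφ.ae_eq_mk),
      ← (measurePreserving_add_left volume t).setLIntegral_comp_preimage_emb
        (MeasurableEquiv.addLeft t).measurableEmbedding, preimage_const_add_Ioc, sub_self,
      add_sub_cancel_left]
  have hmeas : Measurable (fun p : ℝ × ℝ => hφ.mk φ (p.1 + p.2)) :=
    hφ.measurable_mk.comp (measurable_fst.add measurable_snd)
  simp_rw [htranslate]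
  rw [lintegral_lintegral_swap hmeas.aemeasurable]
  simp_rw [lintegral_add_right_eq_self (hφ.mk φ)]
  rw [setLIntegral_const, Real.volume_Ioc, sub_zero, mul_comm, lintegral_congr_ae hφ.ae_eq_mk]

end SquareIntegrals

namespace IsPrimitive

variable {X : Type*} [NormedAddCommGroup X] [NormedSpace ℝ X] {f g : ℝ → X} {T : ℝ}

theorem of_memLp (hT : 0 ≤ T) {p : ℝ≥0∞} (hp : 1 ≤ p) (hg : MemLp g p (timeMeasure T)) :
    IsPrimitive (fun t => ∫ s in (0 : ℝ)..t, g s) g T :=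
  of_integral ((integrable_timeMeasure_iff hT).1 (hg.integrable hp))

theorem add_sub (hfg : IsPrimitive f g T) {h : ℝ} (hh : h ∈ Icc 0 T) :
    IsPrimitive (fun t => f (t + h) - f t) (fun t => g (t + h) - g t) (T - h) := by
  have hT : 0 ≤ T := hh.1.trans hh.2
  have hshift {t : ℝ} (ht : t ∈ Icc 0 (T - h)) :
      IntervalIntegrable (fun s => g (s + h)) volume 0 t := by
    simpa only [sub_self, add_sub_cancel_right] using
      (hfg.intervalIntegrable_of_mem hh (t := t + h) ⟨by linarith [ht.1, hh.1],
        by linarith [ht.2]⟩).comp_add_right h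
  have hsub {t : ℝ} (ht : t ∈ Icc 0 (T - h)) : t ∈ Icc 0 T :=
    ⟨ht.1, ht.2.trans (sub_le_self T hh.1)⟩
  have hend : T - h ∈ Icc 0 (T - h) := ⟨sub_nonneg.2 hh.2, le_rfl⟩
  refine ⟨(hshift hend).sub (hfg.mono (hsub hend)).intervalIntegrable, fun t ht => ?_⟩
  have hth : t + h ∈ Icc 0 T := ⟨by linarith [ht.1, hh.1], by linarith [ht.2]⟩
  rw [intervalIntegral.integral_sub (hshift ht) (hfg.mono (hsub ht)).intervalIntegrable,
    intervalIntegral.integral_comp_add_right, zero_add, ← hfg.sub_eq_integral hh hth,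
    ← hfg.sub_eq_integral ⟨le_rfl, hT⟩ (hsub ht)]
  abel

theorem ae_norm_le [CompleteSpace X] (hfg : IsPrimitive f g T) {K : ℝ}
    (hbound : ∀ᶠ h in 𝓝[>] 0, ∀ t ∈ Ioo 0 (T - h), ‖f (t + h) - f t‖ ≤ K * h) :
    ∀ᵐ t ∂timeMeasure T, ‖g t‖ ≤ K := by
  rw [ae_restrict_iff' measurableSet_Ioo]
  filter_upwards [hfg.ae_hasDerivAt] with t hderiv ht
  refine le_of_tendsto (hderiv ht).tendsto_slope_zero_right.norm ?_
  filter_upwards [hbound, Ioo_mem_nhdsGT (sub_pos.2 ht.2)] with h hh hsmall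
  rw [norm_smul, norm_inv, Real.norm_of_nonneg hsmall.1.le, inv_mul_le_iff₀ hsmall.1,
    mul_comm h]
  exact hh t ⟨ht.1, by linarith [hsmall.2]⟩

end IsPrimitive

namespace IsH1

variable {U : Type*} [NormedAddCommGroup U] [NormedSpace ℝ U] {T : ℝ} {u du : ℝ → U}

theorem isPrimitive (hu : IsH1 T u du) (hT : 0 ≤ T) : IsPrimitive u du T :=
  ⟨(integrable_timeMeasure_iff hT).1 (hu.memLp_deriv.integrable one_le_two), hu.eq_integral⟩

theorem enorm_add_sub_sq_le (hu : IsH1 T u du) {h t : ℝ} (hh : 0 ≤ h) (ht : t ∈ Ioo 0 (T - h)) :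
    ‖u (t + h) - u t‖ₑ ^ 2
      ≤ ENNReal.ofReal h
        * ∫⁻ s in Ioc t (t + h), (Ioo 0 T).indicator (fun s => ‖du s‖ₑ ^ 2) s := by
  have hsub : Ioc t (t + h) ⊆ Ioo 0 T := fun s hs => ⟨ht.1.trans hs.1, by linarith [hs.2, ht.2]⟩
  have hT : 0 ≤ T := by linarith [ht.1, ht.2]
  have hincrement : u (t + h) - u t = ∫ s in Ioc t (t + h), du s := by
    rw [(hu.isPrimitive hT).sub_eq_integral ⟨ht.1.le, by linarith [ht.2]⟩
      ⟨by linarith [ht.1], by linarith [ht.2]⟩, intervalIntegral.integral_of_le (by linarith)]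
  have hmeas : AEMeasurable (fun s => ‖du s‖ₑ) (volume.restrict (Ioc t (t + h))) :=
    (hu.memLp_deriv.1.mono_measure (Measure.restrict_mono hsub le_rfl)).enorm
  calc ‖u (t + h) - u t‖ₑ ^ 2 ≤ (∫⁻ s in Ioc t (t + h), ‖du s‖ₑ) ^ 2 := by
        rw [hincrement]
        gcongr
        exact enorm_integral_le_lintegral_enorm _
    _ ≤ ENNReal.ofReal h * ∫⁻ s in Ioc t (t + h), ‖du s‖ₑ ^ 2 := by
        simpa only [Measure.restrict_apply_univ, Real.volume_Ioc, add_sub_cancel_left] using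
          sq_lintegral_le hmeas
    _ = _ := by
        congr 1
        exact setLIntegral_congr_fun measurableSet_Ioc fun s hs =>
          (indicator_of_mem (hsub hs) fun s => ‖du s‖ₑ ^ 2).symm

theorem eLpNorm_add_sub_le (hu : IsH1 T u du) {h : ℝ} (hh : 0 ≤ h) :
    eLpNorm (fun t => u (t + h) - u t) 2 (timeMeasure (T - h))
      ≤ ENNReal.ofReal h * eLpNorm du 2 (timeMeasure T) := by
  set φ : ℝ → ℝ≥0∞ := (Ioo 0 T).indicator fun s => ‖du s‖ₑ ^ 2 with hφ
  have hmeas : AEMeasurable φ :=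
    (aemeasurable_indicator_iff measurableSet_Ioo).2 (hu.memLp_deriv.1.enorm.pow_const 2)
  rw [eLpNorm_two_le_iff_lintegral]
  calc ∫⁻ t in Ioo 0 (T - h), ‖u (t + h) - u t‖ₑ ^ 2
      ≤ ∫⁻ t in Ioo 0 (T - h), ENNReal.ofReal h * ∫⁻ s in Ioc t (t + h), φ s :=
        setLIntegral_mono' measurableSet_Ioo fun t ht => hu.enorm_add_sub_sq_le hh ht
    _ ≤ ENNReal.ofReal h * ∫⁻ t, ∫⁻ s in Ioc t (t + h), φ s :=
        (setLIntegral_le_lintegral _ _).trans_eq (lintegral_const_mul' _ _ ENNReal.ofReal_ne_top)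
    _ ≤ ENNReal.ofReal h * (ENNReal.ofReal h * ∫⁻ s, φ s) := by
        gcongr
        exact lintegral_lintegral_Ioc_le hmeas h
    _ = ENNReal.ofReal h ^ 2 * ∫⁻ s in Ioo 0 T, ‖du s‖ₑ ^ 2 := by
        rw [← mul_assoc, ← sq, hφ, lintegral_indicator measurableSet_Ioo]
    _ ≤ (ENNReal.ofReal h * eLpNorm du 2 (timeMeasure T)) ^ 2 := by
        rw [mul_pow]
        gcongr
        exact eLpNorm_two_le_iff_lintegral.1 le_rfl

end IsH1

section WeakLimits

variable {X V : Type*} [NormedAddCommGroup X] [InnerProductSpace ℝ X] [CompleteSpace X]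
  [NormedAddCommGroup V] [InnerProductSpace ℝ V] [CompleteSpace V]

theorem isClosed_image_closedBall (j : V →L[ℝ] X) (c : ℝ) :
    IsClosed (j '' Metric.closedBall 0 c) := by
  -- The image of a ball is the trace on `X` of a weakly compact set of functionals.
  let Ψ : WeakDual ℝ V → X → ℝ := fun φ ξ => φ (ContinuousLinearMap.adjoint j ξ)
  have hΨ : Continuous Ψ := continuous_pi fun ξ => WeakDual.eval_continuous _
  have hcompact : IsCompact (Ψ '' (WeakDual.toStrongDual ⁻¹' Metric.closedBall 0 c)) :=
    (WeakDual.isCompact_closedBall (𝕜 := ℝ) (E := V) 0 c).image hΨ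
  have hpairing : Continuous fun (p ξ : X) => ⟪p, ξ⟫ :=
    continuous_pi fun ξ => continuous_id.inner continuous_const
  convert hcompact.isClosed.preimage hpairing using 1
  ext p
  constructor
  · rintro ⟨v, hv, rfl⟩
    refine ⟨StrongDual.toWeakDual (InnerProductSpace.toDual ℝ V v), ?_, funext fun ξ => ?_⟩
    · simpa using hv
    · exact (ContinuousLinearMap.adjoint_inner_right j v ξ)
  · rintro ⟨φ, hφ, heq⟩
    refine ⟨(InnerProductSpace.toDual ℝ V).symm (WeakDual.toStrongDual φ), ?_, ?_⟩
    · simpa using hφ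
    · refine ext_inner_right ℝ fun ξ => ?_
      rw [← ContinuousLinearMap.adjoint_inner_right, InnerProductSpace.toDual_symm_apply]
      exact congrFun heq ξ

theorem exists_enorm_le_liminf {j : V →L[ℝ] X} (hj : Function.Injective j) {x : ℕ → V} {p : X}
    (hx : liminf (fun n => ‖x n‖ₑ) atTop < ∞)
    (hp : Tendsto (fun n => j (x n)) atTop (𝓝 p)) :
    ∃ v, j v = p ∧ ‖v‖ₑ ≤ liminf (fun n => ‖x n‖ₑ) atTop := by
  have hball (c : ℝ≥0) (hc : liminf (fun n => ‖x n‖ₑ) atTop < c) :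
      ∃ v, j v = p ∧ ‖v‖ₑ ≤ c := by
    have hfreq : ∃ᶠ n in atTop, j (x n) ∈ j '' Metric.closedBall 0 c := by
      refine (frequently_lt_of_liminf_lt (by isBoundedDefault) hc).mono fun n hn =>
        mem_image_of_mem j ?_
      rw [mem_closedBall_zero_iff, ← coe_nnnorm, NNReal.coe_le_coe]
      exact ENNReal.coe_le_coe.1 hn.le
    obtain ⟨v, hv, rfl⟩ := (isClosed_image_closedBall j c).mem_of_frequently_of_tendsto hfreq hp
    rw [mem_closedBall_zero_iff, ← coe_nnnorm, NNReal.coe_le_coe] at hv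
    exact ⟨v, rfl, ENNReal.coe_le_coe.2 hv⟩
  obtain ⟨c, hc, -⟩ := ENNReal.lt_iff_exists_nnreal_btwn.1 hx
  obtain ⟨v, rfl, -⟩ := hball c hc
  refine ⟨v, rfl, le_of_forall_gt fun d hd => ?_⟩
  obtain ⟨c, hc, hcd⟩ := ENNReal.lt_iff_exists_nnreal_btwn.1 hd
  obtain ⟨w, hw, hwc⟩ := hball c hc
  rw [← hj hw]
  exact hwc.trans_lt hcd

theorem aestronglyMeasurable_of_comp {X V α : Type*} [NormedAddCommGroup X] [NormedSpace ℝ X]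
    [NormedAddCommGroup V] [NormedSpace ℝ V] [CompleteSpace V] [SecondCountableTopology V]
    [MeasurableSpace α] {m : Measure α} {j : V →L[ℝ] X} (hj : Function.Injective j)
    {z : α → V} {G : α → X} (hG : AEStronglyMeasurable G m) (h : ∀ᵐ t ∂m, j (z t) = G t) :
    AEStronglyMeasurable z m := by
  borelize V
  borelize X
  have hcomp : AEMeasurable (j ∘ z) m := hG.aemeasurable.congr (h.mono fun t ht => ht.symm)
  exact ((j.continuous.measurableEmbedding hj).aemeasurable_comp_iff.1 hcomp).aestronglyMeasurable

theorem exists_memLp_of_tendsto_comp [SecondCountableTopology V] {α : Type*} [MeasurableSpace α]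
    {m : Measure α} {j : V →L[ℝ] X} (hj : Function.Injective j) {ζ : ℕ → α → V} {G : α → X}
    {c : ℝ≥0∞} (hc : c < ∞) (hζ : ∀ n, AEStronglyMeasurable (ζ n) m)
    (hbound : ∀ n, eLpNorm (ζ n) 2 m ≤ c)
    (hlim : ∀ᵐ t ∂m, Tendsto (fun n => j (ζ n t)) atTop (𝓝 (G t))) :
    ∃ z : α → V, MemLp z 2 m ∧ eLpNorm z 2 m ≤ c ∧ ∀ᵐ t ∂m, j (z t) = G t := by
  have hsq : Monotone fun a : ℝ≥0∞ => a ^ 2 := fun a b hab => pow_le_pow_left' hab 2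
  have hliminf (t : α) : liminf (fun n => ‖ζ n t‖ₑ ^ 2) atTop
      = liminf (fun n => ‖ζ n t‖ₑ) atTop ^ 2 :=
    (hsq.map_liminf_of_continuousAt (fun n => ‖ζ n t‖ₑ)
      (ENNReal.continuous_pow 2).continuousAt).symm
  have hfatou : ∫⁻ t, liminf (fun n => ‖ζ n t‖ₑ) atTop ^ 2 ∂m ≤ c ^ 2 := by
    simp only [← hliminf]
    refine (lintegral_liminf_le' fun n => (hζ n).enorm.pow_const 2).trans ?_
    refine (liminf_le_liminf <| Eventually.of_forall fun n =>
      eLpNorm_two_le_iff_lintegral.1 (hbound n)).trans_eq ?_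
    exact liminf_const _
  have hmeas : AEMeasurable (fun t => liminf (fun n => ‖ζ n t‖ₑ) atTop) m := by
    simp only [liminf_eq_iSup_iInf_of_nat]
    exact AEMeasurable.iSup fun n =>
      AEMeasurable.biInf _ (to_countable _) fun i _ => (hζ i).enorm
  have hfinite : ∀ᵐ t ∂m, liminf (fun n => ‖ζ n t‖ₑ) atTop ^ 2 < ∞ :=
    ae_lt_top' (hmeas.pow_const 2) (hfatou.trans_lt (ENNReal.pow_lt_top hc)).ne
  have hex : ∀ᵐ t ∂m, ∃ v, j v = G t ∧ ‖v‖ₑ ≤ liminf (fun n => ‖ζ n t‖ₑ) atTop := by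
    filter_upwards [hfinite, hlim] with t ht htend
    exact exists_enorm_le_liminf hj ((ENNReal.pow_lt_top_iff.1 ht).resolve_right two_ne_zero) htend
  obtain ⟨z, hz⟩ := Filter.skolem.1 hex
  have hG : AEStronglyMeasurable G m := aestronglyMeasurable_of_tendsto_ae atTop
    (fun n => j.continuous.comp_aestronglyMeasurable (hζ n)) hlim
  have hjz : ∀ᵐ t ∂m, j (z t) = G t := hz.mono fun t ht => ht.1
  have hnorm : eLpNorm z 2 m ≤ c := by
    rw [eLpNorm_two_le_iff_lintegral]
    exact (lintegral_mono_ae (hz.mono fun t ht => hsq ht.2)).trans hfatou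
  exact ⟨z, ⟨aestronglyMeasurable_of_comp hj hG hjz, hnorm.trans_lt hc⟩, hnorm, hjz⟩

theorem exists_memLp_deriv_of_eLpNorm_add_sub_le [SecondCountableTopology V] {j : V →L[ℝ] X}
    (hj : Function.Injective j) {T K : ℝ} {F G : ℝ → X} {w : ℝ → V} (hFG : IsPrimitive F G T)
    (hw : MemLp w 2 (timeMeasure T)) (hjw : ∀ᵐ t ∂timeMeasure T, j (w t) = F t)
    (hbound : ∀ᶠ h in 𝓝[>] 0, eLpNorm (fun t => w (t + h) - w t) 2 (timeMeasure (T - h))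
      ≤ ENNReal.ofReal (K * h)) :
    ∃ z : ℝ → V, MemLp z 2 (timeMeasure T) ∧
      eLpNorm z 2 (timeMeasure T) ≤ ENNReal.ofReal K ∧ ∀ᵐ t ∂timeMeasure T, j (z t) = G t := by
  obtain ⟨h, hlim, hh⟩ := exists_seq_forall_of_frequently
    (hbound.and self_mem_nhdsWithin).frequently
  have hpos (n : ℕ) : 0 < h n := (hh n).2
  let ζ (n : ℕ) : ℝ → V :=
    (Ioo 0 (T - h n)).indicator fun t => (h n)⁻¹ • (w (t + h n) - w t)
  have hrestrict (n : ℕ) : (timeMeasure T).restrict (Ioo 0 (T - h n)) = timeMeasure (T - h n) :=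
    Measure.restrict_restrict_of_subset (Ioo_subset_Ioo_right (sub_le_self T (hpos n).le))
  have hζ (n : ℕ) : AEStronglyMeasurable (ζ n) (timeMeasure T) := by
    rw [aestronglyMeasurable_indicator_iff measurableSet_Ioo, hrestrict]
    exact (memLp_add_sub hw (hpos n).le).1.const_smul _
  have hζnorm (n : ℕ) : eLpNorm (ζ n) 2 (timeMeasure T) ≤ ENNReal.ofReal K := by
    rw [eLpNorm_indicator_eq_eLpNorm_restrict measurableSet_Ioo, hrestrict]
    refine (eLpNorm_const_smul_le (c := (h n)⁻¹)
      (f := fun t => w (t + h n) - w t)).trans ?_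
    rw [Real.enorm_of_nonneg (inv_nonneg.2 (hpos n).le)]
    calc _ ≤ ENNReal.ofReal (h n)⁻¹ * ENNReal.ofReal (K * h n) := by
          gcongr
          exact (hh n).1
      _ = ENNReal.ofReal K := by
          rw [← ENNReal.ofReal_mul (inv_nonneg.2 (hpos n).le), mul_comm K,
            inv_mul_cancel_left₀ (hpos n).ne']
  have hquotient : ∀ᵐ t ∂timeMeasure T, Tendsto (fun n => j (ζ n t)) atTop (𝓝 (G t)) := by
    have hall : ∀ᵐ t, ∀ n, t ∈ Ioo 0 (T - h n) →
        j (w t) = F t ∧ j (w (t + h n)) = F (t + h n) :=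
      ae_all_iff.2 fun n => (ae_restrict_iff' measurableSet_Ioo).1
        (ae_timeMeasure_and_add hjw (hpos n).le)
    rw [ae_restrict_iff' measurableSet_Ioo]
    filter_upwards [hFG.ae_hasDerivAt, hall] with t hderiv hae ht
    refine ((hderiv ht).tendsto_slope_zero_right.comp hlim).congr' ?_
    filter_upwards [hlim.mono_right nhdsWithin_le_nhds |>.eventually_lt_const (sub_pos.2 ht.2)]
      with n hn
    have htn : t ∈ Ioo 0 (T - h n) := ⟨ht.1, by linarith⟩
    simp only [ζ, indicator_of_mem htn, map_smul, map_sub, (hae n htn).1, (hae n htn).2,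
      Function.comp_apply]
  exact exists_memLp_of_tendsto_comp hj ENNReal.ofReal_lt_top hζ hζnorm hquotient

end WeakLimits

variable {X V U : Type*} [NormedAddCommGroup X] [InnerProductSpace ℝ X]
  [NormedAddCommGroup V] [InnerProductSpace ℝ V] [NormedAddCommGroup U]

/-- An evolution `∂ₜ(j w) = G`, `w(0) = 0`, in a Hilbert space `X` containing `V` through `j`,
whose right-hand side dissipates the `V`-norm of increments, up to lower order terms controlled
by the source `u`. Since `w` and `G` are only defined almost everywhere, the inequalities are
required on a set `S` of full measure; those for increments start from the time `0`, where `w`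
vanishes, only for times below `ε`. -/
structure DissipativeEvolution (j : V →L[ℝ] X) (T C M ε : ℝ) (G : ℝ → X) (w : ℝ → V) (u : ℝ → U)
    (S : Set ℝ) : Prop where
  memLp_rhs : MemLp G 2 (timeMeasure T)
  memLp : MemLp w 2 (timeMeasure T)
  ae_mem : ∀ᵐ t ∂timeMeasure T, t ∈ S
  map_eq_integral : ∀ t ∈ S, j (w t) = ∫ s in (0 : ℝ)..t, G s
  increment_le : ∀ s ∈ S, ∀ t ∈ S, ⟪G t - G s, j (w t - w s)⟫ + 1 / 2 * ‖w t - w s‖ ^ 2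
    ≤ C * (‖j (w t - w s)‖ ^ 2 + ‖u t - u s‖ ^ 2)
  initial_le : ∀ t ∈ S, t < ε → ⟪G t, j (w t)⟫ ≤ C * ‖j (w t)‖ ^ 2 + M * ‖j (w t)‖

/-- The bound produced by Grönwall's inequality for the time derivative of a
`DissipativeEvolution` whose source has a derivative of norm at most `R` in `L²(0,T)`. -/
def evolutionBound (T C M R : ℝ) : ℝ := √((16 * M ^ 2 + 2 * C * R ^ 2) * Real.exp (2 * C * T))

theorem sq_evolutionBound {T C M R : ℝ} (hC : 0 ≤ C) :
    evolutionBound T C M R ^ 2 = (16 * M ^ 2 + 2 * C * R ^ 2) * Real.exp (2 * C * T) :=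
  Real.sq_sqrt (by positivity)

theorem evolutionBound_nonneg (T C M R : ℝ) : 0 ≤ evolutionBound T C M R := Real.sqrt_nonneg _

namespace DissipativeEvolution

variable {j : V →L[ℝ] X} {T C M R ε : ℝ} {G : ℝ → X} {w : ℝ → V} {u du : ℝ → U} {S : Set ℝ}

theorem isPrimitive (E : DissipativeEvolution j T C M ε G w u S) (hT : 0 ≤ T) :
    IsPrimitive (fun t => ∫ s in (0 : ℝ)..t, G s) G T :=
  IsPrimitive.of_memLp hT one_le_two E.memLp_rhs

theorem norm_integral_le [CompleteSpace X] (E : DissipativeEvolution j T C M ε G w u S)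
    (hC : 0 ≤ C) (hM : 0 ≤ M) {h : ℝ} (hh : 0 < h) (hhT : h < T) (hhε : h < ε)
    (hCh : 4 * C * h ≤ 1) :
    ‖∫ s in (0 : ℝ)..h, G s‖ ≤ 4 * M * h := by
  refine ((E.isPrimitive (hh.trans hhT).le).mono ⟨hh.le, hhT.le⟩).norm_le_of_inner_le hh.le hC hM
    hCh intervalIntegral.integral_same ?_
  filter_upwards [(ae_restrict_iff' measurableSet_Ioo).1 E.ae_mem] with t ht htm
  have htS := ht ⟨htm.1, htm.2.trans_lt hhT⟩
  rw [← E.map_eq_integral t htS]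
  exact E.initial_le t htS (htm.2.trans_lt hhε)

theorem ae_increment_le (E : DissipativeEvolution j T C M ε G w u S) {h : ℝ} (hh : 0 ≤ h) :
    ∀ᵐ t ∂timeMeasure (T - h), ‖w (t + h) - w t‖ ^ 2
      ≤ 2 * C * ‖(∫ s in (0 : ℝ)..t + h, G s) - ∫ s in (0 : ℝ)..t, G s‖ ^ 2
        + 2 * C * ‖u (t + h) - u t‖ ^ 2
        - 2 * ⟪G (t + h) - G t, (∫ s in (0 : ℝ)..t + h, G s) - ∫ s in (0 : ℝ)..t, G s⟫ := by
  filter_upwards [ae_timeMeasure_and_add E.ae_mem hh] with t ⟨ht, hth⟩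
  have hincrement := E.increment_le t ht (t + h) hth
  rw [map_sub, E.map_eq_integral t ht, E.map_eq_integral (t + h) hth] at hincrement
  linarith

theorem norm_sq_add_integral_le [CompleteSpace X] (E : DissipativeEvolution j T C M ε G w u S)
    (hu : MemLp u 2 (timeMeasure T)) {h b : ℝ} (hh : 0 ≤ h) (hb : b ∈ Icc 0 (T - h)) :
    ‖(∫ s in (0 : ℝ)..b + h, G s) - ∫ s in (0 : ℝ)..b, G s‖ ^ 2
        + ∫ t, ‖w (t + h) - w t‖ ^ 2 ∂timeMeasure b
      ≤ ‖∫ s in (0 : ℝ)..h, G s‖ ^ 2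
        + 2 * C * ∫ t, ‖u (t + h) - u t‖ ^ 2 ∂timeMeasure b
        + 2 * C * ∫ t in (0 : ℝ)..b,
            ‖(∫ s in (0 : ℝ)..t + h, G s) - ∫ s in (0 : ℝ)..t, G s‖ ^ 2 := by
  have hprim := ((E.isPrimitive (by linarith [hb.1, hb.2])).add_sub
    ⟨hh, by linarith [hb.1, hb.2]⟩).mono hb
  have henergy := hprim.norm_sq_eq_add_integral_inner hb.1
  set f : ℝ → X := fun t => (∫ s in (0 : ℝ)..t + h, G s) - ∫ s in (0 : ℝ)..t, G s
  have hmono := timeMeasure_mono hb.2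
  have hf_int : Integrable (fun t => ‖f t‖ ^ 2) (timeMeasure b) :=
    (integrable_timeMeasure_iff hb.1).2 <| ContinuousOn.intervalIntegrable <| by
      rw [uIcc_of_le hb.1]
      exact hprim.continuousOn.norm.pow 2
  have hu_int : Integrable (fun t => ‖u (t + h) - u t‖ ^ 2) (timeMeasure b) :=
    ((memLp_add_sub hu hh).mono_measure hmono).integrable_norm_pow two_ne_zero
  have hw_int : Integrable (fun t => ‖w (t + h) - w t‖ ^ 2) (timeMeasure b) :=
    ((memLp_add_sub E.memLp hh).mono_measure hmono).integrable_norm_pow two_ne_zero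
  have hinner_int : Integrable (fun t => ⟪G (t + h) - G t, f t⟫) (timeMeasure b) :=
    (integrable_timeMeasure_iff hb.1).2 (hprim.intervalIntegrable_inner hb.1)
  have hsum_int : Integrable (fun t => 2 * C * ‖f t‖ ^ 2 + 2 * C * ‖u (t + h) - u t‖ ^ 2)
      (timeMeasure b) := (hf_int.const_mul _).add (hu_int.const_mul _)
  have hle := integral_mono_ae hw_int (hsum_int.sub (hinner_int.const_mul 2))
    (ae_mono hmono (E.ae_increment_le hh))
  rw [integral_sub' hsum_int (hinner_int.const_mul 2),
    integral_add (hf_int.const_mul _) (hu_int.const_mul _), integral_const_mul,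
    integral_const_mul, integral_const_mul, integral_timeMeasure hb.1 fun t => ‖f t‖ ^ 2,
    integral_timeMeasure hb.1 fun t => ⟪G (t + h) - G t, f t⟫] at hle
  rw [zero_add, intervalIntegral.integral_same, sub_zero] at henergy
  linarith

theorem norm_sq_add_integral_le_sq [CompleteSpace X] [NormedSpace ℝ U]
    (E : DissipativeEvolution j T C M ε G w u S) (hC : 0 ≤ C)
    (hR : 0 ≤ R) (hu : IsH1 T u du) (hdu : eLpNorm du 2 (timeMeasure T) ≤ ENNReal.ofReal R)
    {h b : ℝ} (hh : 0 ≤ h) (hb : b ∈ Icc 0 (T - h))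
    (hinit : ‖∫ s in (0 : ℝ)..h, G s‖ ≤ 4 * M * h) :
    ‖(∫ s in (0 : ℝ)..b + h, G s) - ∫ s in (0 : ℝ)..b, G s‖ ^ 2
        + ∫ t, ‖w (t + h) - w t‖ ^ 2 ∂timeMeasure b
      ≤ (evolutionBound T C M R * h) ^ 2 := by
  set q : ℝ → ℝ := fun t => ‖(∫ s in (0 : ℝ)..t + h, G s) - ∫ s in (0 : ℝ)..t, G s‖ ^ 2
  have hsource (b : ℝ) (hb : b ∈ Icc 0 (T - h)) :
      ∫ t, ‖u (t + h) - u t‖ ^ 2 ∂timeMeasure b ≤ (h * R) ^ 2 := by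
    have hmono := timeMeasure_mono hb.2
    rw [← eLpNorm_two_le_iff_integral ((memLp_add_sub hu.memLp hh).mono_measure hmono)
      (by positivity), ENNReal.ofReal_mul hh]
    refine (eLpNorm_mono_measure _ hmono).trans ((hu.eLpNorm_add_sub_le hh).trans ?_)
    gcongr
  have henergy (b : ℝ) (hb : b ∈ Icc 0 (T - h)) :
      q b + ∫ t, ‖w (t + h) - w t‖ ^ 2 ∂timeMeasure b
        ≤ (16 * M ^ 2 + 2 * C * R ^ 2) * h ^ 2 + 2 * C * ∫ t in (0 : ℝ)..b, q t := by
    have hinit_sq : ‖∫ s in (0 : ℝ)..h, G s‖ ^ 2 ≤ (4 * M * h) ^ 2 := by gcongr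
    have hsource_mul := mul_le_mul_of_nonneg_left (hsource b hb) (by positivity : 0 ≤ 2 * C)
    have := E.norm_sq_add_integral_le hu.memLp hh hb
    linarith
  have hcont : ContinuousOn q (Icc 0 (T - h)) :=
    ((E.isPrimitive (by linarith [hb.1, hb.2])).add_sub
      ⟨hh, by linarith [hb.1, hb.2]⟩).continuousOn.norm.pow 2
  have hgronwall := add_mul_integral_le_mul_exp (by positivity : 0 ≤ 2 * C) hcont
    (fun t ht => (le_add_of_nonneg_right (integral_nonneg fun t => sq_nonneg _)).trans
      (henergy t ht)) hb
  refine (henergy b hb).trans (hgronwall.trans ?_)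
  rw [mul_pow, sq_evolutionBound hC, mul_right_comm]
  gcongr
  linarith [hb.2]

theorem eventually_norm_integral_le [CompleteSpace X]
    (E : DissipativeEvolution j T C M ε G w u S) (hT : 0 < T) (hC : 0 ≤ C)
    (hM : 0 ≤ M) (hε : 0 < ε) :
    ∀ᶠ h in 𝓝[>] 0, 0 < h ∧ h < T ∧ ‖∫ s in (0 : ℝ)..h, G s‖ ≤ 4 * M * h := by
  filter_upwards [Ioo_mem_nhdsGT hT, Ioo_mem_nhdsGT hε,
    Ioo_mem_nhdsGT (by positivity : 0 < 1 / (4 * C + 1))] with h hhT hhε hhC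
  refine ⟨hhT.1, hhT.2, E.norm_integral_le hC hM hhT.1 hhT.2 hhε.2 ?_⟩
  have := (lt_div_iff₀ (by positivity)).1 hhC.2
  linarith [hhT.1]

theorem exists_memLp_deriv [CompleteSpace X] [CompleteSpace V] [SecondCountableTopology V]
    [NormedSpace ℝ U] (hj : Function.Injective j) (hT : 0 < T)
    (hC : 0 ≤ C) (hM : 0 ≤ M) (hR : 0 ≤ R) (hε : 0 < ε)
    (E : DissipativeEvolution j T C M ε G w u S) (hu : IsH1 T u du)
    (hdu : eLpNorm du 2 (timeMeasure T) ≤ ENNReal.ofReal R) :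
    (∃ z : ℝ → V, MemLp z 2 (timeMeasure T) ∧
      eLpNorm z 2 (timeMeasure T) ≤ ENNReal.ofReal (evolutionBound T C M R) ∧
      ∀ᵐ t ∂timeMeasure T, j (z t) = G t) ∧
    ∀ᵐ t ∂timeMeasure T, ‖G t‖ ≤ evolutionBound T C M R := by
  have hinit := E.eventually_norm_integral_le hT hC hM hε
  constructor
  · refine exists_memLp_deriv_of_eLpNorm_add_sub_le hj (E.isPrimitive hT.le) E.memLp
      (E.ae_mem.mono E.map_eq_integral) ?_
    filter_upwards [hinit] with h ⟨hpos, hhT, hh⟩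
    have hK := evolutionBound_nonneg T C M R
    rw [eLpNorm_two_le_iff_integral (memLp_add_sub E.memLp hpos.le) (by positivity)]
    exact (le_add_of_nonneg_left (sq_nonneg _)).trans
      (E.norm_sq_add_integral_le_sq hC hR hu hdu hpos.le ⟨sub_nonneg.2 hhT.le, le_rfl⟩ hh)
  · refine (E.isPrimitive hT.le).ae_norm_le ?_
    filter_upwards [hinit] with h hinit_h t ht
    obtain ⟨hpos, -, hh⟩ := hinit_h
    have hK := evolutionBound_nonneg T C M R
    refine le_of_sq_le_sq ?_ (by positivity)
    exact (le_add_of_nonneg_right (integral_nonneg fun t => sq_nonneg _)).trans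
      (E.norm_sq_add_integral_le_sq hC hR hu hdu hpos.le (Ioo_subset_Icc_self ht) hh)

end DissipativeEvolution

theorem exists_norm_sq_le_of_isCompactOperator {V H E : Type*} [NormedAddCommGroup V]
    [NormedSpace ℝ V] [NormedAddCommGroup H] [NormedSpace ℝ H] [NormedAddCommGroup E]
    [NormedSpace ℝ E] {K : V →L[ℝ] H} (hK : IsCompactOperator K) {i : H →L[ℝ] E}
    (hi : Function.Injective i) {ε : ℝ} (hε : 0 < ε) :
    ∃ C : ℝ, 0 ≤ C ∧ ∀ v, ‖K v‖ ^ 2 ≤ ε * ‖v‖ ^ 2 + C * ‖i (K v)‖ ^ 2 := by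
  by_contra! hcontra
  choose v hv using fun n : ℕ => hcontra n n.cast_nonneg
  have hv0 : ∀ n, 0 < ‖v n‖ := fun n => norm_pos_iff.2 fun h => by simpa [h] using hv n
  set x : ℕ → V := fun n => ‖v n‖⁻¹ • v n
  have hx : ∀ n, ε + n * ‖i (K (x n))‖ ^ 2 < ‖K (x n)‖ ^ 2 := fun n => by
    have h := mul_lt_mul_of_pos_left (hv n) (by have := hv0 n; positivity : 0 < (‖v n‖⁻¹) ^ 2)
    simp only [x, map_smul, norm_smul, norm_inv, norm_norm, mul_pow]
    refine lt_of_eq_of_lt ?_ h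
    have := (hv0 n).ne'
    field
  obtain ⟨Q, hQ, hKQ⟩ := hK.image_closedBall_subset_compact (f := K.toLinearMap) 1
  obtain ⟨z, -, φ, hφ, hlim⟩ := hQ.tendsto_subseq (x := fun n => K (x n)) fun n =>
    hKQ ⟨x n, by simp [x, norm_smul, (hv0 n).ne'], rfl⟩
  have hnorm := hlim.norm.pow 2
  have hiz : Tendsto (fun n => ‖i (K (x (φ n)))‖ ^ 2) atTop (𝓝 0) := by
    refine squeeze_zero' (.of_forall fun n => sq_nonneg _) ?_
      (hnorm.div_atTop (tendsto_natCast_atTop_atTop.comp hφ.tendsto_atTop))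
    filter_upwards [eventually_gt_atTop 0] with n hn
    have hφn : (0 : ℝ) < φ n := Nat.cast_pos.2 (hn.trans_le (hφ.id_le n))
    rw [Function.comp_apply, Function.comp_apply, le_div_iff₀' hφn]
    linarith [hx (φ n)]
  have hz : z = 0 := hi <| by
    have h := tendsto_nhds_unique (((i.continuous.tendsto z).comp hlim).norm.pow 2) hiz
    simpa using h
  have hεz : ε ≤ ‖z‖ ^ 2 := ge_of_tendsto' hnorm fun n =>
    (le_add_of_nonneg_right (by positivity)).trans (hx (φ n)).le
  simp only [hz, norm_zero] at hεz
  linarith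

namespace EigenSystem

variable {H : Type*} [NormedAddCommGroup H] [InnerProductSpace ℝ H] {A : H →ₗ.[ℝ] H}
  (S : EigenSystem A) {s : ℝ}

theorem tendsto_lam_rpow (hs : 0 < s) : Tendsto (fun j => S.lam j ^ s) atTop atTop :=
  (tendsto_rpow_atTop hs).comp S.tendsto

theorem inner_vec_vec (i j : ℕ) : ⟪S.vec i, S.vec j⟫ = if i = j then (1 : ℝ) else 0 :=
  orthonormal_iff_ite.1 S.orthonormal i j

/-- The projection onto the span of the first `N` eigenvectors. -/
def proj (N : ℕ) : H →L[ℝ] H :=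
  ∑ j ∈ Finset.range N, (innerSL ℝ (S.vec j)).smulRight (S.vec j)

theorem isCompactOperator_proj (N : ℕ) : IsCompactOperator (S.proj N) :=
  Submodule.sum_mem (compactOperator (RingHom.id ℝ) H H) fun j _ =>
    (isCompactOperator_of_locallyCompactSpace_rng
      (ContinuousLinearMap.toSpanSingleton ℝ (S.vec j))).comp_clm (innerSL ℝ (S.vec j))

theorem inner_vec_proj (N j : ℕ) (v : H) :
    ⟪S.vec j, S.proj N v⟫ = if j < N then ⟪S.vec j, v⟫ else 0 := by
  simp [proj, inner_sum, real_inner_smul_right, inner_vec_vec]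

variable [CompleteSpace H]

/-- The eigenvectors as a Hilbert basis. -/
def basis : HilbertBasis ℕ ℝ H := HilbertBasis.mk S.orthonormal S.complete.ge

theorem hasSum_inner (v w : H) :
    HasSum (fun j => ⟪S.vec j, v⟫ * ⟪S.vec j, w⟫) ⟪v, w⟫ := by
  have h := S.basis.hasSum_inner_mul_inner v w
  simp only [basis, HilbertBasis.coe_mk] at h
  simpa only [real_inner_comm v] using h

theorem hasSum_inner_sq (v : H) : HasSum (fun j => ⟪S.vec j, v⟫ ^ 2) (‖v‖ ^ 2) := by
  simpa only [← sq, real_inner_self_eq_norm_sq] using S.hasSum_inner v v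

theorem eq_of_inner_vec {v w : H} (h : ∀ j, ⟪S.vec j, v⟫ = ⟪S.vec j, w⟫) : v = w := by
  refine S.basis.repr.injective (lp.ext (funext fun j => ?_))
  simpa only [HilbertBasis.repr_apply_apply, basis, HilbertBasis.coe_mk] using h j

theorem inner_vec_pow (v : S.domPow s) (j : ℕ) :
    ⟪S.vec j, S.pow s v⟫ = S.lam j ^ s * ⟪S.vec j, (v : H)⟫ := by
  have h := (S.summable_pow v.2).hasSum.mapL (innerSL ℝ (S.vec j))
  refine h.unique ((hasSum_ite_eq j (S.lam j ^ s * ⟪S.vec j, (v : H)⟫)).congr_fun fun i => ?_)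
  rw [innerSL_apply_apply, real_inner_smul_right, inner_vec_vec]
  rcases eq_or_ne i j with rfl | hij
  · simp
  · simp [hij, hij.symm]

theorem mem_domPow_of_inner_eq {v w : H}
    (h : ∀ j, ⟪S.vec j, w⟫ = S.lam j ^ s * ⟪S.vec j, v⟫) : v ∈ S.domPow s := by
  change Summable _
  simpa only [h] using (S.hasSum_inner_sq w).summable

theorem vec_mem_domPow (s : ℝ) (j : ℕ) : S.vec j ∈ S.domPow s := by
  refine S.mem_domPow_of_inner_eq (w := S.lam j ^ s • S.vec j) fun i => ?_
  rw [real_inner_smul_right, inner_vec_vec]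
  rcases eq_or_ne i j with rfl | hij
  · rfl
  · simp [hij]

theorem rpow_two_mul (s : ℝ) (j : ℕ) : S.lam j ^ (2 * s) = (S.lam j ^ s) ^ 2 := by
  rw [mul_comm, Real.rpow_mul (S.lam_nonneg j), Real.rpow_two]

theorem domPow_two_mul_le (s : ℝ) : S.domPow (2 * s) ≤ S.domPow s := fun v hv => by
  refine Summable.of_nonneg_of_le (fun j => sq_nonneg _) (fun j => ?_)
    ((S.hasSum_inner_sq v).summable.add hv)
  rw [rpow_two_mul, mul_pow, mul_pow]
  nlinarith [sq_nonneg ⟪S.vec j, v⟫, mul_nonneg (sq_nonneg ((S.lam j ^ s) ^ 2 - 1))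
    (sq_nonneg ⟪S.vec j, v⟫), mul_nonneg (sq_nonneg (S.lam j ^ s)) (sq_nonneg ⟪S.vec j, v⟫)]

namespace GraphSpace

variable {S}

theorem inner_vec_op (v : S.GraphSpace s) (j : ℕ) :
    ⟪S.vec j, op v⟫ = S.lam j ^ s * ⟪S.vec j, toH v⟫ := S.inner_vec_pow v j

/-- An element of `H` that belongs to `D(A^s)`, as an element of the graph space. -/
def ofMem {v : H} (hv : v ∈ S.domPow s) : S.GraphSpace s := ⟨v, hv⟩

theorem toH_ofMem {v : H} (hv : v ∈ S.domPow s) : toH (ofMem hv) = v := rfl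

theorem toH_injective : Function.Injective (toH : S.GraphSpace s → H) := Subtype.val_injective

instance : InnerProductSpace ℝ (S.GraphSpace s) := InnerProductSpace.induced (S.graphMap s)

/-- The graph map as a linear isometry. -/
def graphIsometry : S.GraphSpace s →ₗᵢ[ℝ] WithLp 2 (H × H) where
  toLinearMap := S.graphMap s
  norm_map' _ := rfl

theorem range_graphIsometry :
    range (graphIsometry : S.GraphSpace s →ₗᵢ[ℝ] WithLp 2 (H × H)) =
      ⋂ j, {p | ⟪S.vec j, p.snd⟫ = S.lam j ^ s * ⟪S.vec j, p.fst⟫} := by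
  ext p
  simp only [mem_range, mem_iInter, mem_ofPred_eq]
  constructor
  · rintro ⟨v, rfl⟩ j
    exact inner_vec_op v j
  · intro h
    let v : S.GraphSpace s := ofMem (S.mem_domPow_of_inner_eq h)
    have hop : op v = p.snd := S.eq_of_inner_vec fun j => by rw [inner_vec_op, h]; rfl
    exact ⟨v, (WithLp.equiv 2 (H × H)).injective (Prod.ext rfl hop)⟩

instance : CompleteSpace (S.GraphSpace s) := by
  rw [completeSpace_iff_isComplete_range
    (graphIsometry (S := S) (s := s)).isometry.isUniformInducing, range_graphIsometry]
  refine IsClosed.isComplete (isClosed_iInter fun j => isClosed_eq ?_ ?_)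
  · exact continuous_const.inner (WithLp.continuous_snd 2 H H)
  · exact continuous_const.mul (continuous_const.inner (WithLp.continuous_fst 2 H H))

instance [SecondCountableTopology H] : SecondCountableTopology (S.GraphSpace s) :=
  have : SecondCountableTopology (WithLp 2 (H × H)) :=
    (WithLp.homeomorphProd 2 H H).secondCountableTopology
  (graphIsometry (S := S) (s := s)).isometry.isEmbedding.isInducing.secondCountableTopology

theorem norm_toH_le (v : S.GraphSpace s) : ‖toH v‖ ≤ ‖v‖ :=
  le_of_sq_le_sq (by rw [norm_sq]; nlinarith [sq_nonneg ‖op v‖]) (norm_nonneg _)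

theorem norm_op_le (v : S.GraphSpace s) : ‖op v‖ ≤ ‖v‖ :=
  le_of_sq_le_sq (by rw [norm_sq]; nlinarith [sq_nonneg ‖toH v‖]) (norm_nonneg _)

/-- The continuous inclusion of `D(A^s)` into `H`. -/
def toHL : S.GraphSpace s →L[ℝ] H :=
  LinearMap.mkContinuous toH 1 fun v => by rw [one_mul]; exact norm_toH_le v

theorem norm_toH_sub_proj_le (v : S.GraphSpace s) {N : ℕ} (hs : 0 < s) (hN : 0 < S.lam N ^ s) :
    ‖toH v - S.proj N (toH v)‖ ≤ (S.lam N ^ s)⁻¹ * ‖v‖ := by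
  rw [le_inv_mul_iff₀ hN]
  refine le_trans (le_of_sq_le_sq ?_ (norm_nonneg _)) (norm_op_le v)
  rw [mul_pow]
  refine hasSum_le (fun j => ?_) ((S.hasSum_inner_sq _).mul_left _) (S.hasSum_inner_sq (op v))
  rw [inner_sub_right, inner_vec_proj, inner_vec_op, mul_pow]
  split_ifs with hj
  · simp only [sub_self, ne_eq, OfNat.ofNat_ne_zero, not_false_eq_true, zero_pow, mul_zero]
    positivity
  · have := S.mono (not_lt.1 hj)
    have := S.lam_nonneg N
    rw [sub_zero]
    gcongr

theorem isCompactOperator_toHL (hs : 0 < s) :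
    IsCompactOperator (toHL : S.GraphSpace s →L[ℝ] H) := by
  have hlim := S.tendsto_lam_rpow hs
  refine isCompactOperator_of_tendsto (F := fun N => S.proj N ∘L toHL) (l := atTop) ?_
    (.of_forall fun N => (S.isCompactOperator_proj N).comp_clm toHL)
  rw [tendsto_iff_norm_sub_tendsto_zero]
  refine squeeze_zero' (.of_forall fun _ => norm_nonneg _) ?_ hlim.inv_tendsto_atTop
  filter_upwards [hlim.eventually_gt_atTop 0] with N hN
  refine ContinuousLinearMap.opNorm_le_bound _ (inv_nonneg.2 hN.le) fun v => ?_
  rw [sub_apply, norm_sub_rev]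
  exact norm_toH_sub_proj_le v hs hN

/-- The inclusion of `D(A^(2s))` into `D(A^s)`. -/
def ofTwoMul (v : S.GraphSpace (2 * s)) : S.GraphSpace s := ofMem (S.domPow_two_mul_le s v.2)

theorem toH_ofTwoMul (v : S.GraphSpace (2 * s)) : toH (ofTwoMul v) = toH v :=
  toH_ofMem _

theorem inner_op_ofTwoMul (v : S.GraphSpace (2 * s)) (w : S.GraphSpace s) :
    ⟪op (ofTwoMul v), op w⟫ = ⟪op v, toH w⟫ := by
  refine (S.hasSum_inner _ _).unique ((S.hasSum_inner (op v) (toH w)).congr_fun fun j => ?_)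
  rw [inner_vec_op, inner_vec_op, inner_vec_op, toH_ofTwoMul, rpow_two_mul]
  ring

theorem norm_ofTwoMul_le (v : S.GraphSpace (2 * s)) : ‖ofTwoMul v‖ ≤ 2 * ‖v‖ := by
  refine le_of_sq_le_sq ?_ (by positivity)
  rw [norm_sq, ← real_inner_self_eq_norm_sq (op _), inner_op_ofTwoMul, toH_ofTwoMul]
  have hinner : ⟪op v, toH v⟫ ≤ ‖v‖ * ‖v‖ := (real_inner_le_norm _ _).trans
    (mul_le_mul (norm_op_le v) (norm_toH_le v) (norm_nonneg _) (norm_nonneg _))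
  nlinarith [norm_toH_le v, norm_nonneg (toH v), norm_nonneg v]

end GraphSpace

end EigenSystem

namespace EigenSystem

variable {H : Type*} [NormedAddCommGroup H] [InnerProductSpace ℝ H] {A : H →ₗ.[ℝ] H}
  (S : EigenSystem A) {s : ℝ}

theorem lam_pos_of_ne_zero (hker : 0 < S.lam 1) {j : ℕ} (hj : j ≠ 0) : 0 < S.lam j :=
  hker.trans_le (S.mono (Nat.one_le_iff_ne_zero.2 hj))

theorem weight_sq (hs : 0 < s) (j : ℕ) :
    S.weight s j ^ 2 = (S.lam j ^ s) ^ 2 + if S.lam j = 0 then 1 else 0 := by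
  unfold weight
  split_ifs with h
  · simp [h, Real.zero_rpow hs.ne']
  · rw [add_zero]

variable [CompleteSpace H]

theorem weight_pos (s : ℝ) (j : ℕ) : 0 < S.weight s j := by
  refine lt_of_le_of_ne ?_ (S.weight_ne_zero s j).symm
  unfold weight
  split_ifs
  · exact zero_le_one
  · exact Real.rpow_nonneg (S.lam_nonneg j) s

theorem exists_le_weight (hs : 0 < s) : ∃ c : ℝ, 0 < c ∧ ∀ j, c ≤ S.weight s j := by
  obtain ⟨N, hN⟩ := ((S.tendsto_lam_rpow hs).eventually_ge_atTop 1).exists_forall_of_atTop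
  obtain ⟨i, -, hi⟩ := (Finset.range (N + 1)).exists_min_image (S.weight s) ⟨0, by simp⟩
  refine ⟨min (S.weight s i) 1, lt_min (S.weight_pos s i) one_pos, fun j => ?_⟩
  by_cases hj : j < N + 1
  · exact (min_le_left _ _).trans (hi j (Finset.mem_range.2 hj))
  · refine (min_le_right _ _).trans ?_
    unfold weight
    split_ifs
    · exact le_rfl
    · exact hN j (by omega)

namespace EnergySpace

variable {S}

/-- An element of `H` that belongs to `D(A^s)`, as an element of the energy space. -/
def ofMem {v : H} (hv : v ∈ S.domPow s) : S.EnergySpace s := ⟨v, hv⟩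

theorem toH_ofMem {v : H} (hv : v ∈ S.domPow s) : toH (ofMem hv) = v := rfl

theorem toH_injective : Function.Injective (toH : S.EnergySpace s → H) := Subtype.val_injective

theorem inner_vec_op (v : S.EnergySpace s) (j : ℕ) :
    ⟪S.vec j, op v⟫ = S.lam j ^ s * ⟪S.vec j, toH v⟫ := S.inner_vec_pow v j

instance : InnerProductSpace ℝ (S.EnergySpace s) := InnerProductSpace.induced (S.coeffMap s)

protected theorem hasSum_inner (v w : S.EnergySpace s) :
    HasSum (fun j => S.weight s j ^ 2 * (⟪S.vec j, toH v⟫ * ⟪S.vec j, toH w⟫)) ⟪v, w⟫ := by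
  refine (lp.hasSum_inner (𝕜 := ℝ) (S.coeffMap s v) (S.coeffMap s w)).congr_fun fun j => ?_
  change _ = inner ℝ (S.weight s j * ⟪S.vec j, toH v⟫) (S.weight s j * ⟪S.vec j, toH w⟫)
  simp only [RCLike.inner_apply, conj_trivial]
  ring

theorem hasSum_norm_sq (v : S.EnergySpace s) :
    HasSum (fun j => S.weight s j ^ 2 * ⟪S.vec j, toH v⟫ ^ 2) (‖v‖ ^ 2) := by
  simpa only [← sq, real_inner_self_eq_norm_sq] using EnergySpace.hasSum_inner v v

theorem norm_op_le (hs : 0 < s) (v : S.EnergySpace s) : ‖op v‖ ≤ ‖v‖ := by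
  refine le_of_sq_le_sq (hasSum_le (fun j => ?_) (S.hasSum_inner_sq (op v)) (hasSum_norm_sq v))
    (norm_nonneg v)
  rw [inner_vec_op, mul_pow, S.weight_sq hs]
  gcongr
  exact le_add_of_nonneg_right (by positivity)

theorem exists_norm_toH_le (hs : 0 < s) : ∃ C : ℝ, ∀ v : S.EnergySpace s, ‖toH v‖ ≤ C * ‖v‖ := by
  obtain ⟨c, hc, hcw⟩ := S.exists_le_weight hs
  refine ⟨c⁻¹, fun v => ?_⟩
  rw [le_inv_mul_iff₀ hc]
  refine le_of_sq_le_sq ?_ (norm_nonneg _)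
  rw [mul_pow]
  refine hasSum_le (fun j => ?_) ((S.hasSum_inner_sq (toH v)).mul_left _) (hasSum_norm_sq v)
  have := hcw j
  gcongr

theorem norm_ofMem_le (hs : 0 < s) (v : S.GraphSpace s) :
    ‖(ofMem v.2 : S.EnergySpace s)‖ ≤ ‖v‖ := by
  refine le_of_sq_le_sq ?_ (norm_nonneg v)
  rw [GraphSpace.norm_sq]
  refine hasSum_le (fun j => ?_) (hasSum_norm_sq _)
    ((S.hasSum_inner_sq (GraphSpace.toH v)).add (S.hasSum_inner_sq (GraphSpace.op v)))
  rw [S.weight_sq hs, GraphSpace.inner_vec_op, mul_pow, add_mul, add_comm]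
  refine add_le_add (mul_le_of_le_one_left (sq_nonneg _) ?_) le_rfl
  split_ifs <;> norm_num

theorem op_ofMem {z : H} {v : H} (h : ∀ j, ⟪S.vec j, z⟫ = S.lam j ^ s * ⟪S.vec j, v⟫) :
    op (ofMem (S.mem_domPow_of_inner_eq h)) = z :=
  S.eq_of_inner_vec fun j => by rw [inner_vec_op, toH_ofMem, h]

section Fact

variable [hs : Fact (0 < s)]

/-- The continuous inclusion of `D(A^s)` into `H`. -/
def toHL : S.EnergySpace s →L[ℝ] H :=
  LinearMap.mkContinuousOfExistsBound toH (exists_norm_toH_le hs.out)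

theorem exists_norm_le : ∃ C : ℝ, ∀ v : S.EnergySpace s,
    ‖(GraphSpace.ofMem v.2 : S.GraphSpace s)‖ ≤ C * ‖v‖ := by
  obtain ⟨C, hC⟩ := exists_norm_toH_le (S := S) hs.out
  refine ⟨|C| + 1, fun v => ?_⟩
  refine le_of_sq_le_sq ?_ (by positivity)
  rw [GraphSpace.norm_sq]
  have hv : ‖toH v‖ ≤ |C| * ‖v‖ := (hC v).trans (by gcongr; exact le_abs_self C)
  calc ‖toH v‖ ^ 2 + ‖op v‖ ^ 2 ≤ (|C| * ‖v‖) ^ 2 + ‖v‖ ^ 2 := by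
        gcongr
        exact norm_op_le hs.out v
    _ ≤ ((|C| + 1) * ‖v‖) ^ 2 := by nlinarith [mul_nonneg (abs_nonneg C) (sq_nonneg ‖v‖)]

/-- For `s > 0`, the energy norm on `D(A^s)` is equivalent to the graph norm. -/
def graphEquiv : S.GraphSpace s ≃L[ℝ] S.EnergySpace s :=
  LinearEquiv.toContinuousLinearEquivOfBounds (LinearEquiv.refl ℝ (S.domPow s) :
    S.GraphSpace s ≃ₗ[ℝ] S.EnergySpace s) 1 exists_norm_le.choose
    (fun v => (norm_ofMem_le hs.out v).trans_eq (one_mul _).symm) exists_norm_le.choose_spec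

instance : CompleteSpace (S.EnergySpace s) :=
  (completeSpace_congr (e := (graphEquiv (S := S) (s := s)).toEquiv)
    graphEquiv.isUniformEmbedding).1 inferInstance

instance [SecondCountableTopology H] : SecondCountableTopology (S.EnergySpace s) :=
  (graphEquiv (S := S) (s := s)).symm.toHomeomorph.secondCountableTopology

end Fact

end EnergySpace

/-- The normalised first eigenvector if it spans the kernel of `A`, and `0` if `A` is injective.
-/
def kernelVec (s : ℝ) : S.EnergySpace s :=
  if S.lam 0 = 0 then EnergySpace.ofMem (S.vec_mem_domPow s 0) else 0

theorem inner_kernelVec (v : S.EnergySpace s) :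
    ⟪S.kernelVec s, v⟫ = if S.lam 0 = 0 then ⟪S.vec 0, EnergySpace.toH v⟫ else 0 := by
  unfold kernelVec
  split_ifs with h
  · refine (EnergySpace.hasSum_inner _ v).unique
      ((hasSum_ite_eq 0 ⟪S.vec 0, EnergySpace.toH v⟫).congr_fun fun j => ?_)
    rw [EnergySpace.toH_ofMem, inner_vec_vec]
    rcases eq_or_ne j 0 with rfl | hj
    · simp [weight, h]
    · simp [hj]
  · exact inner_zero_left v

theorem norm_kernelVec_le_one : ‖S.kernelVec s‖ ≤ 1 := by
  have h : ‖S.kernelVec s‖ ^ 2 ≤ 1 := by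
    rw [← real_inner_self_eq_norm_sq, inner_kernelVec]
    split_ifs with h0
    · rw [kernelVec, if_pos h0, EnergySpace.toH_ofMem, inner_vec_vec, if_pos rfl]
    · exact zero_le_one
  exact (sq_le_one_iff₀ (norm_nonneg _)).1 h

theorem inner_kernelVec_sub (v : S.EnergySpace s) :
    ⟪S.kernelVec s, v - ⟪S.kernelVec s, v⟫ • S.kernelVec s⟫ = 0 := by
  rw [inner_sub_right, real_inner_smul_right, S.inner_kernelVec (S.kernelVec s),
    S.inner_kernelVec v]
  split_ifs with h
  · rw [kernelVec, if_pos h, EnergySpace.toH_ofMem, inner_vec_vec, if_pos rfl, mul_one, sub_self]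
  · rw [zero_mul, sub_zero]

namespace EnergySpace

variable {S}

theorem inner_op (hs : 0 < s) (hker : 0 < S.lam 1) (v w : S.EnergySpace s) :
    ⟪op v, op w⟫ = ⟪v, w⟫ - ⟪S.kernelVec s, v⟫ * ⟪S.kernelVec s, w⟫ := by
  refine (S.hasSum_inner (op v) (op w)).unique (((EnergySpace.hasSum_inner v w).sub
    (hasSum_ite_eq 0 (⟪S.kernelVec s, v⟫ * ⟪S.kernelVec s, w⟫))).congr_fun fun j => ?_)
  rw [inner_vec_op, inner_vec_op, S.weight_sq hs, inner_kernelVec, inner_kernelVec]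
  rcases eq_or_ne j 0 with rfl | hj
  · rw [if_pos rfl]
    split_ifs <;> ring
  · rw [if_neg (S.lam_pos_of_ne_zero hker hj).ne', if_neg hj]
    ring

theorem op_vec (j : ℕ) : op (ofMem (S.vec_mem_domPow s j)) = S.lam j ^ s • S.vec j := by
  refine S.eq_of_inner_vec fun i => ?_
  rw [inner_vec_op, toH_ofMem, real_inner_smul_right, inner_vec_vec]
  rcases eq_or_ne i j with rfl | hij
  · rfl
  · simp [hij]

theorem exists_energySpace_two_mul (hs : 0 < s) (hker : 0 < S.lam 1) {m : S.EnergySpace s} {z : H}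
    (h : ∀ v : S.EnergySpace s, ⟪z, toH v⟫ + ⟪op m, op v⟫ = 0) :
    ∃ n : S.EnergySpace (2 * s), toH n = toH m ∧ ‖n‖ ≤ ‖z‖ + ‖m‖ := by
  have hz : ∀ j, ⟪S.vec j, -z⟫ = S.lam j ^ (2 * s) * ⟪S.vec j, toH m⟫ := fun j => by
    have hj := h (ofMem (S.vec_mem_domPow s j))
    rw [op_vec, toH_ofMem, real_inner_smul_right, real_inner_comm, real_inner_comm (S.vec j),
      inner_vec_op] at hj
    rw [rpow_two_mul, inner_neg_right]
    linear_combination -hj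
  set n : S.EnergySpace (2 * s) := ofMem (S.mem_domPow_of_inner_eq hz) with hn
  have hkn : ⟪S.kernelVec (2 * s), n⟫ = ⟪S.kernelVec s, m⟫ := by
    rw [inner_kernelVec, inner_kernelVec, hn, toH_ofMem]
  have hnorm : ‖n‖ ^ 2 = ‖z‖ ^ 2 + ⟪S.kernelVec s, m⟫ ^ 2 := by
    have := inner_op (by positivity) hker n n
    rw [real_inner_self_eq_norm_sq, real_inner_self_eq_norm_sq, op_ofMem hz, norm_neg, hkn] at this
    linear_combination -this
  refine ⟨n, toH_ofMem _, le_of_sq_le_sq ?_ (by positivity)⟩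
  have hkm : |⟪S.kernelVec s, m⟫| ≤ ‖m‖ := (abs_real_inner_le_norm _ _).trans
    (mul_le_of_le_one_left (norm_nonneg m) S.norm_kernelVec_le_one)
  rw [hnorm, ← sq_abs ⟪S.kernelVec s, m⟫]
  nlinarith [norm_nonneg z, norm_nonneg m, abs_nonneg ⟪S.kernelVec s, m⟫]

end EnergySpace

section Dual

open EnergySpace

variable [hs : Fact (0 < s)]

/-- The Riesz isometry from the dual of `D(A^s)` to `D(A^s)` itself. -/
def riesz : S.DualSpace s →ₗᵢ[ℝ] S.EnergySpace s where
  toFun f := (InnerProductSpace.toDual ℝ (S.EnergySpace s)).symm f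
  map_add' f g := map_add _ f g
  map_smul' c f := map_smulₛₗ _ c f
  norm_map' f := LinearIsometryEquiv.norm_map _ f

theorem inner_riesz (f : S.DualSpace s) (v : S.EnergySpace s) : ⟪S.riesz f, v⟫ = f v :=
  InnerProductSpace.toDual_symm_apply

/-- The embedding of `H` into the dual of `D(A^s)`, the latter identified with `D(A^s)` through
the Riesz isometry. -/
def embed (s : ℝ) [Fact (0 < s)] : H →L[ℝ] S.EnergySpace s := ContinuousLinearMap.adjoint toHL

theorem inner_embed (w : H) (v : S.EnergySpace s) : ⟪S.embed s w, v⟫ = ⟪w, toH v⟫ :=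
  ContinuousLinearMap.adjoint_inner_left _ _ _

theorem represents_iff {f : S.DualSpace s} {w : H} :
    S.Represents f w ↔ S.riesz f = S.embed s w := by
  constructor
  · exact fun h => ext_inner_right ℝ fun v => by rw [inner_riesz, inner_embed, h]
  · exact fun h v => by rw [← S.inner_riesz, h, inner_embed]

theorem embed_injective : Function.Injective (S.embed s) := fun v w h => by
  refine S.eq_of_inner_vec fun j => ?_
  have hv := S.inner_embed v (ofMem (S.vec_mem_domPow s j))
  have hw := S.inner_embed w (ofMem (S.vec_mem_domPow s j))
  rw [toH_ofMem] at hv hw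
  rw [real_inner_comm, ← hv, h, hw, real_inner_comm]

end Dual

end EigenSystem

section Subdifferential

variable {βh : ℝ → ℝ≥0∞} {lam : ℝ}

theorem toReal_add_mul_le {s ξ z : ℝ} (hξ : ξ ∈ subdiff βh s) (hs : βh s ≠ ∞) (hz : βh z ≠ ∞) :
    (βh s).toReal + ξ * (z - s) ≤ (βh z).toReal := by
  have h := hξ z
  rw [← EReal.coe_ennreal_toReal hs, ← EReal.coe_ennreal_toReal hz] at h
  exact_mod_cast h

theorem ne_top_of_mem_subdiff {s ξ z : ℝ} (hξ : ξ ∈ subdiff βh s) (hz : βh z ≠ ∞) :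
    βh s ≠ ∞ := by
  intro hs
  have h := hξ z
  rw [hs, EReal.coe_ennreal_top, EReal.top_add_coe, ← EReal.coe_ennreal_toReal hz, top_le_iff] at h
  exact EReal.coe_ne_top _ h

theorem mem_subdiff_of_toReal_add_mul_le {s ξ : ℝ} (hs : βh s ≠ ∞)
    (h : ∀ z, βh z ≠ ∞ → (βh s).toReal + ξ * (z - s) ≤ (βh z).toReal) : ξ ∈ subdiff βh s := by
  intro z
  by_cases hz : βh z = ∞
  · rw [hz, EReal.coe_ennreal_top]
    exact le_top
  · rw [← EReal.coe_ennreal_toReal hs, ← EReal.coe_ennreal_toReal hz]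
    exact_mod_cast h z hz

theorem convexOn_toReal (hconv : ConvexOn ℝ≥0 univ βh) :
    ConvexOn ℝ {s | βh s ≠ ∞} fun s => (βh s).toReal := by
  have key : ∀ s, βh s ≠ ∞ → ∀ z, βh z ≠ ∞ → ∀ a b : ℝ, 0 ≤ a → 0 ≤ b → a + b = 1 →
      βh (a * s + b * z) ≤ ENNReal.ofReal (a * (βh s).toReal + b * (βh z).toReal) := by
    intro s hs z hz a b ha hb hab
    lift a to ℝ≥0 using ha
    lift b to ℝ≥0 using hb
    refine (hconv.2 (mem_univ s) (mem_univ z) zero_le zero_le (by exact_mod_cast hab)).trans_eq ?_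
    rw [ENNReal.ofReal_add (by positivity) (by positivity), ENNReal.ofReal_mul a.coe_nonneg,
      ENNReal.ofReal_mul b.coe_nonneg, ENNReal.ofReal_toReal hs, ENNReal.ofReal_toReal hz,
      ENNReal.ofReal_coe_nnreal, ENNReal.ofReal_coe_nnreal]
    rfl
  refine ⟨fun s hs z hz a b ha hb hab => ?_, fun s hs z hz a b ha hb hab => ?_⟩
  · exact ne_top_of_le_ne_top ENNReal.ofReal_ne_top (key s hs z hz a b ha hb hab)
  · exact ENNReal.toReal_le_of_le_ofReal (by positivity) (key s hs z hz a b ha hb hab)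

theorem exists_forall_add_sq_div_le (hlsc : LowerSemicontinuous βh) (hproper : ∃ z, βh z ≠ ∞)
    (hl : 0 < lam) (s : ℝ) : ∃ p, βh p ≠ ∞ ∧ ∀ q, βh q ≠ ∞ →
      (βh p).toReal + (p - s) ^ 2 / (2 * lam) ≤ (βh q).toReal + (q - s) ^ 2 / (2 * lam) := by
  obtain ⟨z, hz⟩ := hproper
  set f : ℝ → ℝ≥0∞ := fun p => βh p + ENNReal.ofReal ((p - s) ^ 2 / (2 * lam))
  have f_eq : ∀ q, βh q ≠ ∞ → f q = ENNReal.ofReal ((βh q).toReal + (q - s) ^ 2 / (2 * lam)) :=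
    fun q hq => by rw [ENNReal.ofReal_add (by positivity) (by positivity), ENNReal.ofReal_toReal hq]
  set R := √((z - s) ^ 2 + 2 * lam * (βh z).toReal)
  have hR : R ^ 2 / (2 * lam) = (βh z).toReal + (z - s) ^ 2 / (2 * lam) := by
    rw [Real.sq_sqrt (by positivity)]
    field_simp
    ring
  have hzR : z ∈ Metric.closedBall s R := by
    rw [mem_closedBall_iff_norm, Real.norm_eq_abs]
    exact Real.abs_le_sqrt (le_add_of_nonneg_right (by positivity))
  have hflsc : LowerSemicontinuous f := hlsc.add
    (ENNReal.continuous_ofReal.comp (by fun_prop)).lowerSemicontinuous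
  obtain ⟨p, -, hp⟩ := (hflsc.lowerSemicontinuousOn _).exists_isMinOn ⟨z, hzR⟩
    (isCompact_closedBall s R)
  have hmin : ∀ q, f p ≤ f q := fun q => by
    by_cases hq : q ∈ Metric.closedBall s R
    · exact hp hq
    · rw [mem_closedBall_iff_norm, not_le, Real.norm_eq_abs] at hq
      calc f p ≤ f z := hp hzR
        _ = ENNReal.ofReal (R ^ 2 / (2 * lam)) := by rw [f_eq z hz, hR]
        _ ≤ ENNReal.ofReal ((q - s) ^ 2 / (2 * lam)) := by
            rw [← sq_abs (q - s)]
            gcongr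
        _ ≤ f q := le_add_self
  have hpt : βh p ≠ ∞ :=
    ne_top_of_le_ne_top ENNReal.ofReal_ne_top (le_self_add.trans ((hmin z).trans_eq (f_eq z hz)))
  refine ⟨p, hpt, fun q hq => ?_⟩
  have := hmin q
  rwa [f_eq p hpt, f_eq q hq, ENNReal.ofReal_le_ofReal_iff (by positivity)] at this

/-- Euler–Lagrange inequality for the minimiser `p` of `βh + (· - s)² / (2 lam)`, tested along the
segment from `p` to `z`. -/
theorem exists_resolvent (hconv : ConvexOn ℝ≥0 univ βh) (hlsc : LowerSemicontinuous βh)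
    (hproper : ∃ z, βh z ≠ ∞) (hl : 0 < lam) (s : ℝ) : ∃ p, (s - p) / lam ∈ subdiff βh p := by
  obtain ⟨p, hp, hmin⟩ := exists_forall_add_sq_div_le hlsc hproper hl s
  refine ⟨p, mem_subdiff_of_toReal_add_mul_le hp fun z hz => ?_⟩
  set D := (βh z).toReal - (βh p).toReal - (s - p) / lam * (z - p)
  have hineq : ∀ θ ∈ Ioo (0 : ℝ) 1, 0 ≤ D + θ * ((z - p) ^ 2 / (2 * lam)) := fun θ hθ => by
    have hcomb := (convexOn_toReal hconv).1 hp hz (sub_nonneg.2 hθ.2.le) hθ.1.le (by ring)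
    have hle := (convexOn_toReal hconv).2 hp hz (sub_nonneg.2 hθ.2.le) hθ.1.le (by ring)
    simp only [smul_eq_mul] at hle hcomb
    refine nonneg_of_mul_nonneg_right (a := θ) ?_ hθ.1
    have hexp : ((1 - θ) * p + θ * z - s) ^ 2 / (2 * lam) = (p - s) ^ 2 / (2 * lam)
        + θ * (-((s - p) / lam * (z - p)) + θ * ((z - p) ^ 2 / (2 * lam))) := by
      field_simp
      ring
    linarith [hmin _ hcomb]
  have hlim : Tendsto (fun θ : ℝ => D + θ * ((z - p) ^ 2 / (2 * lam))) (𝓝[>] 0) (𝓝 D) := by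
    have : Continuous fun θ : ℝ => D + θ * ((z - p) ^ 2 / (2 * lam)) := by fun_prop
    simpa using (this.tendsto 0).mono_left nhdsWithin_le_nhds
  have : 0 ≤ D := ge_of_tendsto hlim (eventually_of_mem (Ioo_mem_nhdsGT one_pos) hineq)
  linarith

theorem sub_mul_yosida (hl : lam ≠ 0) (s : ℝ) : s - lam * yosida βh lam s = resolvent βh lam s := by
  rw [yosida, mul_div_cancel₀ _ hl, sub_sub_cancel]

theorem yosida_mem_subdiff (hconv : ConvexOn ℝ≥0 univ βh) (hlsc : LowerSemicontinuous βh)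
    (hproper : ∃ z, βh z ≠ ∞) (hl : 0 < lam) (s : ℝ) :
    yosida βh lam s ∈ subdiff βh (resolvent βh lam s) :=
  Classical.epsilon_spec (p := fun p => (s - p) / lam ∈ subdiff βh p)
    (exists_resolvent hconv hlsc hproper hl s)

section Yosida

variable (hconv : ConvexOn ℝ≥0 univ βh) (hlsc : LowerSemicontinuous βh) {s : ℝ} (hs : βh s ≠ ∞)
include hconv hlsc hs

theorem toReal_resolvent_add_le (hl : 0 < lam) :
    (βh (resolvent βh lam s)).toReal + (s - resolvent βh lam s) ^ 2 / lam ≤ (βh s).toReal := by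
  have hmem := yosida_mem_subdiff hconv hlsc ⟨s, hs⟩ hl s
  have h := toReal_add_mul_le hmem (ne_top_of_mem_subdiff hmem hs) hs
  rwa [yosida, div_mul_eq_mul_div, ← sq] at h

theorem resolvent_le (hl : 0 < lam) : βh (resolvent βh lam s) ≤ βh s := by
  have hmem := yosida_mem_subdiff hconv hlsc ⟨s, hs⟩ hl s
  have hsq : 0 ≤ (s - resolvent βh lam s) ^ 2 / lam := by positivity
  exact (ENNReal.toReal_le_toReal (ne_top_of_mem_subdiff hmem hs) hs).1
    (by linarith [toReal_resolvent_add_le hconv hlsc hs hl])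

theorem tendsto_resolvent : Tendsto (fun lam => resolvent βh lam s) (𝓝[>] 0) (𝓝 s) := by
  have hsqrt : Tendsto (fun lam => √(lam * (βh s).toReal)) (𝓝[>] 0) (𝓝 0) := by
    have : Continuous fun lam => √(lam * (βh s).toReal) := by fun_prop
    simpa using (this.tendsto 0).mono_left nhdsWithin_le_nhds
  refine tendsto_iff_dist_tendsto_zero.2 (squeeze_zero' (.of_forall fun _ => dist_nonneg) ?_ hsqrt)
  filter_upwards [self_mem_nhdsWithin] with lam (hl : 0 < lam)
  rw [dist_comm, Real.dist_eq]
  refine Real.abs_le_sqrt ?_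
  rw [← div_le_iff₀' hl]
  exact le_of_add_le_of_nonneg_right (toReal_resolvent_add_le hconv hlsc hs hl)
    ENNReal.toReal_nonneg

theorem tendsto_apply_resolvent :
    Tendsto (fun lam => βh (resolvent βh lam s)) (𝓝[>] 0) (𝓝 (βh s)) := by
  refine tendsto_of_le_liminf_of_limsup_le ?_ ?_
  · exact (lowerSemicontinuousAt_iff_le_liminf.1 (hlsc s)).trans
      (liminf_le_liminf_of_le (tendsto_resolvent hconv hlsc hs))
  · refine limsup_le_of_le (by isBoundedDefault) ?_
    filter_upwards [self_mem_nhdsWithin] with lam hl using resolvent_le hconv hlsc hs hl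

end Yosida

theorem exists_bound_subdiffDom (hproper : ∃ z, βh z ≠ ∞) {δ : ℝ} (hδ : 0 < δ) (Q : ℝ) :
    ∃ M : ℝ, 0 ≤ M ∧ ∀ a : ℝ, Icc a (a + δ) ⊆ Icc (-Q) Q → Icc a (a + δ) ⊆ subdiffDom βh →
      ∃ g ∈ Icc a (a + δ), βh g ≤ ENNReal.ofReal M := by
  obtain ⟨z, hz⟩ := hproper
  set I := Finset.Icc ⌈-Q / δ⌉ ⌊Q / δ⌋ with hI
  refine ⟨∑ k ∈ I, (βh (k * δ)).toReal, by positivity, fun a haQ ha => ?_⟩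
  have hk : (⌈a / δ⌉ : ℝ) * δ ∈ Icc a (a + δ) := by
    refine ⟨(div_le_iff₀ hδ).1 (Int.le_ceil _), ?_⟩
    rw [← sub_le_iff_le_add, ← sub_one_mul, ← le_div_iff₀ hδ, sub_le_iff_le_add]
    exact (Int.ceil_lt_add_one _).le
  refine ⟨_, hk, ?_⟩
  obtain ⟨ξ, hξ⟩ := ha hk
  rw [← ENNReal.ofReal_toReal (ne_top_of_mem_subdiff hξ hz)]
  refine ENNReal.ofReal_le_ofReal
    (Finset.single_le_sum (f := fun k : ℤ => (βh (k * δ)).toReal) (by intros; positivity) ?_)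
  rw [hI, Finset.mem_Icc, Int.ceil_le, Int.le_floor, div_le_iff₀ hδ, le_div_iff₀ hδ]
  exact haQ hk

end Subdifferential

section Energy

variable {βh : ℝ → ℝ≥0∞} {Ω : Set (EuclideanSpace ℝ (Fin 3))}

theorem inner_eq_integral (v w : L2 Ω) : ⟪v, w⟫ = ∫ x in Ω, v x * w x := by
  rw [L2.inner_def]
  refine integral_congr_ae (ae_of_all _ fun x => ?_)
  simp [mul_comm]

theorem integrable_mul (v w : L2 Ω) : Integrable (fun x => v x * w x) (volume.restrict Ω) :=
  (Lp.memLp v).integrable_mul (Lp.memLp w)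

theorem aemeasurable_comp (hβ : Measurable βh) (v : L2 Ω) :
    AEMeasurable (fun x => βh (v x)) (volume.restrict Ω) :=
  hβ.comp_aemeasurable (Lp.aestronglyMeasurable v).aemeasurable

theorem ae_ne_top_of_energy_ne_top (hβ : Measurable βh) {v : L2 Ω} (hv : energy βh v ≠ ∞) :
    ∀ᵐ x ∂(volume.restrict Ω), βh (v x) ≠ ∞ :=
  (ae_lt_top' (aemeasurable_comp hβ v) hv).mono fun _ hx => hx.ne

theorem toReal_energy_eq_integral (hβ : Measurable βh) {v : L2 Ω} (hv : energy βh v ≠ ∞) :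
    (energy βh v).toReal = ∫ x in Ω, (βh (v x)).toReal :=
  (integral_toReal (aemeasurable_comp hβ v)
    ((ae_ne_top_of_energy_ne_top hβ hv).mono fun _ hx => hx.lt_top)).symm

theorem energy_add_inner_le (hβ : Measurable βh) {p q b : L2 Ω}
    (hp : energy βh p ≠ ∞) (hq : energy βh q ≠ ∞)
    (hb : ∀ᵐ x ∂(volume.restrict Ω), b x ∈ subdiff βh (p x)) :
    (energy βh p).toReal + ⟪b, q - p⟫ ≤ (energy βh q).toReal := by
  have hip := integrable_toReal_of_lintegral_ne_top (aemeasurable_comp hβ p) hp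
  have hiq := integrable_toReal_of_lintegral_ne_top (aemeasurable_comp hβ q) hq
  rw [toReal_energy_eq_integral hβ hp, toReal_energy_eq_integral hβ hq, inner_eq_integral,
    ← integral_add hip (integrable_mul _ _)]
  refine integral_mono_ae (hip.add (integrable_mul _ _)) hiq ?_
  filter_upwards [hb, ae_ne_top_of_energy_ne_top hβ hp, ae_ne_top_of_energy_ne_top hβ hq,
    Lp.coeFn_sub q p] with x hbx hpx hqx hsub
  rw [hsub, Pi.sub_apply]
  exact toReal_add_mul_le hbx hpx hqx

section Yosida

variable (hconv : ConvexOn ℝ≥0 univ βh) (hlsc : LowerSemicontinuous βh)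
  {y₀ : L2 Ω} {b : ℝ → L2 Ω}
  (hb : ∀ᶠ lam in 𝓝[>] (0 : ℝ), b lam =ᵐ[volume.restrict Ω] fun x => yosida βh lam (y₀ x))

include hb in
theorem eventually_ae_sub_smul_eq_resolvent : ∀ᶠ lam in 𝓝[>] (0 : ℝ),
    (y₀ - lam • b lam : L2 Ω) =ᵐ[volume.restrict Ω] fun x => resolvent βh lam (y₀ x) := by
  filter_upwards [hb, self_mem_nhdsWithin] with lam hblam (hl : 0 < lam)
  filter_upwards [hblam, Lp.coeFn_sub y₀ (lam • b lam), Lp.coeFn_smul lam (b lam)] with x hx h1 h2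
  rw [h1, Pi.sub_apply, h2, Pi.smul_apply, smul_eq_mul, hx, sub_mul_yosida hl.ne']

include hconv hlsc hb in
theorem tendsto_energy_sub_smul (hy₀ : energy βh y₀ ≠ ∞) :
    Tendsto (fun lam => energy βh (y₀ - lam • b lam)) (𝓝[>] 0) (𝓝 (energy βh y₀)) := by
  have hres := eventually_ae_sub_smul_eq_resolvent hb
  have hfin := ae_ne_top_of_energy_ne_top hlsc.measurable hy₀
  have heq : ∀ᶠ lam in 𝓝[>] (0 : ℝ),
      ∫⁻ x in Ω, βh (resolvent βh lam (y₀ x)) = energy βh (y₀ - lam • b lam) :=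
    hres.mono fun lam h => lintegral_congr_ae (h.mono fun x hx => congrArg βh hx.symm)
  refine Tendsto.congr' heq
    (tendsto_lintegral_filter_of_dominated_convergence' (fun x => βh (y₀ x)) ?_ ?_ hy₀ ?_)
  · filter_upwards [hres] with lam h
    exact (aemeasurable_comp hlsc.measurable _).congr (h.mono fun x hx => congrArg βh hx)
  · filter_upwards [self_mem_nhdsWithin] with lam hl
    exact hfin.mono fun x hx => resolvent_le hconv hlsc hx hl
  · exact hfin.mono fun x hx => tendsto_apply_resolvent hconv hlsc hx

include hconv hlsc hb in
theorem eventually_energy_add_inner_le (hy₀ : energy βh y₀ ≠ ∞) {η : ℝ} (hη : 0 < η) :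
    ∀ᶠ lam in 𝓝[>] (0 : ℝ), ∀ q : L2 Ω, energy βh q ≠ ∞ →
      (energy βh y₀).toReal + ⟪b lam, q - y₀⟫ ≤ (energy βh q).toReal + η := by
  have hlim := tendsto_energy_sub_smul hconv hlsc hb hy₀
  have hfin := hlim.eventually_ne hy₀
  have hclose := ((ENNReal.tendsto_toReal hy₀).comp hlim).eventually_const_lt
    (sub_lt_self (energy βh y₀).toReal hη)
  filter_upwards [hfin, hclose, hb, eventually_ae_sub_smul_eq_resolvent hb, self_mem_nhdsWithin]
    with lam hpfin hpclose hblam hres (hl : 0 < lam) q hq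
  have hsub : ∀ᵐ x ∂(volume.restrict Ω), b lam x ∈ subdiff βh ((y₀ - lam • b lam : L2 Ω) x) := by
    filter_upwards [hblam, hres, ae_ne_top_of_energy_ne_top hlsc.measurable hy₀] with x h1 h2 h3
    rw [h1, h2]
    exact yosida_mem_subdiff hconv hlsc ⟨_, h3⟩ hl _
  have hle := energy_add_inner_le hlsc.measurable hpfin hq hsub
  rw [sub_sub_eq_add_sub, add_sub_right_comm, inner_add_right, real_inner_smul_right,
    real_inner_self_eq_norm_sq] at hle
  have : 0 ≤ lam * ‖b lam‖ ^ 2 := by positivity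
  simp only [Function.comp_apply] at hpclose
  linarith

end Yosida

theorem exists_superposition (hΩ : volume Ω ≠ ∞) {g : ℝ → ℝ} {L : ℝ≥0} (hg : LipschitzWith L g) :
    ∃ N : L2 Ω → L2 Ω, LipschitzWith L N ∧
      ∀ v : L2 Ω, N v =ᵐ[volume.restrict Ω] fun x => g (v x) := by
  have : IsFiniteMeasure (volume.restrict Ω) := isFiniteMeasure_restrict.2 hΩ
  have hg₀ : LipschitzWith L fun s => g s - g 0 :=
    LipschitzWith.of_dist_le_mul fun s t => (dist_sub_right _ _ _).trans_le (hg.dist_le_mul s t)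
  refine ⟨fun v => hg₀.compLp (sub_self _) v + (memLp_const (g 0)).toLp, ?_, fun v => ?_⟩
  · refine LipschitzWith.of_dist_le_mul fun v w => ?_
    rw [dist_add_right]
    exact (hg₀.lipschitzWith_compLp (sub_self _)).dist_le_mul v w
  · filter_upwards [Lp.coeFn_add (hg₀.compLp (sub_self _) v) (memLp_const (g 0)).toLp,
      hg₀.coeFn_compLp (sub_self _) v,
      (memLp_const (μ := volume.restrict Ω) (p := 2) (g 0)).coeFn_toLp] with x hadd hcomp hconst
    rw [hadd, Pi.add_apply, hcomp, hconst]
    exact sub_add_cancel _ _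

end Energy

section TimeBounds

variable {X : Type*} [NormedAddCommGroup X] {T R : ℝ}

theorem exists_norm_lt_of_eLpNorm_le {f : ℝ → X} (hT : 0 < T) {R' : ℝ} (hR : 0 ≤ R)
    (hRR' : R < R') (hfR : eLpNorm f 2 (timeMeasure T) ≤ ENNReal.ofReal R) :
    ∃ s ∈ Ioo 0 T, ‖f s‖ < R' / √T := by
  by_contra! hlarge
  have hR' : 0 ≤ R' := hR.trans hRR'.le
  have hsq : ENNReal.ofReal (R' ^ 2) ≤ ENNReal.ofReal (R ^ 2) := by
    calc ENNReal.ofReal (R' ^ 2)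
        = ∫⁻ s in Ioo 0 T, ENNReal.ofReal ((R' / √T) ^ 2) := by
          rw [setLIntegral_const, Real.volume_Ioo, sub_zero, ← ENNReal.ofReal_mul (by positivity),
            div_pow, Real.sq_sqrt hT.le, div_mul_cancel₀ _ hT.ne']
      _ ≤ ∫⁻ s in Ioo 0 T, ‖f s‖ₑ ^ 2 := by
          refine setLIntegral_mono' measurableSet_Ioo fun s hs => ?_
          rw [← ofReal_norm, ← ENNReal.ofReal_pow (norm_nonneg _)]
          gcongr
          exact hlarge s hs
      _ ≤ ENNReal.ofReal (R ^ 2) := by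
          rw [ENNReal.ofReal_pow hR]
          exact eLpNorm_two_le_iff_lintegral.1 hfR
  rw [ENNReal.ofReal_le_ofReal_iff (by positivity)] at hsq
  exact absurd (le_of_sq_le_sq hsq hR) hRR'.not_ge

variable [NormedSpace ℝ X]

theorem norm_integral_le_sqrt_mul {f : ℝ → X} (hf : AEStronglyMeasurable f (timeMeasure T))
    (hT : 0 ≤ T) (hR : 0 ≤ R) (hfR : eLpNorm f 2 (timeMeasure T) ≤ ENNReal.ofReal R) {s t : ℝ}
    (hs : s ∈ Icc 0 T) (ht : t ∈ Icc 0 T) : ‖∫ x in s..t, f x‖ ≤ √T * R := by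
  have hsub : uIoc s t ⊆ Ioc 0 T := fun x hx =>
    ⟨(le_min hs.1 ht.1).trans_lt hx.1, hx.2.trans (max_le hs.2 ht.2)⟩
  have hlintegral : ‖∫ x in s..t, f x‖ₑ ≤ ∫⁻ x in Ioo 0 T, ‖f x‖ₑ := by
    rw [← ofReal_norm, intervalIntegral.norm_intervalIntegral_eq, ofReal_norm,
      setLIntegral_congr Ioo_ae_eq_Ioc]
    exact (enorm_integral_le_lintegral_enorm _).trans (lintegral_mono_set hsub)
  have hsq : ‖∫ x in s..t, f x‖ₑ ^ 2 ≤ ENNReal.ofReal ((√T * R) ^ 2) := by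
    calc ‖∫ x in s..t, f x‖ₑ ^ 2 ≤ (∫⁻ x in Ioo 0 T, ‖f x‖ₑ) ^ 2 := by gcongr
      _ ≤ timeMeasure T univ * ∫⁻ x in Ioo 0 T, ‖f x‖ₑ ^ 2 := sq_lintegral_le hf.enorm
      _ ≤ ENNReal.ofReal T * ENNReal.ofReal R ^ 2 := by
          gcongr
          · rw [Measure.restrict_apply_univ, Real.volume_Ioo, sub_zero]
          · exact eLpNorm_two_le_iff_lintegral.1 hfR
      _ = ENNReal.ofReal ((√T * R) ^ 2) := by
          rw [← ENNReal.ofReal_pow hR, ← ENNReal.ofReal_mul hT, mul_pow, Real.sq_sqrt hT]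
  rw [← ofReal_norm, ← ENNReal.ofReal_pow (norm_nonneg _),
    ENNReal.ofReal_le_ofReal_iff (by positivity)] at hsq
  exact le_of_sq_le_sq hsq (by positivity)

theorem IsH1.norm_le {u du : ℝ → X} (hu : IsH1 T u du) (hT : 0 < T) (hR : 0 ≤ R)
    (hunorm : eLpNorm u 2 (timeMeasure T) ≤ ENNReal.ofReal R)
    (hdunorm : eLpNorm du 2 (timeMeasure T) ≤ ENNReal.ofReal R) {t : ℝ} (ht : t ∈ Icc 0 T) :
    ‖u t‖ ≤ (R + 1) / √T + √T * R := by
  obtain ⟨s, hs, hus⟩ := exists_norm_lt_of_eLpNorm_le hT hR (lt_add_one R) hunorm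
  have hs' := Ioo_subset_Icc_self hs
  calc ‖u t‖ ≤ ‖u s‖ + ‖u t - u s‖ := norm_le_norm_add_norm_sub' _ _
    _ ≤ (R + 1) / √T + √T * R := by
        rw [(hu.isPrimitive hT.le).sub_eq_integral hs' ht]
        exact add_le_add hus.le
          (norm_integral_le_sqrt_mul hu.memLp_deriv.1 hT.le hR hdunorm hs' ht)

end TimeBounds

section PhaseSpace

variable {E H : Type*} [NormedAddCommGroup E] [NormedAddCommGroup H] [InnerProductSpace ℝ H]

/-- The velocity `(ψ, τ^(-1/2) w)` in the phase space, where `w` stands for `τ ψ`. For `τ = 0`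
the second component vanishes because `0⁻¹ = 0`. -/
def phaseVelocity (τ : ℝ) (ψ : E) (w : H) : WithLp 2 (E × H) := WithLp.toLp 2 (ψ, (√τ)⁻¹ • w)

theorem memLp_phaseVelocity {α : Type*} [MeasurableSpace α] {m : Measure α} {p : ℝ≥0∞}
    {ψ : α → E} {w : α → H} (hψ : MemLp ψ p m) (hw : MemLp w p m) (τ : ℝ) :
    MemLp (fun t => phaseVelocity τ (ψ t) (w t)) p m :=
  memLp_prodLp_iff.2 ⟨hψ, hw.const_smul _⟩

variable [InnerProductSpace ℝ E]

/-- The embedding `v ↦ (i v, √τ v)` of `H` into the phase space `E × H`. Its squared norm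
`‖i v‖² + τ ‖v‖²` treats the viscous and the nonviscous problem at the same time. -/
def phaseMap (i : H →L[ℝ] E) (τ : ℝ) : H →L[ℝ] WithLp 2 (E × H) :=
  ((WithLp.prodContinuousLinearEquiv 2 ℝ E H).symm : (E × H) →L[ℝ] WithLp 2 (E × H)).comp
    (i.prod (√τ • ContinuousLinearMap.id ℝ H))

theorem phaseMap_apply (i : H →L[ℝ] E) (τ : ℝ) (v : H) :
    phaseMap i τ v = WithLp.toLp 2 (i v, √τ • v) := rfl

theorem phaseMap_injective {i : H →L[ℝ] E} (hi : Function.Injective i) (τ : ℝ) :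
    Function.Injective (phaseMap i τ) := fun _ _ h =>
  hi (congrArg (fun p : WithLp 2 (E × H) => p.fst) h)

theorem inner_phaseVelocity_phaseMap (i : H →L[ℝ] E) {τ : ℝ} (hτ : 0 ≤ τ) (ψ : E) {w : H}
    (hw : τ = 0 → w = 0) (v : H) :
    ⟪phaseVelocity τ ψ w, phaseMap i τ v⟫ = ⟪ψ, i v⟫ + ⟪w, v⟫ := by
  rw [phaseMap_apply, phaseVelocity, WithLp.prod_inner_apply]
  change ⟪ψ, i v⟫ + ⟪(√τ)⁻¹ • w, √τ • v⟫ = _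
  rw [real_inner_smul_left, real_inner_smul_right, ← mul_assoc]
  obtain rfl | hpos := hτ.eq_or_lt
  · rw [hw rfl, inner_zero_left, mul_zero]
  · rw [inv_mul_cancel₀ (Real.sqrt_pos.2 hpos).ne', one_mul]

theorem phaseMap_eq_integral [CompleteSpace E] [CompleteSpace H] {i : H →L[ℝ] E}
    (hi : Function.Injective i) {T τ : ℝ} {ψ : ℝ → E} {w : ℝ → H}
    (hψ : MemLp ψ 2 (timeMeasure T)) (hw : MemLp w 2 (timeMeasure T))
    (hiw : ∀ᵐ t ∂timeMeasure T, i (w t) = τ • ψ t) {t : ℝ} (ht : t ∈ Icc 0 T) {d : H}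
    (hd : i d = ∫ s in (0 : ℝ)..t, ψ s) :
    phaseMap i τ d = ∫ s in (0 : ℝ)..t, phaseVelocity τ (ψ s) (w s) := by
  have hT : 0 ≤ T := ht.1.trans ht.2
  have hzero : (0 : ℝ) ∈ Icc 0 T := ⟨le_rfl, hT⟩
  have hvelocity : IntervalIntegrable (fun s => phaseVelocity τ (ψ s) (w s)) volume 0 t :=
    (IsPrimitive.of_memLp hT one_le_two
      (memLp_phaseVelocity hψ hw τ)).intervalIntegrable_of_mem hzero ht
  have hsecond : IntervalIntegrable (fun s => (√τ)⁻¹ • w s) volume 0 t :=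
    (IsPrimitive.of_memLp hT one_le_two
      (hw.const_smul (√τ)⁻¹)).intervalIntegrable_of_mem hzero ht
  refine (WithLp.equiv 2 (E × H)).injective (Prod.ext ?_ ?_)
  · exact hd.trans ((WithLp.fstL 2 ℝ E H).intervalIntegral_comp_comm hvelocity)
  · refine Eq.trans ?_ ((WithLp.sndL 2 ℝ E H).intervalIntegral_comp_comm hvelocity)
    apply hi
    change i (√τ • d) = i (∫ s in (0 : ℝ)..t, (√τ)⁻¹ • w s)
    rw [← i.intervalIntegral_comp_comm hsecond, map_smul, hd, ← intervalIntegral.integral_smul,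
      intervalIntegral.integral_of_le ht.1, intervalIntegral.integral_of_le ht.1,
      integral_Ioc_eq_integral_Ioo, integral_Ioc_eq_integral_Ioo]
    refine integral_congr_ae ?_
    filter_upwards [ae_mono (timeMeasure_mono ht.2) hiw] with s hs
    rw [map_smul, hs, smul_smul, ← div_eq_inv_mul, Real.div_sqrt]

end PhaseSpace

section Estimates

open EigenSystem

section InnerBounds

variable {F : Type*} [NormedAddCommGroup F] [InnerProductSpace ℝ F]

theorem neg_mul_le_inner {v w : F} {a b : ℝ} (hv : ‖v‖ ≤ a) (hw : ‖w‖ ≤ b) :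
    -(a * b) ≤ ⟪v, w⟫ :=
  neg_le_of_abs_le ((abs_real_inner_le_norm v w).trans
    (mul_le_mul hv hw (norm_nonneg w) ((norm_nonneg v).trans hv)))

theorem neg_mul_norm_sq_le_inner {N : F → F} {L : ℝ≥0} (hN : LipschitzWith L N) (v w : F) :
    -(L * ‖v - w‖ ^ 2) ≤ ⟪N v - N w, v - w⟫ := by
  rw [sq, ← mul_assoc]
  exact neg_mul_le_inner (hN.norm_sub_le v w) le_rfl

end InnerBounds

variable {H : Type*} [NormedAddCommGroup H] [InnerProductSpace ℝ H] [CompleteSpace H]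
  {A B : H →ₗ.[ℝ] H}

/-- The system at a fixed time, for a potential energy `Φ` and a perturbation `N` on the Hilbert
space `H`: here `ψ` is the Riesz representative of `∂ₜy` in `D(A^r)`, and `w` is `τ ∂ₜy`. The first
equation reads `ψ = -μ` up to the component along the kernel of `A`, and the conservation of
mass says that `y - y₀` has no such component. -/
structure SystemAt (SA : EigenSystem A) (SB : EigenSystem B) (r σ τ : ℝ) [Fact (0 < r)]
    (Φ : H → ℝ≥0∞) (N : H → H) (y₀ : SB.GraphSpace σ) (u : H) (y : SB.GraphSpace σ)
    (ψ : SA.EnergySpace r) (w : H) (μ : SA.EnergySpace r) : Prop where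
  energy_ne_top : Φ (GraphSpace.toH y) ≠ ∞
  riesz_eq : ψ = -(μ - ⟪SA.kernelVec r, μ⟫ • SA.kernelVec r)
  inner_kernel : ⟪SA.kernelVec r, SA.embed r (GraphSpace.toH (y - y₀))⟫ = 0
  eq_zero_of_nonviscous : τ = 0 → w = 0
  inequality : ∀ v : SB.GraphSpace σ, Φ (GraphSpace.toH v) ≠ ∞ →
    ⟪w, GraphSpace.toH (y - v)⟫ + ⟪GraphSpace.op y, GraphSpace.op (y - v)⟫
      + ⟪N (GraphSpace.toH y) - u, GraphSpace.toH (y - v)⟫ + (Φ (GraphSpace.toH y)).toReal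
    ≤ ⟪EnergySpace.toH μ, GraphSpace.toH (y - v)⟫ + (Φ (GraphSpace.toH v)).toReal

variable {SA : EigenSystem A} {SB : EigenSystem B} {r σ τ : ℝ} [Fact (0 < r)]

/-- With the constant `C`, the graph norm of `D(B^σ)` absorbs the terms in the norm of `H` produced
by an `L`-Lipschitz perturbation and by the source, up to the weaker norm of the phase space. -/
structure IsAbsorptionConstant (SA : EigenSystem A) (SB : EigenSystem B) (r σ τ : ℝ)
    [Fact (0 < r)] (L : ℝ≥0) (C : ℝ) : Prop where
  half_le : 1 / 2 ≤ C
  norm_sq_le (v : SB.GraphSpace σ) : (2 * L + 3) * ‖GraphSpace.toH v‖ ^ 2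
    ≤ ‖v‖ ^ 2 + 2 * C * ‖phaseMap (SA.embed r) τ (GraphSpace.toH v)‖ ^ 2

theorem exists_isAbsorptionConstant (hσ : 0 < σ) (τ : ℝ) (L : ℝ≥0) :
    ∃ C, IsAbsorptionConstant SA SB r σ τ L C := by
  have hL : (0 : ℝ) < 2 * L + 3 := by positivity
  obtain ⟨C, hC, hbound⟩ := exists_norm_sq_le_of_isCompactOperator
    (GraphSpace.isCompactOperator_toHL (S := SB) hσ)
    (phaseMap_injective (SA.embed_injective (s := r)) τ) (inv_pos.2 hL)
  refine ⟨1 / 2 + (2 * L + 3) * C / 2, le_add_of_nonneg_right (by positivity), fun v => ?_⟩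
  set J := ‖phaseMap (SA.embed r) τ (GraphSpace.toH v)‖
  calc (2 * L + 3) * ‖GraphSpace.toH v‖ ^ 2
      ≤ (2 * L + 3) * ((2 * L + 3 : ℝ)⁻¹ * ‖v‖ ^ 2 + C * J ^ 2) := by
        gcongr
        exact hbound v
    _ = ‖v‖ ^ 2 + (2 * L + 3) * C * J ^ 2 := by
        rw [mul_add, mul_inv_cancel_left₀ hL.ne', mul_assoc]
    _ ≤ ‖v‖ ^ 2 + 2 * (1 / 2 + (2 * L + 3) * C / 2) * J ^ 2 := by nlinarith [sq_nonneg J]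

namespace SystemAt

variable {Φ : H → ℝ≥0∞} {N : H → H} {L : ℝ≥0} {y₀ : SB.GraphSpace σ} {u u' : H}
  {y y' : SB.GraphSpace σ} {ψ ψ' : SA.EnergySpace r} {w w' : H} {μ μ' : SA.EnergySpace r}

theorem inner_mu (h : SystemAt SA SB r σ τ Φ N y₀ u y ψ w μ) (d : H) :
    ⟪EnergySpace.toH μ, d⟫ = -⟪ψ, SA.embed r d⟫
      + ⟪SA.kernelVec r, μ⟫ * ⟪SA.kernelVec r, SA.embed r d⟫ := by
  rw [h.riesz_eq, inner_neg_left, inner_sub_left, real_inner_smul_left,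
    real_inner_comm (SA.embed r d) μ, SA.inner_embed, real_inner_comm]
  ring

theorem inner_kernel_sub (h : SystemAt SA SB r σ τ Φ N y₀ u y ψ w μ) (v : SB.GraphSpace σ) :
    ⟪SA.kernelVec r, SA.embed r (GraphSpace.toH (y - v))⟫
      = ⟪SA.kernelVec r, SA.embed r (GraphSpace.toH (y₀ - v))⟫ := by
  rw [← sub_add_sub_cancel y y₀ v, map_add, map_add, inner_add_right, h.inner_kernel, zero_add]

theorem test_le (hτ : 0 ≤ τ) (h : SystemAt SA SB r σ τ Φ N y₀ u y ψ w μ) {v : SB.GraphSpace σ}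
    (hv : Φ (GraphSpace.toH v) ≠ ∞) :
    ⟪phaseVelocity τ ψ w, phaseMap (SA.embed r) τ (GraphSpace.toH (y - v))⟫
      + ⟪GraphSpace.op y, GraphSpace.op (y - v)⟫
      + ⟪N (GraphSpace.toH y) - u, GraphSpace.toH (y - v)⟫ + (Φ (GraphSpace.toH y)).toReal
    ≤ ⟪SA.kernelVec r, μ⟫
        * ⟪SA.kernelVec r, SA.embed r (GraphSpace.toH (y₀ - v))⟫
      + (Φ (GraphSpace.toH v)).toReal := by
  have hineq := h.inequality v hv
  rw [h.inner_mu, h.inner_kernel_sub] at hineq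
  rw [inner_phaseVelocity_phaseMap _ hτ ψ h.eq_zero_of_nonviscous]
  linarith

theorem increment_le (hτ : 0 ≤ τ) (hN : LipschitzWith L N) {C : ℝ}
    (hC : IsAbsorptionConstant SA SB r σ τ L C)
    (h : SystemAt SA SB r σ τ Φ N y₀ u y ψ w μ)
    (h' : SystemAt SA SB r σ τ Φ N y₀ u' y' ψ' w' μ') :
    ⟪phaseVelocity τ ψ w - phaseVelocity τ ψ' w',
        phaseMap (SA.embed r) τ (GraphSpace.toH (y - y'))⟫ + 1 / 2 * ‖y - y'‖ ^ 2
      ≤ C * (‖phaseMap (SA.embed r) τ (GraphSpace.toH (y - y'))‖ ^ 2 + ‖u - u'‖ ^ 2) := by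
  have htest := h.test_le hτ h'.energy_ne_top
  have htest' := h'.test_le hτ h.energy_ne_top
  rw [← h'.inner_kernel_sub, sub_self, map_zero, map_zero, inner_zero_right, mul_zero,
    zero_add] at htest
  rw [← h.inner_kernel_sub, sub_self, map_zero, map_zero, inner_zero_right, mul_zero, zero_add,
    ← neg_sub y y'] at htest'
  simp only [map_neg, inner_neg_right] at htest'
  set d := y - y' with hd
  have hop : ⟪GraphSpace.op y, GraphSpace.op d⟫ - ⟪GraphSpace.op y', GraphSpace.op d⟫
      = ‖GraphSpace.op d‖ ^ 2 := by
    rw [← inner_sub_left, ← map_sub, ← hd, real_inner_self_eq_norm_sq]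
  have hlipschitz := neg_mul_norm_sq_le_inner hN (GraphSpace.toH y) (GraphSpace.toH y')
  have hsource := real_inner_le_norm (u - u') (GraphSpace.toH d)
  rw [← map_sub, ← hd, inner_sub_left] at hlipschitz
  rw [inner_sub_left] at htest htest' hsource
  rw [inner_sub_left]
  nlinarith [hC.half_le, hC.norm_sq_le d, GraphSpace.norm_sq d,
    sq_nonneg (‖u - u'‖ - ‖GraphSpace.toH d‖), sq_nonneg ‖u - u'‖]

theorem initial_le {x₀ : SB.GraphSpace (2 * σ)} (hτ : 0 ≤ τ) (hN : LipschitzWith L N) {C : ℝ}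
    (hC : IsAbsorptionConstant SA SB r σ τ L C)
    (hx₀ : Φ (GraphSpace.toH x₀) ≠ ∞)
    (h : SystemAt SA SB r σ τ Φ N (GraphSpace.ofTwoMul x₀) u y ψ w μ) {b : H} {M η : ℝ}
    (hb : (Φ (GraphSpace.toH x₀)).toReal + ⟪b, GraphSpace.toH y - GraphSpace.toH x₀⟫
      ≤ (Φ (GraphSpace.toH y)).toReal + η)
    (hM : -⟪GraphSpace.op x₀ + b + N (GraphSpace.toH x₀) - u,
        GraphSpace.toH (y - GraphSpace.ofTwoMul x₀)⟫
      ≤ M * ‖phaseMap (SA.embed r) τ (GraphSpace.toH (y - GraphSpace.ofTwoMul x₀))‖) :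
    ⟪phaseVelocity τ ψ w,
        phaseMap (SA.embed r) τ (GraphSpace.toH (y - GraphSpace.ofTwoMul x₀))⟫
      ≤ C * ‖phaseMap (SA.embed r) τ (GraphSpace.toH (y - GraphSpace.ofTwoMul x₀))‖ ^ 2
        + M * ‖phaseMap (SA.embed r) τ (GraphSpace.toH (y - GraphSpace.ofTwoMul x₀))‖ + η := by
  have htest := h.test_le hτ (v := GraphSpace.ofTwoMul x₀) (by rwa [GraphSpace.toH_ofTwoMul])
  rw [sub_self, map_zero, map_zero, inner_zero_right, mul_zero, zero_add,
    GraphSpace.toH_ofTwoMul] at htest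
  have hsub : GraphSpace.toH y - GraphSpace.toH x₀
      = GraphSpace.toH (y - GraphSpace.ofTwoMul x₀) := by
    rw [map_sub, GraphSpace.toH_ofTwoMul]
  have hlipschitz := neg_mul_norm_sq_le_inner hN (GraphSpace.toH y) (GraphSpace.toH x₀)
  rw [hsub, inner_sub_left] at hlipschitz
  rw [hsub] at hb
  have hop : ⟪GraphSpace.op y, GraphSpace.op (y - GraphSpace.ofTwoMul x₀)⟫
      = ‖GraphSpace.op (y - GraphSpace.ofTwoMul x₀)‖ ^ 2
        + ⟪GraphSpace.op x₀, GraphSpace.toH (y - GraphSpace.ofTwoMul x₀)⟫ := by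
    rw [← GraphSpace.inner_op_ofTwoMul, ← real_inner_self_eq_norm_sq, ← inner_add_left, ← map_add,
      sub_add_cancel]
  rw [inner_sub_left, inner_add_left, inner_add_left] at hM
  rw [inner_sub_left] at htest
  have habsorb := hC.norm_sq_le (y - GraphSpace.ofTwoMul x₀)
  have hnorm := GraphSpace.norm_sq (y - GraphSpace.ofTwoMul x₀)
  linarith [sq_nonneg ‖y - GraphSpace.ofTwoMul x₀‖,
    sq_nonneg ‖GraphSpace.toH (y - GraphSpace.ofTwoMul x₀)‖]

theorem kernel_component_le (hτ : 0 ≤ τ) (h : SystemAt SA SB r σ τ Φ N y₀ u y ψ w μ)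
    {v : SB.GraphSpace σ} {K Kv Ky Kf Ke : ℝ} (hKe : 0 ≤ Ke)
    (hv : Φ (GraphSpace.toH v) ≤ ENNReal.ofReal Ke) (hvnorm : ‖v‖ ≤ Kv) (hy : ‖y‖ ≤ Ky)
    (hf : ‖N (GraphSpace.toH y) - u‖ ≤ Kf) (hK : ‖phaseVelocity τ ψ w‖ ≤ K) :
    ⟪SA.kernelVec r, μ⟫
        * ⟪SA.kernelVec r, SA.embed r (GraphSpace.toH (v - y₀))⟫
      ≤ Ke + (K * ‖phaseMap (SA.embed r) τ‖ + Ky + Kf) * (Ky + Kv) := by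
  have htest := h.test_le hτ (hv.trans_lt ENNReal.ofReal_lt_top).ne
  rw [← neg_sub v y₀, map_neg, map_neg, inner_neg_right, mul_neg] at htest
  have hvenergy := ENNReal.toReal_le_of_le_ofReal hKe hv
  have hd : ‖y - v‖ ≤ Ky + Kv := (norm_sub_le _ _).trans (add_le_add hy hvnorm)
  have hD : ‖GraphSpace.toH (y - v)‖ ≤ Ky + Kv := (GraphSpace.norm_toH_le _).trans hd
  have hphase := neg_mul_le_inner hK
    (((phaseMap (SA.embed r) τ).le_opNorm _).trans
      (mul_le_mul_of_nonneg_left hD (norm_nonneg _)))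
  have hop := neg_mul_le_inner ((GraphSpace.norm_op_le y).trans hy)
    ((GraphSpace.norm_op_le _).trans hd)
  have hforce := neg_mul_le_inner hf hD
  have hyenergy : 0 ≤ (Φ (GraphSpace.toH y)).toReal := ENNReal.toReal_nonneg
  linarith

end SystemAt

end Estimates

section Solutions

open EigenSystem

theorem ne_top_and_add_toReal_le {a b : ℝ} {p q : ℝ≥0∞}
    (h : (a : EReal) + (p : EReal) ≤ (b : EReal) + (q : EReal)) (hq : q ≠ ∞) :
    p ≠ ∞ ∧ a + p.toReal ≤ b + q.toReal := by
  rw [← EReal.coe_ennreal_toReal hq] at h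
  have hp : p ≠ ∞ := by
    rintro rfl
    rw [EReal.coe_ennreal_top, EReal.coe_add_top, top_le_iff] at h
    exact EReal.coe_ne_top (b + q.toReal) (by exact_mod_cast h)
  rw [← EReal.coe_ennreal_toReal hp] at h
  exact ⟨hp, by exact_mod_cast h⟩

variable {Ω : Set (EuclideanSpace ℝ (Fin 3))} {A B : L2 Ω →ₗ.[ℝ] L2 Ω}
  {SA : EigenSystem A} {SB : EigenSystem B} {r σ τ T : ℝ} [Fact (0 < r)]
  {βh : ℝ → ℝ≥0∞} {πh : ℝ → ℝ} {N : L2 Ω → L2 Ω} {u : ℝ → L2 Ω} {y₀ : SB.GraphSpace σ}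
  {y : ℝ → SB.GraphSpace σ} {dy : ℝ → SA.DualSpace r} {μ : ℝ → SA.EnergySpace r}

namespace IsSolution

theorem ae_riesz_eq (hker : 0 < SA.lam 1) {x₀ : L2 Ω}
    (hsol : IsSolution SA SB r σ τ T βh πh u x₀ y dy μ) :
    ∀ᵐ t ∂(timeMeasure T),
      SA.riesz (dy t) = -(μ t - ⟪SA.kernelVec r, μ t⟫ • SA.kernelVec r) := by
  filter_upwards [hsol.first] with t ht
  refine ext_inner_right ℝ fun v => ?_
  have hv := ht v
  rw [EnergySpace.inner_op Fact.out hker] at hv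
  rw [SA.inner_riesz, inner_neg_left, inner_sub_left, real_inner_smul_left]
  linarith

theorem memLp_riesz {x₀ : L2 Ω} (hsol : IsSolution SA SB r σ τ T βh πh u x₀ y dy μ) :
    MemLp (fun t => SA.riesz (dy t)) 2 (timeMeasure T) :=
  SA.riesz.toContinuousLinearMap.comp_memLp' hsol.dy_memLp

theorem ae_embed_sub_eq_integral (hT : 0 ≤ T)
    (hsol : IsSolution SA SB r σ τ T βh πh u (GraphSpace.toH y₀) y dy μ) :
    ∀ᵐ t ∂(timeMeasure T),
      SA.embed r (GraphSpace.toH (y t - y₀)) = ∫ s in (0 : ℝ)..t, SA.riesz (dy s) := by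
  obtain ⟨Y, hY0, hY, hYt⟩ := hsol.y_eq_integral
  filter_upwards [hYt, ae_restrict_mem measurableSet_Ioo] with t ht htT
  have ht' := Ioo_subset_Icc_self htT
  have hint : IntervalIntegrable dy volume 0 t :=
    (IsPrimitive.of_memLp hT one_le_two hsol.dy_memLp).intervalIntegrable_of_mem ⟨le_rfl, hT⟩ ht'
  rw [map_sub, map_sub, ← SA.represents_iff.1 ht, ← SA.represents_iff.1 hY0, hY t ht', map_add,
    add_sub_cancel_left]
  exact (SA.riesz.toContinuousLinearMap.intervalIntegral_comp_comm hint).symm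

theorem inner_kernelVec_integral_eq_zero (hker : 0 < SA.lam 1) (hT : 0 ≤ T) {x₀ : L2 Ω}
    (hsol : IsSolution SA SB r σ τ T βh πh u x₀ y dy μ) {t : ℝ} (ht : t ∈ Icc 0 T) :
    ⟪SA.kernelVec r, ∫ s in (0 : ℝ)..t, SA.riesz (dy s)⟫ = 0 := by
  have hint : IntervalIntegrable (fun s => SA.riesz (dy s)) volume 0 t :=
    (IsPrimitive.of_memLp hT one_le_two hsol.memLp_riesz).intervalIntegrable_of_mem
      ⟨le_rfl, hT⟩ ht
  have hzero : ∀ᵐ s ∂(timeMeasure t), ⟪SA.kernelVec r, SA.riesz (dy s)⟫ = 0 := by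
    filter_upwards [ae_mono (timeMeasure_mono ht.2) (hsol.ae_riesz_eq hker)] with s hs
    rw [hs, inner_neg_right, SA.inner_kernelVec_sub, neg_zero]
  rw [← innerSL_apply_apply ℝ, ← (innerSL ℝ _).intervalIntegral_comp_comm hint,
    ← integral_timeMeasure ht.1]
  exact integral_eq_zero_of_ae hzero

theorem exists_ae_systemAt (hker : 0 < SA.lam 1) (hT : 0 ≤ T)
    (hN : ∀ v : L2 Ω, N v =ᵐ[volume.restrict Ω] fun x => deriv πh (v x))
    (hy₀ : energy βh (GraphSpace.toH y₀) ≠ ∞)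
    (hsol : IsSolution SA SB r σ τ T βh πh u (GraphSpace.toH y₀) y dy μ) :
    ∃ w : ℝ → L2 Ω, MemLp w 2 (timeMeasure T) ∧
      (∀ᵐ t ∂(timeMeasure T), SA.embed r (w t) = τ • SA.riesz (dy t)) ∧
      ∀ᵐ t ∂(timeMeasure T), SystemAt SA SB r σ τ (energy βh) N y₀ (u t) (y t)
        (SA.riesz (dy t)) (w t) (μ t) := by
  obtain ⟨w, hw, hwdy, hineq⟩ := hsol.second
  have hembed : ∀ᵐ t ∂(timeMeasure T), SA.embed r (w t) = τ • SA.riesz (dy t) :=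
    hwdy.mono fun t ht => by rw [← SA.represents_iff.1 ht, map_smul]
  refine ⟨w, hw, hembed, ?_⟩
  filter_upwards [hembed, hsol.ae_riesz_eq hker, hsol.ae_embed_sub_eq_integral hT, hineq,
    ae_restrict_mem measurableSet_Ioo] with t hwt hψ hy hvar ht
  refine
    { energy_ne_top := (ne_top_and_add_toReal_le (hvar y₀) hy₀).1
      riesz_eq := hψ
      inner_kernel := ?_
      eq_zero_of_nonviscous := fun hτ => SA.embed_injective (s := r) ?_
      inequality := fun v hv => ?_ }
  · rw [hy, hsol.inner_kernelVec_integral_eq_zero hker hT (Ioo_subset_Icc_self ht)]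
  · rw [hwt, hτ, zero_smul, map_zero]
  · have hforce : ⟪N (GraphSpace.toH (y t)) - u t, GraphSpace.toH (y t - v)⟫ =
        ∫ x in Ω, (deriv πh (GraphSpace.toH (y t) x) - u t x) * GraphSpace.toH (y t - v) x := by
      rw [inner_eq_integral]
      refine integral_congr_ae ?_
      filter_upwards [hN (GraphSpace.toH (y t)), Lp.coeFn_sub (N (GraphSpace.toH (y t))) (u t)]
        with x hNx hsub
      rw [hsub, Pi.sub_apply, hNx]
    rw [hforce]
    exact (ne_top_and_add_toReal_le (hvar v) hv).2

end IsSolution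

end Solutions

section MeanValue

open EigenSystem

variable {Ω : Set (EuclideanSpace ℝ (Fin 3))} {c : ℝ}

theorem ne_zero_and_average_eq_of_constant (hΩ : volume Ω ≠ ∞) {e : L2 Ω}
    (he : e =ᵐ[volume.restrict Ω] fun _ => c) (hnorm : ‖e‖ = 1) :
    c ≠ 0 ∧ ∀ v : L2 Ω, ⨍ x in Ω, v x = c * ⟪e, v⟫ := by
  have : IsFiniteMeasure (volume.restrict Ω) := isFiniteMeasure_restrict.2 hΩ
  have hinner : ∀ v : L2 Ω, ⟪e, v⟫ = c * ∫ x in Ω, v x := fun v => by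
    rw [inner_eq_integral, ← integral_const_mul]
    exact integral_congr_ae (he.mono fun x hx => by simp only [hx])
  have hcc : c * (c * volume.real Ω) = 1 := by
    have hee := hinner e
    rw [real_inner_self_eq_norm_sq, hnorm, integral_congr_ae he, integral_const, smul_eq_mul,
      measureReal_restrict_apply_univ] at hee
    linarith
  refine ⟨left_ne_zero_of_mul_eq_one hcc, fun v => ?_⟩
  have hvol : (volume.real Ω)⁻¹ = c * c := inv_eq_of_mul_eq_one_right (by linarith)
  rw [setAverage_eq, smul_eq_mul, hvol, hinner, mul_assoc]

variable {A B : L2 Ω →ₗ.[ℝ] L2 Ω} {SA : EigenSystem A} {SB : EigenSystem B} {r σ τ : ℝ}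
  [Fact (0 < r)] {βh : ℝ → ℝ≥0∞} {N : L2 Ω → L2 Ω} {y₀ y : SB.GraphSpace σ} {u w : L2 Ω}
  {ψ μ : SA.EnergySpace r} {K Ky Kf : ℝ}

theorem SystemAt.inner_kernelVec_div_mul_le (hΩ : volume Ω ≠ ∞) (hτ : 0 ≤ τ)
    (h : SystemAt SA SB r σ τ (energy βh) N y₀ u y ψ w μ) (hlam : SA.lam 0 = 0)
    (hc : SA.vec 0 =ᵐ[volume.restrict Ω] fun _ => c) {e : SB.GraphSpace σ}
    (he : GraphSpace.toH e = SA.vec 0) {g M Q : ℝ} (hM : 0 ≤ M) (hg : βh g ≤ ENNReal.ofReal M)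
    (hgQ : |g| ≤ Q) (hy : ‖y‖ ≤ Ky) (hf : ‖N (GraphSpace.toH y) - u‖ ≤ Kf)
    (hK : ‖phaseVelocity τ ψ w‖ ≤ K) :
    ⟪SA.kernelVec r, μ⟫ / c * (g - ⨍ x in Ω, GraphSpace.toH y₀ x)
      ≤ M * volume.real Ω
        + (K * ‖phaseMap (SA.embed r) τ‖ + Ky + Kf) * (Ky + Q / |c| * ‖e‖) := by
  obtain ⟨hc0, haverage⟩ := ne_zero_and_average_eq_of_constant hΩ hc (SA.orthonormal.1 0)
  set v : SB.GraphSpace σ := (g / c) • e with hv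
  have hvH : GraphSpace.toH v = (g / c) • SA.vec 0 := by rw [hv, map_smul, he]
  have hvg : (GraphSpace.toH v : L2 Ω) =ᵐ[volume.restrict Ω] fun _ => g := by
    rw [hvH]
    filter_upwards [hc, Lp.coeFn_smul (g / c) (SA.vec 0)] with x hx hsmul
    rw [hsmul, Pi.smul_apply, hx, smul_eq_mul, div_mul_cancel₀ _ hc0]
  have henergy : energy βh (GraphSpace.toH v) ≤ ENNReal.ofReal (M * volume.real Ω) := by
    calc energy βh (GraphSpace.toH v) = βh g * volume Ω := by
          rw [← setLIntegral_const]
          exact lintegral_congr_ae (hvg.mono fun x hx => congrArg βh hx)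
      _ ≤ ENNReal.ofReal (M * volume.real Ω) := by
          rw [ENNReal.ofReal_mul hM, measureReal_def, ENNReal.ofReal_toReal hΩ]
          gcongr
  have hnorm : ‖v‖ ≤ Q / |c| * ‖e‖ := by
    rw [hv, norm_smul, Real.norm_eq_abs, abs_div]
    gcongr
  have hkernel : ⟪SA.kernelVec r, SA.embed r (GraphSpace.toH (v - y₀))⟫
      = (g - ⨍ x in Ω, GraphSpace.toH y₀ x) / c := by
    rw [real_inner_comm, SA.inner_embed, real_inner_comm, kernelVec, if_pos hlam,
      EnergySpace.toH_ofMem, map_sub, inner_sub_right, hvH, real_inner_smul_right, inner_vec_vec,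
      if_pos rfl, mul_one, haverage, sub_div, mul_div_cancel_left₀ _ hc0]
  calc ⟪SA.kernelVec r, μ⟫ / c * (g - ⨍ x in Ω, GraphSpace.toH y₀ x)
      = ⟪SA.kernelVec r, μ⟫ * ⟪SA.kernelVec r, SA.embed r (GraphSpace.toH (v - y₀))⟫ := by
        rw [hkernel]
        ring
    _ ≤ _ := h.kernel_component_le hτ (by positivity) henergy hnorm hy hf hK

theorem abs_mul_le_of_two_sided {a m δ Q : ℝ} {g₁ g₂ : ℝ} (hg₁ : m + δ ≤ g₁) (hg₂ : g₂ ≤ m - δ)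
    (h₁ : a * (g₁ - m) ≤ Q) (h₂ : a * (g₂ - m) ≤ Q) : |a| * δ ≤ Q := by
  rcases abs_cases a with ⟨ha, ha'⟩ | ⟨ha, ha'⟩ <;> rw [ha] <;> nlinarith

theorem exists_kernel_bound (hΩ : volume Ω ≠ ∞) (hτ : 0 ≤ τ) (hlam : SA.lam 0 = 0)
    (hc : SA.vec 0 =ᵐ[volume.restrict Ω] fun _ => c) (hmem : SA.vec 0 ∈ SB.domPow σ)
    (hproper : ∃ z, βh z ≠ ∞) {δ : ℝ} (hδ : 0 < δ) (R K Ky Kf : ℝ) :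
    ∃ Ka : ℝ, ∀ y₀ : SB.GraphSpace σ, ‖GraphSpace.toH y₀‖ ≤ R →
      Icc ((⨍ x in Ω, GraphSpace.toH y₀ x) - δ) ((⨍ x in Ω, GraphSpace.toH y₀ x) + δ)
        ⊆ subdiffDom βh →
      ∀ (u : L2 Ω) (y : SB.GraphSpace σ) (ψ : SA.EnergySpace r) (w : L2 Ω)
        (μ : SA.EnergySpace r), SystemAt SA SB r σ τ (energy βh) N y₀ u y ψ w μ →
        ‖y‖ ≤ Ky → ‖N (GraphSpace.toH y) - u‖ ≤ Kf → ‖phaseVelocity τ ψ w‖ ≤ K →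
        |⟪SA.kernelVec r, μ⟫| ≤ Ka := by
  obtain ⟨hc0, haverage⟩ := ne_zero_and_average_eq_of_constant hΩ hc (SA.orthonormal.1 0)
  set Q := |c| * R + δ
  obtain ⟨M, hM, hbound⟩ := exists_bound_subdiffDom hproper (half_pos hδ) Q
  set Kc := M * volume.real Ω + (K * ‖phaseMap (SA.embed r) τ‖ + Ky + Kf)
    * (Ky + Q / |c| * ‖(GraphSpace.ofMem hmem : SB.GraphSpace σ)‖)
  refine ⟨Kc / (δ / 2) * |c|, fun y₀ hy₀ hsub u y ψ w μ hsys hy hf hK => ?_⟩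
  set m := ⨍ x in Ω, GraphSpace.toH y₀ x with hm
  have hmR : |m| ≤ |c| * R := by
    rw [hm, haverage, abs_mul]
    gcongr
    refine (abs_real_inner_le_norm _ _).trans ?_
    rwa [SA.orthonormal.1 0, one_mul]
  have hmQ : Icc (m - δ) (m + δ) ⊆ Icc (-Q) Q :=
    Icc_subset_Icc (by linarith [(abs_le.1 hmR).1]) (by linarith [(abs_le.1 hmR).2])
  have hsource : ∀ a, m - δ ≤ a → a ≤ m + δ / 2 →
      ∃ g ∈ Icc a (a + δ / 2), ⟪SA.kernelVec r, μ⟫ / c * (g - m) ≤ Kc := fun a ha ha' => by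
    have haI : Icc a (a + δ / 2) ⊆ Icc (m - δ) (m + δ) := Icc_subset_Icc ha (by linarith)
    obtain ⟨g, hg, hβg⟩ := hbound a (haI.trans hmQ) (haI.trans hsub)
    exact ⟨g, hg, hsys.inner_kernelVec_div_mul_le hΩ hτ hlam hc (GraphSpace.toH_ofMem hmem) hM
      hβg (abs_le.2 (hmQ (haI hg))) hy hf hK⟩
  obtain ⟨g₁, hg₁, hle₁⟩ := hsource (m + δ / 2) (by linarith) le_rfl
  obtain ⟨g₂, hg₂, hle₂⟩ := hsource (m - δ) le_rfl (by linarith)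
  have htwo : |⟪SA.kernelVec r, μ⟫ / c| * (δ / 2) ≤ Kc :=
    abs_mul_le_of_two_sided hg₁.1 (hg₂.2.trans_eq (by ring)) hle₁ hle₂
  rwa [abs_div, ← le_div_iff₀ (half_pos hδ), div_le_iff₀ (abs_pos.2 hc0)] at htwo

end MeanValue

section InitialVelocity

open EigenSystem

section PhaseMap

variable {E H : Type*} [NormedAddCommGroup E] [InnerProductSpace ℝ E] [NormedAddCommGroup H]
  [InnerProductSpace ℝ H]

theorem norm_le_norm_phaseMap (i : H →L[ℝ] E) (τ : ℝ) (v : H) : ‖i v‖ ≤ ‖phaseMap i τ v‖ := by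
  rw [phaseMap_apply]
  exact WithLp.norm_fst_le E (WithLp.toLp 2 (i v, √τ • v))

theorem norm_sqrt_smul_le_norm_phaseMap (i : H →L[ℝ] E) (τ : ℝ) (v : H) :
    ‖√τ • v‖ ≤ ‖phaseMap i τ v‖ := by
  rw [phaseMap_apply]
  exact WithLp.norm_snd_le E (WithLp.toLp 2 (i v, √τ • v))

theorem norm_le_inv_mul_norm_phaseMap (i : H →L[ℝ] E) {τ : ℝ} (hτ : 0 < τ) (v : H) :
    ‖v‖ ≤ (√τ)⁻¹ * ‖phaseMap i τ v‖ := by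
  have hsqrt := Real.sqrt_pos.2 hτ
  rw [le_inv_mul_iff₀ hsqrt, ← norm_smul_of_nonneg hsqrt.le]
  exact norm_sqrt_smul_le_norm_phaseMap i τ v

end PhaseMap

theorem norm_le_of_lipschitzWith {X Y : Type*} [NormedAddCommGroup X] [NormedAddCommGroup Y]
    {N : X → Y} {L : ℝ≥0} (hN : LipschitzWith L N) {v : X} {a : ℝ} (hv : ‖v‖ ≤ a) :
    ‖N v‖ ≤ ‖N 0‖ + L * a := by
  calc ‖N v‖ ≤ ‖N 0‖ + ‖N v - N 0‖ := norm_le_norm_add_norm_sub' _ _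
    _ ≤ ‖N 0‖ + L * a := by
      gcongr
      refine (hN.norm_sub_le v 0).trans ?_
      rw [sub_zero]
      gcongr

variable {Ω : Set (EuclideanSpace ℝ (Fin 3))} {A B : L2 Ω →ₗ.[ℝ] L2 Ω}
  {SA : EigenSystem A} {SB : EigenSystem B} {r σ τ : ℝ} [Fact (0 < r)]
  {βh : ℝ → ℝ≥0∞} {πh : ℝ → ℝ} {N : L2 Ω → L2 Ω} {L : ℝ≥0} {C : ℝ}

namespace SystemAt

variable {x₀ : SB.GraphSpace (2 * σ)} {u w : L2 Ω} {y : SB.GraphSpace σ}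
  {ψ μ : SA.EnergySpace r}

theorem initial_le_of_viscous (hlsc : LowerSemicontinuous βh) (hN : LipschitzWith L N)
    (hτ : 0 < τ)
    (hC : IsAbsorptionConstant SA SB r σ τ L C)
    (hx₀ : energy βh (GraphSpace.toH x₀) ≠ ∞)
    (h : SystemAt SA SB r σ τ (energy βh) N (GraphSpace.ofTwoMul x₀) u y ψ w μ) {R Q : ℝ}
    (hdata : ViscousData βh (GraphSpace.toH x₀) R) (hx₀R : ‖x₀‖ ≤ R) (hu : ‖u‖ ≤ Q) :
    ⟪phaseVelocity τ ψ w,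
        phaseMap (SA.embed r) τ (GraphSpace.toH (y - GraphSpace.ofTwoMul x₀))⟫
      ≤ C * ‖phaseMap (SA.embed r) τ (GraphSpace.toH (y - GraphSpace.ofTwoMul x₀))‖ ^ 2
        + (√τ)⁻¹ * (R + R + (‖N 0‖ + L * R) + Q)
          * ‖phaseMap (SA.embed r) τ (GraphSpace.toH (y - GraphSpace.ofTwoMul x₀))‖ := by
  obtain ⟨b, hb, hbR⟩ := hdata
  have hsubgradient := energy_add_inner_le hlsc.measurable hx₀ h.energy_ne_top
    (hb.mono fun x hx => hx.1)
  have hforce : ‖GraphSpace.op x₀ + b + N (GraphSpace.toH x₀) - u‖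
      ≤ R + R + (‖N 0‖ + L * R) + Q := by
    refine norm_sub_le_of_le (norm_add_le_of_le (norm_add_le_of_le ?_ hbR) ?_) hu
    · exact (GraphSpace.norm_op_le x₀).trans hx₀R
    · exact norm_le_of_lipschitzWith hN ((GraphSpace.norm_toH_le x₀).trans hx₀R)
  rw [← add_zero (_ + _)]
  refine h.initial_le hτ.le hN hC hx₀ (b := b) (by rwa [add_zero]) ?_
  rw [neg_le, mul_right_comm, mul_comm _ (R + R + (‖N 0‖ + L * R) + Q)]
  exact neg_mul_le_inner hforce (norm_le_inv_mul_norm_phaseMap _ hτ _)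

theorem initial_le_of_nonviscous (hconv : ConvexOn ℝ≥0 univ βh) (hlsc : LowerSemicontinuous βh)
    (hNae : ∀ v : L2 Ω, N v =ᵐ[volume.restrict Ω] fun x => deriv πh (v x))
    (hN : LipschitzWith L N) (hτ : 0 ≤ τ)
    (hC : IsAbsorptionConstant SA SB r σ τ L C)
    (hx₀ : energy βh (GraphSpace.toH x₀) ≠ ∞)
    (h : SystemAt SA SB r σ τ (energy βh) N (GraphSpace.ofTwoMul x₀) u y ψ w μ) {M₀ : ℝ}
    (hdata : ∀ᶠ lam in 𝓝[>] (0 : ℝ), ∃ m : SA.EnergySpace r,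
      (∀ᵐ x ∂(volume.restrict Ω), EnergySpace.toH m x =
        GraphSpace.op x₀ x + yosida βh lam (GraphSpace.toH x₀ x)
          + deriv πh (GraphSpace.toH x₀ x) - u x) ∧ ‖m‖ ≤ M₀) :
    ⟪phaseVelocity τ ψ w,
        phaseMap (SA.embed r) τ (GraphSpace.toH (y - GraphSpace.ofTwoMul x₀))⟫
      ≤ C * ‖phaseMap (SA.embed r) τ (GraphSpace.toH (y - GraphSpace.ofTwoMul x₀))‖ ^ 2
        + M₀ * ‖phaseMap (SA.embed r) τ (GraphSpace.toH (y - GraphSpace.ofTwoMul x₀))‖ := by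
  obtain ⟨m, hm⟩ := hdata.choice
  set b : ℝ → L2 Ω := fun lam =>
    EnergySpace.toH (m lam) - GraphSpace.op x₀ - N (GraphSpace.toH x₀) + u with hb
  have hyosida : ∀ᶠ lam in 𝓝[>] (0 : ℝ),
      b lam =ᵐ[volume.restrict Ω] fun x => yosida βh lam (GraphSpace.toH x₀ x) := by
    filter_upwards [hm] with lam ⟨hmx, _⟩
    filter_upwards [hmx, hNae (GraphSpace.toH x₀),
      Lp.coeFn_add (EnergySpace.toH (m lam) - GraphSpace.op x₀ - N (GraphSpace.toH x₀)) u,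
      Lp.coeFn_sub (EnergySpace.toH (m lam) - GraphSpace.op x₀) (N (GraphSpace.toH x₀)),
      Lp.coeFn_sub (EnergySpace.toH (m lam)) (GraphSpace.op x₀)] with x hmx hNx hadd hsub hsub'
    rw [hb, hadd, Pi.add_apply, hsub, Pi.sub_apply, hsub', Pi.sub_apply, hmx, hNx]
    ring
  refine le_of_forall_pos_le_add fun η hη => ?_
  obtain ⟨lam, ⟨-, hmM⟩, hsubgradient⟩ :=
    (hm.and (eventually_energy_add_inner_le hconv hlsc hyosida hx₀ hη)).exists
  refine h.initial_le hτ hN hC hx₀ (hsubgradient _ h.energy_ne_top) ?_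
  have hforce : GraphSpace.op x₀ + b lam + N (GraphSpace.toH x₀) - u
      = EnergySpace.toH (m lam) := by
    simp only [hb]
    abel
  rw [hforce, real_inner_comm, ← SA.inner_embed, real_inner_comm, neg_le]
  exact neg_mul_le_inner hmM (norm_le_norm_phaseMap _ τ _)

end SystemAt

end InitialVelocity

section VelocityEstimate

open EigenSystem

variable {Ω : Set (EuclideanSpace ℝ (Fin 3))} {A B : L2 Ω →ₗ.[ℝ] L2 Ω}

/-- Data of the Cauchy problem whose norms are at most `R`, with the conditions on the mean value,
through `δ₀`, and on the initial chemical potential, through `M₀`. -/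
structure BoundedData (SA : EigenSystem A) (SB : EigenSystem B) (r σ τ : ℝ) (βh : ℝ → ℝ≥0∞)
    (πh : ℝ → ℝ) (T R δ₀ M₀ : ℝ) (u du : ℝ → L2 Ω) (x₀ : SB.GraphSpace (2 * σ)) : Prop where
  isH1 : IsH1 T u du
  eLpNorm_le : eLpNorm u 2 (timeMeasure T) ≤ ENNReal.ofReal R
  eLpNorm_deriv_le : eLpNorm du 2 (timeMeasure T) ≤ ENNReal.ofReal R
  norm_le : ‖x₀‖ ≤ R
  energy_le : energy βh (GraphSpace.toH x₀) ≤ ENNReal.ofReal R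
  mean : SA.lam 0 = 0 →
    Icc ((⨍ x in Ω, GraphSpace.toH x₀ x) - δ₀) ((⨍ x in Ω, GraphSpace.toH x₀ x) + δ₀)
      ⊆ subdiffDom βh
  viscous : 0 < τ → ViscousData βh (GraphSpace.toH x₀) R
  nonviscous : τ = 0 → NonviscousData SA SB r σ βh πh u x₀ M₀

/-- The bound of `IsH1.norm_le` for the source. -/
def sourceBound (T R : ℝ) : ℝ := (R + 1) / √T + √T * R

/-- A bound for the initial velocity: the first summand comes from the viscous case, and the second
one from the nonviscous case, where the first vanishes since `(√0)⁻¹ = 0`. -/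
def initialBound (τ T : ℝ) (N : L2 Ω → L2 Ω) (L : ℝ≥0) (R M₀ : ℝ) : ℝ :=
  (√τ)⁻¹ * (R + R + (‖N 0‖ + L * R) + sourceBound T R) + |M₀|

variable {SA : EigenSystem A} {SB : EigenSystem B} {r σ τ T R δ₀ M₀ : ℝ}
  {βh : ℝ → ℝ≥0∞} {πh : ℝ → ℝ} {N : L2 Ω → L2 Ω} {L : ℝ≥0} {C : ℝ}

theorem initialBound_nonneg (hR : 0 ≤ R) : 0 ≤ initialBound τ T N L R M₀ := by
  unfold initialBound sourceBound
  positivity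

namespace BoundedData

variable {u du : ℝ → L2 Ω} {x₀ : SB.GraphSpace (2 * σ)}

theorem energy_ne_top (D : BoundedData SA SB r σ τ βh πh T R δ₀ M₀ u du x₀) :
    energy βh (GraphSpace.toH x₀) ≠ ∞ :=
  (D.energy_le.trans_lt ENNReal.ofReal_lt_top).ne

theorem norm_toH_le (D : BoundedData SA SB r σ τ βh πh T R δ₀ M₀ u du x₀) :
    ‖GraphSpace.toH x₀‖ ≤ R :=
  (GraphSpace.norm_toH_le x₀).trans D.norm_le

theorem nonneg (D : BoundedData SA SB r σ τ βh πh T R δ₀ M₀ u du x₀) : 0 ≤ R :=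
  (norm_nonneg x₀).trans D.norm_le

theorem norm_source_le (D : BoundedData SA SB r σ τ βh πh T R δ₀ M₀ u du x₀) (hT : 0 < T) {t : ℝ}
    (ht : t ∈ Icc 0 T) : ‖u t‖ ≤ sourceBound T R :=
  D.isH1.norm_le hT D.nonneg D.eLpNorm_le D.eLpNorm_deriv_le ht

variable [Fact (0 < r)]

theorem exists_initial_le (D : BoundedData SA SB r σ τ βh πh T R δ₀ M₀ u du x₀)
    (hconv : ConvexOn ℝ≥0 univ βh) (hlsc : LowerSemicontinuous βh) (hT : 0 < T) (hτ : 0 ≤ τ)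
    (hNae : ∀ v : L2 Ω, N v =ᵐ[volume.restrict Ω] fun x => deriv πh (v x))
    (hN : LipschitzWith L N) (hC : IsAbsorptionConstant SA SB r σ τ L C) :
    ∃ ε > 0, ∀ t ∈ Ioo 0 T, t < ε →
      ∀ (y : SB.GraphSpace σ) (ψ : SA.EnergySpace r) (w : L2 Ω) (μ : SA.EnergySpace r),
      SystemAt SA SB r σ τ (energy βh) N (GraphSpace.ofTwoMul x₀) (u t) y ψ w μ →
      ⟪phaseVelocity τ ψ w,
          phaseMap (SA.embed r) τ (GraphSpace.toH (y - GraphSpace.ofTwoMul x₀))⟫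
        ≤ C * ‖phaseMap (SA.embed r) τ (GraphSpace.toH (y - GraphSpace.ofTwoMul x₀))‖ ^ 2
          + initialBound τ T N L R M₀
            * ‖phaseMap (SA.embed r) τ (GraphSpace.toH (y - GraphSpace.ofTwoMul x₀))‖ := by
  rcases hτ.eq_or_lt with rfl | hτ
  · obtain ⟨ε, hε, hdata⟩ := D.nonviscous rfl
    refine ⟨ε, hε, fun t ht htε y ψ w μ h => ?_⟩
    refine (h.initial_le_of_nonviscous (M₀ := M₀) hconv hlsc hNae hN le_rfl hC D.energy_ne_top
      ?_).trans ?_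
    · filter_upwards [Ioo_mem_nhdsGT hε] with lam hlam
      exact hdata lam hlam t ⟨ht.1, htε⟩
    · rw [initialBound, Real.sqrt_zero, inv_zero, zero_mul, zero_add]
      gcongr
      exact le_abs_self M₀
  · refine ⟨1, one_pos, fun t ht _ y ψ w μ h => ?_⟩
    refine (h.initial_le_of_viscous hlsc hN hτ hC D.energy_ne_top (D.viscous hτ) D.norm_le
      (D.norm_source_le hT (Ioo_subset_Icc_self ht))).trans ?_
    rw [initialBound]
    gcongr
    exact le_add_of_nonneg_right (abs_nonneg M₀)

theorem exists_dissipativeEvolution (D : BoundedData SA SB r σ τ βh πh T R δ₀ M₀ u du x₀)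
    (hconv : ConvexOn ℝ≥0 univ βh) (hlsc : LowerSemicontinuous βh) (hT : 0 < T) (hτ : 0 ≤ τ)
    (hNae : ∀ v : L2 Ω, N v =ᵐ[volume.restrict Ω] fun x => deriv πh (v x))
    (hN : LipschitzWith L N) (hC : IsAbsorptionConstant SA SB r σ τ L C)
    {y : ℝ → SB.GraphSpace σ} {dy : ℝ → SA.DualSpace r} {μ : ℝ → SA.EnergySpace r}
    (hsol : IsSolution SA SB r σ τ T βh πh u (GraphSpace.toH (GraphSpace.ofTwoMul x₀)) y dy μ)
    {w : ℝ → L2 Ω} (hw : MemLp w 2 (timeMeasure T))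
    (hwdy : ∀ᵐ t ∂(timeMeasure T), SA.embed r (w t) = τ • SA.riesz (dy t))
    (hsys : ∀ᵐ t ∂(timeMeasure T), SystemAt SA SB r σ τ (energy βh) N (GraphSpace.ofTwoMul x₀)
      (u t) (y t) (SA.riesz (dy t)) (w t) (μ t)) :
    ∃ ε > 0, ∃ S, DissipativeEvolution (phaseMap (SA.embed r) τ ∘L GraphSpace.toHL) T C
      (initialBound τ T N L R M₀) ε (fun t => phaseVelocity τ (SA.riesz (dy t)) (w t))
      (fun t => y t - GraphSpace.ofTwoMul x₀) u S := by
  obtain ⟨ε, hε, hinitial⟩ := D.exists_initial_le hconv hlsc hT hτ hNae hN hC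
  refine ⟨ε, hε, {t | t ∈ Ioo 0 T ∧
    SystemAt SA SB r σ τ (energy βh) N (GraphSpace.ofTwoMul x₀) (u t) (y t) (SA.riesz (dy t))
      (w t) (μ t) ∧
    SA.embed r (GraphSpace.toH (y t - GraphSpace.ofTwoMul x₀))
      = ∫ s in (0 : ℝ)..t, SA.riesz (dy s)}, ?_⟩
  exact
    { memLp_rhs := memLp_phaseVelocity hsol.memLp_riesz hw τ
      memLp := (hsol.y_memLp.mono_exponent le_top).sub (memLp_const _)
      ae_mem := by
        filter_upwards [ae_restrict_mem measurableSet_Ioo, hsys,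
          hsol.ae_embed_sub_eq_integral hT.le] with t ht hsys hint using ⟨ht, hsys, hint⟩
      map_eq_integral := fun t ⟨ht, _, hint⟩ =>
        phaseMap_eq_integral SA.embed_injective hsol.memLp_riesz hw hwdy
          (Ioo_subset_Icc_self ht) hint
      increment_le := fun s ⟨_, hs, _⟩ t ⟨_, ht, _⟩ => by
        rw [sub_sub_sub_cancel_right]
        exact ht.increment_le hτ hN hC hs
      initial_le := fun t ⟨htm, ht, _⟩ htε => hinitial t htm htε _ _ _ _ ht }

end BoundedData

/-- The a priori estimate for the time derivative `z` of `y`, as an element of `D(B^σ)`, and for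
the pair of `∂ₜy` in the dual of `D(A^r)` and of `√τ ∂ₜy` in `H`, which is
`phaseVelocity τ (SA.riesz (dy t)) (w t)` with `w = τ ∂ₜy`. -/
structure VelocityBound (SA : EigenSystem A) (SB : EigenSystem B) (r σ τ T : ℝ) [Fact (0 < r)]
    (βh : ℝ → ℝ≥0∞) (N : L2 Ω → L2 Ω) (K : ℝ) (u : ℝ → L2 Ω) (y₀ : SB.GraphSpace σ)
    (y : ℝ → SB.GraphSpace σ) (dy : ℝ → SA.DualSpace r) (μ : ℝ → SA.EnergySpace r)
    (w : ℝ → L2 Ω) (z : ℝ → SB.GraphSpace σ) : Prop where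
  systemAt : ∀ᵐ t ∂(timeMeasure T), SystemAt SA SB r σ τ (energy βh) N y₀ (u t) (y t)
    (SA.riesz (dy t)) (w t) (μ t)
  memLp : MemLp z 2 (timeMeasure T)
  eLpNorm_le : eLpNorm z 2 (timeMeasure T) ≤ ENNReal.ofReal K
  phaseMap_eq : ∀ᵐ t ∂(timeMeasure T),
    phaseMap (SA.embed r) τ (GraphSpace.toH (z t)) = phaseVelocity τ (SA.riesz (dy t)) (w t)
  norm_le : ∀ᵐ t ∂(timeMeasure T), ‖phaseVelocity τ (SA.riesz (dy t)) (w t)‖ ≤ K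
  sub_eq_integral : ∀ᵐ t ∂(timeMeasure T), y t - y₀ = ∫ s in (0 : ℝ)..t, z s

variable [Fact (0 < r)]

theorem exists_velocityBound (hconv : ConvexOn ℝ≥0 univ βh) (hlsc : LowerSemicontinuous βh)
    (hker : 0 < SA.lam 1) (hσ : 0 < σ) (hT : 0 < T) (hτ : 0 ≤ τ)
    (hNae : ∀ v : L2 Ω, N v =ᵐ[volume.restrict Ω] fun x => deriv πh (v x))
    (hN : LipschitzWith L N) (R δ₀ M₀ : ℝ) :
    ∃ K : ℝ, 0 ≤ K ∧ ∀ (u du : ℝ → L2 Ω) (x₀ : SB.GraphSpace (2 * σ)),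
      BoundedData SA SB r σ τ βh πh T R δ₀ M₀ u du x₀ →
      ∀ (y : ℝ → SB.GraphSpace σ) (dy : ℝ → SA.DualSpace r) (μ : ℝ → SA.EnergySpace r),
        IsSolution SA SB r σ τ T βh πh u (GraphSpace.toH x₀) y dy μ →
        ∃ w z, VelocityBound SA SB r σ τ T βh N K u (GraphSpace.ofTwoMul x₀) y dy μ w z := by
  have : Fact ((2 : ℝ≥0∞) ≠ ∞) := ⟨ENNReal.ofNat_ne_top⟩
  obtain ⟨C, hC⟩ := exists_isAbsorptionConstant (SA := SA) (SB := SB) (r := r) hσ τ L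
  refine ⟨evolutionBound T C (initialBound τ T N L R M₀) R, evolutionBound_nonneg _ _ _ _,
    fun u du x₀ D y dy μ hsol => ?_⟩
  rw [← GraphSpace.toH_ofTwoMul x₀] at hsol
  obtain ⟨w, hw, hwdy, hsys⟩ := hsol.exists_ae_systemAt hker hT.le hNae
    (by rw [GraphSpace.toH_ofTwoMul]; exact D.energy_ne_top)
  obtain ⟨ε, hε, S, E⟩ := D.exists_dissipativeEvolution hconv hlsc hT hτ hNae hN hC hsol hw hwdy
    hsys
  have hj : Function.Injective (phaseMap (SA.embed r) τ ∘L GraphSpace.toHL (S := SB) (s := σ)) :=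
    (phaseMap_injective SA.embed_injective τ).comp GraphSpace.toH_injective
  obtain ⟨⟨z, hz, hzK, hjz⟩, hK⟩ := E.exists_memLp_deriv hj hT (one_half_pos.le.trans hC.half_le)
    (initialBound_nonneg D.nonneg) D.nonneg hε D.isH1 D.eLpNorm_deriv_le
  refine ⟨w, z, hsys, hz, hzK, hjz, hK, ?_⟩
  filter_upwards [E.ae_mem, ae_restrict_mem measurableSet_Ioo] with t htS ht
  refine hj ?_
  have hint : IntervalIntegrable z volume 0 t :=
    (IsPrimitive.of_memLp hT.le one_le_two hz).intervalIntegrable_of_mem ⟨le_rfl, hT.le⟩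
      (Ioo_subset_Icc_self ht)
  rw [E.map_eq_integral t htS, ← ContinuousLinearMap.intervalIntegral_comp_comm _ hint,
    ← integral_timeMeasure ht.1.le, ← integral_timeMeasure ht.1.le]
  refine integral_congr_ae ?_
  filter_upwards [ae_mono (timeMeasure_mono ht.2.le) hjz] with s hs using hs.symm

namespace VelocityBound

variable {K : ℝ} {u : ℝ → L2 Ω} {y₀ : SB.GraphSpace σ} {y : ℝ → SB.GraphSpace σ}
  {dy : ℝ → SA.DualSpace r} {μ : ℝ → SA.EnergySpace r} {w : ℝ → L2 Ω} {z : ℝ → SB.GraphSpace σ}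

theorem ae_represents (V : VelocityBound SA SB r σ τ T βh N K u y₀ y dy μ w z) :
    ∀ᵐ t ∂(timeMeasure T), SA.Represents (dy t) (GraphSpace.toH (z t)) := by
  filter_upwards [V.phaseMap_eq] with t ht
  rw [phaseMap_apply] at ht
  exact SA.represents_iff.2 (congrArg WithLp.fst ht).symm

theorem ae_norm_deriv_le (V : VelocityBound SA SB r σ τ T βh N K u y₀ y dy μ w z) :
    ∀ᵐ t ∂(timeMeasure T), ‖dy t‖ ≤ K := by
  filter_upwards [V.ae_represents, V.phaseMap_eq, V.norm_le] with t hrep hphase hK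
  rw [← SA.riesz.norm_map, SA.represents_iff.1 hrep]
  exact (norm_le_norm_phaseMap _ τ _).trans (hphase ▸ hK)

theorem ae_norm_sqrt_smul_toH_le (V : VelocityBound SA SB r σ τ T βh N K u y₀ y dy μ w z) :
    ∀ᵐ t ∂(timeMeasure T), ‖√τ • GraphSpace.toH (z t)‖ ≤ K := by
  filter_upwards [V.phaseMap_eq, V.norm_le] with t hphase hK
  exact (norm_sqrt_smul_le_norm_phaseMap (SA.embed r) τ _).trans (hphase ▸ hK)

theorem ae_norm_toH_le (V : VelocityBound SA SB r σ τ T βh N K u y₀ y dy μ w z) (hτ : 0 < τ) :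
    ∀ᵐ t ∂(timeMeasure T), ‖GraphSpace.toH (z t)‖ ≤ (√τ)⁻¹ * K := by
  have hsqrt := Real.sqrt_pos.2 hτ
  filter_upwards [V.ae_norm_sqrt_smul_toH_le] with t ht
  rwa [le_inv_mul_iff₀ hsqrt, ← norm_smul_of_nonneg hsqrt.le]

theorem ae_norm_le (V : VelocityBound SA SB r σ τ T βh N K u y₀ y dy μ w z) (hT : 0 ≤ T)
    (hK : 0 ≤ K) {Q : ℝ} (hy₀ : ‖y₀‖ ≤ Q) :
    ∀ᵐ t ∂(timeMeasure T), ‖y t‖ ≤ Q + √T * K := by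
  filter_upwards [V.sub_eq_integral, ae_restrict_mem measurableSet_Ioo] with t hint ht
  rw [← add_sub_cancel y₀ (y t), hint]
  exact norm_add_le_of_le hy₀ (norm_integral_le_sqrt_mul V.memLp.1 hT hK V.eLpNorm_le ⟨le_rfl, hT⟩
    (Ioo_subset_Icc_self ht))

end VelocityBound

end VelocityEstimate

section PotentialEstimate

open EigenSystem

variable {Ω : Set (EuclideanSpace ℝ (Fin 3))} {A B : L2 Ω →ₗ.[ℝ] L2 Ω}
  {SA : EigenSystem A} {SB : EigenSystem B} {r σ τ T K : ℝ} [Fact (0 < r)]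
  {βh : ℝ → ℝ≥0∞} {πh : ℝ → ℝ} {N : L2 Ω → L2 Ω} {L : ℝ≥0}

theorem eLpNorm_top_le_of_ae_bound {α E : Type*} [MeasurableSpace α] {m : Measure α}
    [NormedAddCommGroup E] {f : α → E} {C : ℝ} (h : ∀ᵐ x ∂m, ‖f x‖ ≤ C) :
    eLpNorm f ∞ m ≤ ENNReal.ofReal C := by
  rw [eLpNorm_exponent_top]
  exact eLpNormEssSup_le_of_ae_bound h

theorem SystemAt.norm_potential_le {Φ : L2 Ω → ℝ≥0∞} {y₀ y : SB.GraphSpace σ} {u w : L2 Ω}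
    {ψ μ : SA.EnergySpace r} (h : SystemAt SA SB r σ τ Φ N y₀ u y ψ w μ) {a : ℝ}
    (ha : |⟪SA.kernelVec r, μ⟫| ≤ a) : ‖μ‖ ≤ ‖ψ‖ + a := by
  have hμ : μ = -ψ + ⟪SA.kernelVec r, μ⟫ • SA.kernelVec r := by
    rw [h.riesz_eq, neg_neg, sub_add_cancel]
  rw [hμ]
  refine norm_add_le_of_le (norm_neg ψ).le ?_
  rw [norm_smul]
  exact (mul_le_of_le_one_right (abs_nonneg _) SA.norm_kernelVec_le_one).trans ha

theorem exists_norm_potential_le (hΩ : volume Ω ≠ ∞) (hτ : 0 ≤ τ)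
    (hsimple : SA.lam 0 = 0 → ∃ c : ℝ, SA.vec 0 =ᵐ[volume.restrict Ω] fun _ => c)
    (hmem : SA.lam 0 = 0 → SA.vec 0 ∈ SB.domPow σ) (hproper : ∃ s, βh s ≠ ∞) {δ : ℝ} (hδ : 0 < δ)
    (R K Ky Kf : ℝ) :
    ∃ Kμ : ℝ, ∀ y₀ : SB.GraphSpace σ, ‖GraphSpace.toH y₀‖ ≤ R →
      (SA.lam 0 = 0 → Icc ((⨍ x in Ω, GraphSpace.toH y₀ x) - δ)
        ((⨍ x in Ω, GraphSpace.toH y₀ x) + δ) ⊆ subdiffDom βh) →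
      ∀ (u : L2 Ω) (y : SB.GraphSpace σ) (ψ : SA.EnergySpace r) (w : L2 Ω)
        (μ : SA.EnergySpace r), SystemAt SA SB r σ τ (energy βh) N y₀ u y ψ w μ →
        ‖y‖ ≤ Ky → ‖N (GraphSpace.toH y) - u‖ ≤ Kf → ‖phaseVelocity τ ψ w‖ ≤ K → ‖μ‖ ≤ Kμ := by
  have hψ (ψ : SA.EnergySpace r) (w : L2 Ω) : ‖ψ‖ ≤ ‖phaseVelocity τ ψ w‖ :=
    WithLp.norm_fst_le (SA.EnergySpace r) (phaseVelocity τ ψ w)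
  by_cases hlam : SA.lam 0 = 0
  · obtain ⟨c, hc⟩ := hsimple hlam
    obtain ⟨Ka, hKa⟩ := exists_kernel_bound (r := r) (N := N) hΩ hτ hlam hc (hmem hlam) hproper hδ
      R K Ky Kf
    refine ⟨K + Ka, fun y₀ hy₀ hsub u y ψ w μ h hy hf hK => ?_⟩
    refine (h.norm_potential_le (hKa y₀ hy₀ (hsub hlam) u y ψ w μ h hy hf hK)).trans ?_
    gcongr
    exact (hψ ψ w).trans hK
  · refine ⟨K, fun y₀ _ _ u y ψ w μ h _ _ hK => ?_⟩
    refine (h.norm_potential_le (a := 0) ?_).trans ?_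
    · rw [inner_kernelVec, if_neg hlam, abs_zero]
    · rw [add_zero]
      exact (hψ ψ w).trans hK

theorem exists_potentialBound (hΩ : volume Ω ≠ ∞) (hT : 0 < T) (hτ : 0 ≤ τ)
    (hN : LipschitzWith L N)
    (hsimple : SA.lam 0 = 0 → ∃ c : ℝ, SA.vec 0 =ᵐ[volume.restrict Ω] fun _ => c)
    (hmem : SA.lam 0 = 0 → SA.vec 0 ∈ SB.domPow σ) (hproper : ∃ s, βh s ≠ ∞) {δ₀ : ℝ}
    (hδ₀ : 0 < δ₀) (hK : 0 ≤ K) (R M₀ : ℝ) :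
    ∃ Kμ : ℝ, 0 ≤ Kμ ∧ ∀ (u du : ℝ → L2 Ω) (x₀ : SB.GraphSpace (2 * σ)),
      BoundedData SA SB r σ τ βh πh T R δ₀ M₀ u du x₀ →
      ∀ (y : ℝ → SB.GraphSpace σ) (dy : ℝ → SA.DualSpace r) (μ : ℝ → SA.EnergySpace r)
        (w : ℝ → L2 Ω) (z : ℝ → SB.GraphSpace σ),
        VelocityBound SA SB r σ τ T βh N K u (GraphSpace.ofTwoMul x₀) y dy μ w z →
        ∀ᵐ t ∂(timeMeasure T), ‖μ t‖ ≤ Kμ := by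
  set Ky := 2 * R + √T * K
  obtain ⟨Kμ, hKμ⟩ := exists_norm_potential_le (r := r) (N := N) hΩ hτ hsimple hmem hproper hδ₀ R K
    Ky (‖N 0‖ + L * Ky + sourceBound T R)
  refine ⟨|Kμ|, abs_nonneg Kμ, fun u du x₀ D y dy μ w z V => ?_⟩
  have hx₀ : ‖GraphSpace.ofTwoMul x₀‖ ≤ 2 * R :=
    (GraphSpace.norm_ofTwoMul_le x₀).trans (by gcongr; exact D.norm_le)
  filter_upwards [V.systemAt, V.norm_le, V.ae_norm_le hT.le hK hx₀,
    ae_restrict_mem measurableSet_Ioo] with t hsys hvelocity hy ht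
  have hforce : ‖N (GraphSpace.toH (y t)) - u t‖ ≤ ‖N 0‖ + L * Ky + sourceBound T R :=
    norm_sub_le_of_le (norm_le_of_lipschitzWith hN ((GraphSpace.norm_toH_le (y t)).trans hy))
      (D.norm_source_le hT (Ioo_subset_Icc_self ht))
  refine (hKμ (GraphSpace.ofTwoMul x₀) ?_ ?_ (u t) (y t) _ (w t) (μ t) hsys hy hforce
    hvelocity).trans (le_abs_self Kμ)
  · rw [GraphSpace.toH_ofTwoMul]
    exact D.norm_toH_le
  · rw [GraphSpace.toH_ofTwoMul]
    exact D.mean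

theorem IsSolution.exists_regular_potential (hker : 0 < SA.lam 1) {u : ℝ → L2 Ω} {x₀ : L2 Ω}
    {y : ℝ → SB.GraphSpace σ} {dy : ℝ → SA.DualSpace r} {μ : ℝ → SA.EnergySpace r}
    (hsol : IsSolution SA SB r σ τ T βh πh u x₀ y dy μ) {z : ℝ → L2 Ω}
    (hz : ∀ᵐ t ∂(timeMeasure T), SA.Represents (dy t) (z t)) :
    ∃ m : ℝ → SA.EnergySpace (2 * r), AEStronglyMeasurable m (timeMeasure T) ∧
      (∀ᵐ t ∂(timeMeasure T), EnergySpace.toH (m t) = EnergySpace.toH (μ t)) ∧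
      ∀ᵐ t ∂(timeMeasure T), ‖m t‖ ≤ ‖z t‖ + ‖μ t‖ := by
  have hr : 0 < r := Fact.out
  have : Fact (0 < 2 * r) := ⟨mul_pos two_pos hr⟩
  have : Fact ((2 : ℝ≥0∞) ≠ ∞) := ⟨ENNReal.ofNat_ne_top⟩
  have hexists : ∀ᵐ t ∂(timeMeasure T), ∃ m : SA.EnergySpace (2 * r),
      EnergySpace.toH m = EnergySpace.toH (μ t) ∧ ‖m‖ ≤ ‖z t‖ + ‖μ t‖ := by
    filter_upwards [hz, hsol.first] with t hrep hfirst
    refine EnergySpace.exists_energySpace_two_mul hr hker fun v => ?_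
    rw [← hrep v, hfirst v]
  obtain ⟨m, hm⟩ := skolem.1 hexists
  refine ⟨m, ?_, hm.mono fun t ht => ht.1, hm.mono fun t ht => ht.2⟩
  exact aestronglyMeasurable_of_comp (j := EnergySpace.toHL) EnergySpace.toH_injective
    ((EnergySpace.toHL (S := SA) (s := r)).continuous.comp_aestronglyMeasurable hsol.mu_memLp.1)
    (hm.mono fun t ht => ht.1)

namespace VelocityBound

variable {u : ℝ → L2 Ω} {x₀ : L2 Ω} {y₀ : SB.GraphSpace σ} {y : ℝ → SB.GraphSpace σ}
  {dy : ℝ → SA.DualSpace r} {μ : ℝ → SA.EnergySpace r} {w : ℝ → L2 Ω} {z : ℝ → SB.GraphSpace σ}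

theorem memLp_toH (V : VelocityBound SA SB r σ τ T βh N K u y₀ y dy μ w z) (hτ : 0 < τ) :
    MemLp (fun t => GraphSpace.toH (z t)) ∞ (timeMeasure T) :=
  memLp_top_of_bound
    ((GraphSpace.toHL (S := SB) (s := σ)).continuous.comp_aestronglyMeasurable V.memLp.1) _
    (V.ae_norm_toH_le hτ)

theorem exists_regular_potential (V : VelocityBound SA SB r σ τ T βh N K u y₀ y dy μ w z)
    (hker : 0 < SA.lam 1) (hsol : IsSolution SA SB r σ τ T βh πh u x₀ y dy μ) {Kμ : ℝ}
    (hμ : ∀ᵐ t ∂(timeMeasure T), ‖μ t‖ ≤ Kμ) :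
    ∃ m : ℝ → SA.EnergySpace (2 * r),
      (∀ᵐ t ∂(timeMeasure T), EnergySpace.toH (m t) = EnergySpace.toH (μ t)) ∧
      (0 < τ → MemLp m ∞ (timeMeasure T)) ∧
      ∀ᵐ t ∂(timeMeasure T), ‖√τ • m t‖ ≤ K + √τ * Kμ := by
  obtain ⟨m, hm, hmμ, hbound⟩ := hsol.exists_regular_potential hker V.ae_represents
  refine ⟨m, hmμ, fun hτ => memLp_top_of_bound hm ((√τ)⁻¹ * K + Kμ) ?_, ?_⟩
  · filter_upwards [hbound, V.ae_norm_toH_le hτ, hμ] with t ht hz hμ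
    exact ht.trans (add_le_add hz hμ)
  · filter_upwards [hbound, V.ae_norm_sqrt_smul_toH_le, hμ] with t ht hz hμ
    rw [norm_smul_of_nonneg (Real.sqrt_nonneg τ)] at hz ⊢
    calc √τ * ‖m t‖ ≤ √τ * (‖GraphSpace.toH (z t)‖ + ‖μ t‖) := by gcongr
      _ ≤ K + √τ * Kμ := by
        rw [mul_add]
        gcongr

end VelocityBound

end PotentialEstimate

end FracCH

end

open FracCH EigenSystem in
theorem theorem2p2_general
    (Ω : Set (EuclideanSpace ℝ (Fin 3))) (hΩ : volume Ω ≠ ∞)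
    (A B : L2 Ω →ₗ.[ℝ] L2 Ω) (SA : EigenSystem A) (SB : EigenSystem B)
    (r σ : ℝ) (hr : 0 < r) (hσ : 0 < σ)
    (hsimple : 0 < SA.lam 0 ∨ (SA.lam 0 = 0 ∧ 0 < SA.lam 1 ∧
      ∃ c : ℝ, SA.vec 0 =ᵐ[volume.restrict Ω] fun _ => c))
    (hconst : SA.lam 0 = 0 → ∀ (c : ℝ) (v : L2 Ω), (v =ᵐ[volume.restrict Ω] fun _ => c) →
      v ∈ SB.domPow σ)
    (τ : ℝ) (hτ : 0 ≤ τ)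
    (βh : ℝ → ℝ≥0∞) (hconv : ConvexOn ℝ≥0 univ βh) (hlsc : LowerSemicontinuous βh)
    (hproper : ∃ s, βh s ≠ ∞)
    (πh : ℝ → ℝ) (_hπ : Differentiable ℝ πh) (hlip : ∃ L : ℝ≥0, LipschitzWith L (deriv πh))
    (T : ℝ) (hT : 0 < T) (R δ₀ M₀ : ℝ) (hδ₀ : 0 < δ₀) :
    ∃ K₃ : ℝ, ∀ (u du : ℝ → L2 Ω) (y0 : SB.GraphSpace (2 * σ)),
      IsH1 T u du →
      eLpNorm u 2 (timeMeasure T) ≤ ENNReal.ofReal R →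
      eLpNorm du 2 (timeMeasure T) ≤ ENNReal.ofReal R →
      ‖y0‖ ≤ R →
      energy βh (GraphSpace.toH y0) ≤ ENNReal.ofReal R →
      (SA.lam 0 = 0 →
        Icc ((⨍ x in Ω, GraphSpace.toH y0 x) - δ₀) ((⨍ x in Ω, GraphSpace.toH y0 x) + δ₀)
          ⊆ subdiffDom βh) →
      (0 < τ → ViscousData βh (GraphSpace.toH y0) R) →
      (τ = 0 → NonviscousData SA SB r σ βh πh u y0 M₀) →
      ∀ (y : ℝ → SB.GraphSpace σ) (dy : ℝ → SA.DualSpace r) (μ : ℝ → SA.EnergySpace r),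
        IsSolution SA SB r σ τ T βh πh u (GraphSpace.toH y0) y dy μ →
        MemLp dy ∞ (timeMeasure T) ∧ MemLp μ ∞ (timeMeasure T) ∧
        ∃ z : ℝ → SB.GraphSpace σ,
          (∀ᵐ t ∂(timeMeasure T), SA.Represents (dy t) (GraphSpace.toH (z t))) ∧
          MemLp z 2 (timeMeasure T) ∧
          (0 < τ → MemLp (fun t => GraphSpace.toH (z t)) ∞ (timeMeasure T)) ∧
          (0 < τ → ∃ m : ℝ → SA.EnergySpace (2 * r),
            (∀ᵐ t ∂(timeMeasure T), EnergySpace.toH (m t) = EnergySpace.toH (μ t)) ∧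
            MemLp m ∞ (timeMeasure T)) ∧
          ∃ n : ℝ → SA.EnergySpace (2 * r),
            (∀ᵐ t ∂(timeMeasure T), EnergySpace.toH (n t) = √τ • EnergySpace.toH (μ t)) ∧
            eLpNorm dy ∞ (timeMeasure T) + eLpNorm z 2 (timeMeasure T)
              + eLpNorm μ ∞ (timeMeasure T)
              + eLpNorm (fun t => √τ • GraphSpace.toH (z t)) ∞ (timeMeasure T)
              + eLpNorm n ∞ (timeMeasure T) ≤ ENNReal.ofReal K₃ := by
  have := Fact.mk hr
  obtain ⟨L, hL⟩ := hlip
  obtain ⟨N, hN, hNae⟩ := exists_superposition hΩ hL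
  have hker : 0 < SA.lam 1 :=
    hsimple.elim (fun h => h.trans_le (SA.mono zero_le_one)) fun h => h.2.1
  have hvec (h : SA.lam 0 = 0) : ∃ c : ℝ, SA.vec 0 =ᵐ[volume.restrict Ω] fun _ => c :=
    (hsimple.resolve_left h.not_gt).2.2
  obtain ⟨K, hK, hvelocity⟩ := exists_velocityBound (SA := SA) (SB := SB) (r := r) hconv hlsc hker
    hσ hT hτ hNae hN R δ₀ M₀
  obtain ⟨Kμ, hKμ, hpotential⟩ := exists_potentialBound (SA := SA) (SB := SB) (r := r) hΩ hT hτ hN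
    hvec (fun h => (hvec h).elim fun c hc => hconst h c _ hc) hproper hδ₀ hK R M₀
  refine ⟨K + K + Kμ + K + (K + √τ * Kμ), fun u du y0 hu hu₂ hdu hy0 henergy hmean hviscous
    hnonviscous y dy μ hsol => ?_⟩
  have D : BoundedData SA SB r σ τ βh πh T R δ₀ M₀ u du y0 :=
    ⟨hu, hu₂, hdu, hy0, henergy, hmean, hviscous, hnonviscous⟩
  obtain ⟨w, z, V⟩ := hvelocity u du y0 D y dy μ hsol
  have hμ := hpotential u du y0 D y dy μ w z V
  obtain ⟨m, hmμ, hm, hmK⟩ := V.exists_regular_potential hker hsol hμ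
  refine ⟨memLp_top_of_bound hsol.dy_memLp.1 K V.ae_norm_deriv_le,
    memLp_top_of_bound hsol.mu_memLp.1 Kμ hμ, z, V.ae_represents, V.memLp, V.memLp_toH,
    fun h => ⟨m, hmμ, hm h⟩, fun t => √τ • m t, hmμ.mono fun t ht => by rw [map_smul, ht], ?_⟩
  rw [ENNReal.ofReal_add (by positivity) (by positivity), ENNReal.ofReal_add (by positivity) hK,
    ENNReal.ofReal_add (by positivity) hKμ, ENNReal.ofReal_add hK hK]
  exact add_le_add (add_le_add (add_le_add (add_le_add
    (eLpNorm_top_le_of_ae_bound V.ae_norm_deriv_le) V.eLpNorm_le) (eLpNorm_top_le_of_ae_bound hμ))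
    (eLpNorm_top_le_of_ae_bound V.ae_norm_sqrt_smul_toH_le)) (eLpNorm_top_le_of_ae_bound hmK)

open FracCH EigenSystem in
theorem theorem2p2
    (Ω : Set (EuclideanSpace ℝ (Fin 3))) (hΩo : IsOpen Ω) (hΩb : Bornology.IsBounded Ω)
    (hΩc : IsConnected Ω)
    (A B : L2 Ω →ₗ.[ℝ] L2 Ω) (hA : IsAdmissibleOperator A) (hB : IsAdmissibleOperator B)
    (SA : EigenSystem A) (SB : EigenSystem B)
    (r σ : ℝ) (hr : 0 < r) (hσ : 0 < σ)
    -- either the first eigenvalue of `A` is positive, or it is zero and simple with a constant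
    -- eigenfunction, and then the constants belong to `D(B^σ)`
    (hsimple : 0 < SA.lam 0 ∨ (SA.lam 0 = 0 ∧ 0 < SA.lam 1 ∧
      ∃ c : ℝ, SA.vec 0 =ᵐ[volume.restrict Ω] fun _ => c))
    (hconst : SA.lam 0 = 0 → ∀ (c : ℝ) (v : L2 Ω), (v =ᵐ[volume.restrict Ω] fun _ => c) →
      v ∈ SB.domPow σ)
    (τ : ℝ) (hτ : 0 ≤ τ)
    (βh : ℝ → ℝ≥0∞) (πh : ℝ → ℝ) (hpot : IsAdmissiblePotential βh πh)
    (T : ℝ) (hT : 0 < T)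
    -- a bound for the norms of the data, the width of an interval around the mean value, and the
    -- bound for the initial chemical potential if `τ = 0`
    (R δ₀ M₀ : ℝ) (hδ₀ : 0 < δ₀) :
    ∃ K₃ : ℝ, ∀ (u du : ℝ → L2 Ω) (y0 : SB.GraphSpace (2 * σ)),
      IsH1 T u du →
      eLpNorm u 2 (timeMeasure T) ≤ ENNReal.ofReal R →
      eLpNorm du 2 (timeMeasure T) ≤ ENNReal.ofReal R →
      ‖y0‖ ≤ R →
      energy βh (GraphSpace.toH y0) ≤ ENNReal.ofReal R →
      (SA.lam 0 = 0 →
        Icc ((⨍ x in Ω, GraphSpace.toH y0 x) - δ₀) ((⨍ x in Ω, GraphSpace.toH y0 x) + δ₀)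
          ⊆ subdiffDom βh) →
      (0 < τ → ViscousData βh (GraphSpace.toH y0) R) →
      (τ = 0 → NonviscousData SA SB r σ βh πh u y0 M₀) →
      ∀ (y : ℝ → SB.GraphSpace σ) (dy : ℝ → SA.DualSpace r) (μ : ℝ → SA.EnergySpace r),
        IsSolution SA SB r σ τ T βh πh u (GraphSpace.toH y0) y dy μ →
        MemLp dy ∞ (timeMeasure T) ∧ MemLp μ ∞ (timeMeasure T) ∧
        ∃ z : ℝ → SB.GraphSpace σ,
          (∀ᵐ t ∂(timeMeasure T), SA.Represents (dy t) (GraphSpace.toH (z t))) ∧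
          MemLp z 2 (timeMeasure T) ∧
          (0 < τ → MemLp (fun t => GraphSpace.toH (z t)) ∞ (timeMeasure T)) ∧
          (0 < τ → ∃ m : ℝ → SA.EnergySpace (2 * r),
            (∀ᵐ t ∂(timeMeasure T), EnergySpace.toH (m t) = EnergySpace.toH (μ t)) ∧
            MemLp m ∞ (timeMeasure T)) ∧
          ∃ n : ℝ → SA.EnergySpace (2 * r),
            (∀ᵐ t ∂(timeMeasure T), EnergySpace.toH (n t) = √τ • EnergySpace.toH (μ t)) ∧
            eLpNorm dy ∞ (timeMeasure T) + eLpNorm z 2 (timeMeasure T)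
              + eLpNorm μ ∞ (timeMeasure T)
              + eLpNorm (fun t => √τ • GraphSpace.toH (z t)) ∞ (timeMeasure T)
              + eLpNorm n ∞ (timeMeasure T) ≤ ENNReal.ofReal K₃ :=
  theorem2p2_general Ω hΩb.measure_lt_top.ne A B SA SB r σ hr hσ hsimple hconst τ hτ βh hpot.convex
    hpot.lsc ⟨0, by simp [hpot.zero]⟩ πh (hpot.contDiff.differentiable one_ne_zero) hpot.lipschitz
    T hT R δ₀ M₀ hδ₀
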